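/- **Theorem 4.3 (Global-in-time existence and uniqueness).** Let $\ell,T,\beta,p,q>0$, $I=(0,\ell)$, and let $H^m$ denote the $L^2$-based Sobolev spaces, whose elements are identified with their continuous representatives. Put $H^1_0(I)\cap H^2(I)=\{w\in H^2(I): w(0)=w(\ell)=0\}$. Let functions $u_0,u_1,u_2,\varphi$ on $I$ and $f$ on $(0,T)$ be given such that * (i1) $u_0,u_1\in H^4(I)$, $\varphi\in H^3(I)$, and $\varphi,\varphi',\varphi''$ vanish at $0$ and $\ell$; * (i2) $u_2\in H^2(I)$, $u_2-\beta u_2''=u_0''$ a.e. in $I$, and $v_0(x):=u_1(x)-u_1(\ell)\frac x\ell$, $v_1(x):=u_2(x)-u_2(\ell)\frac x\ell$ belong to $H^1_0(I)\cap H^2(I)$; * (i3) $\int_0^\ell\varphi'u_0''\,dx\ne0$; put $\alpha:=\big(\int_0^\ell\varphi'u_0''\,dx\big)^{-1}$; * (i4) $f\in H^4(0,T)$, $\int_0^\ell(\varphi-\beta\varphi'')u_0'\,dx=f(0)$, $\int_0^\ell(\varphi-\beta\varphi'')u_1'\,dx=f'(0)$, $\int_0^\ell(\varphi-\beta\varphi'')u_2'\,dx=f''(0)$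 and $\int_0^\ell(\varphi-\beta\varphi'')w\,dx=f'''(0)$, where $w\in H^2(I)$ solves $w-\beta w''=u_1'''-k_0u_0'''$ (the integral does not depend on the choice of $w$) and $k_0:=\alpha\big(f'''(0)+\int_0^\ell v_0\varphi'''\,dx\big)$; * (i5) $\psi(\ell)\ne0$, where $\psi(x):=\int_0^x\varphi\,ds-\beta\varphi'(x)$; put $y_2:=\frac1{\psi(\ell)}\big[f'(0)-k_0f(0)+\int_0^\ell\psi\,(u_1''-k_0u_0'')\,dx\big]$. For $y\in H^3(0,T)$ write $z:=py'+qy$. Then there are $$v\in H^2(0,T;H^1_0(I)\cap H^2(I)),\qquad k\in H^1(0,T),\qquad y\in H^3(0,T)$$ such that the following hold. 1. *(Equivalent problem.)* $(v,k,y)$ solves, on $I\times(0,T)$, $$v_{tt}-v_{xx}-\beta v_{xxtt}+k(t)u_0''+\int_0^tk(t-s)v_{xx}(x,s)\,ds=z''\tfrac x\ell,\qquad v|_{x=0}=v|_{x=\ell}=0,\qquad v|_{t=0}=v_0,\quad v_t|_{t=0}=v_1,$$ $$k'(t)=\alpha\Big\{f^{(iv)}(t)+\int_0^\ell v_t\varphi'''dx-k(0)\int_0^\ell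 v\varphi'''dx-\int_0^t\!\!\int_0^\ell k'(t-s)v(x,s)\varphi'''(x)\,dx\,ds\Big\},\qquad k(0)=k_0,$$ $$y'''(t)=\partial_tG(t)-k'(t)\,\widehat G_0-k(0)G(t)-\int_0^tk'(t-s)G(s)\,ds,\qquad y''(0)=y_2,$$ where $G(t)=\frac1{\psi(\ell)}\big(f'(t)+\int_0^\ell\psi v_{xx}(x,t)\,dx\big)$ and $\widehat G_0=\frac1{\psi(\ell)}\big(f(0)+\int_0^\ell\psi u_0''\,dx\big)$. For any solution $(\tilde v,\tilde k,\tilde y)$ of this problem with the same regularity, $(\tilde v,\tilde k)=(v,k)$ on $[0,T]$. 2. *(Inverse problem.)* $(v,k,y)$ is the unique triple with this regularity that solves $$v_{tt}-v_{xx}-\beta v_{xxtt}+k(t)u_0''+\int_0^tk(t-s)v_{xx}(x,s)\,ds=z''\tfrac x\ell,\qquad v|_{x=0}=v|_{x=\ell}=0,\qquad v|_{t=0}=v_0,\quad v_t|_{t=0}=v_1,$$ $$\Big[v_x-\int_0^tk(t-s)v_x(x,s)\,ds\Big]_{x=\ell}=y''(t)+k(t)u_0'(\ell)+\tfrac1\ell\Big(z(t)-\int_0^tk(t-s)z(s)\,ds\Big),\qquad\int_0^\ell(\varphi-\beta\varphi'')\Big[v_x-\frac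 z\ell\Big]dx=f'(t)$$ on $(0,T)$. 3. *(Recovery.)* If moreover $u_0(0)=0$ and $u_2(\ell)=-(p\,y_2+q\,u_0'(\ell))$, then $u(t):=u_0+\int_0^t\big[v(s)-z(s)\frac x\ell\big]ds$ defines, together with $k$ and $y$, the unique triple $(u,k,y)\in H^3(0,T;H^2(I))\times H^1(0,T)\times H^3(0,T)$ that solves the original problem $$u_{tt}-u_{xx}-\beta u_{xxtt}+\int_0^tk(t-s)u_{xx}(x,s)\,ds=0\ \text{ in } I\times(0,T),\qquad u|_{x=0}=0,$$ $$\Big[u_x-\int_0^tk(s)u_x(x,t-s)\,ds\Big]_{x=\ell}=y'(t),\qquad u_t|_{x=\ell}=-py'(t)-qy(t)\quad(0<t<T),$$ $$u|_{t=0}=u_0,\quad u_t|_{t=0}=u_1,\qquad\int_0^\ell(\varphi-\beta\varphi'')u_x(x,t)\,dx=f(t)\quad(0\le t\le T).$$ -/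

import Mathlib

open Set MeasureTheory
open scoped ContDiff

namespace AcousticInverse

noncomputable section

/-! ### Sobolev spaces of vector-valued functions on a bounded interval -/

/-- `u'` is the weak derivative of `u` on the open interval `(a, b)`: integration by parts holds
against every smooth test function with compact support in `(a, b)`. -/
def HasWeakDeriv {E : Type*} [NormedAddCommGroup E] [NormedSpace ℝ E] (a b : ℝ)
    (u u' : ℝ → E) : Prop :=
  ∀ θ : ℝ → ℝ, ContDiff ℝ ∞ θ → HasCompactSupport θ → tsupport θ ⊆ Ioo a b →
    ∫ t in Ioo a b, deriv θ t • u t = - ∫ t in Ioo a b, θ t • u' t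

/-- `D 0, D 1, …, D m` are the successive weak derivatives of an element `D 0` of
`H^m(a, b; E)`: all of them are in `L²(a, b; E)`, and all but the last one (which is only
determined almost everywhere) are the continuous representatives on `[a, b]`. -/
structure IsSobolevJet {E : Type*} [NormedAddCommGroup E] [NormedSpace ℝ E] (m : ℕ) (a b : ℝ)
    (D : ℕ → ℝ → E) : Prop where
  memLp : ∀ j ≤ m, MemLp (D j) 2 (volume.restrict (Ioo a b))
  continuousOn : ∀ j < m, ContinuousOn (D j) (Icc a b)
  weak : ∀ j < m, HasWeakDeriv a b (D j) (D (j + 1))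

/-- `u ∈ H^m(a, b; E)` for `m ≥ 1`, where `u` is the continuous representative on `[a, b]`. -/
def MemH {E : Type*} [NormedAddCommGroup E] [NormedSpace ℝ E] (m : ℕ) (a b : ℝ)
    (u : ℝ → E) : Prop :=
  ∃ D : ℕ → ℝ → E, IsSobolevJet m a b D ∧ EqOn (D 0) u (Icc a b)

open Classical in
/-- For `u ∈ H^m(a, b; E)` and `j ≤ m`, the `j`-th weak derivative of `u`. For `j < m` it is the
continuous representative on `[a, b]`; for `j = m` it is determined almost everywhere. -/
def wderiv {E : Type*} [NormedAddCommGroup E] [NormedSpace ℝ E] (m : ℕ) (a b : ℝ)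
    (u : ℝ → E) (j : ℕ) : ℝ → E :=
  if h : MemH m a b u then h.choose j else 0

theorem isSobolevJet_wderiv {E : Type*} [NormedAddCommGroup E] [NormedSpace ℝ E] {m : ℕ}
    {a b : ℝ} {u : ℝ → E} (h : MemH m a b u) :
    IsSobolevJet m a b (wderiv m a b u) ∧ EqOn (wderiv m a b u 0) u (Icc a b) := by
  have : wderiv m a b u = h.choose := by
    funext j
    simp [wderiv, h]
  rw [this]
  exact h.choose_spec

theorem integrable_smul_test {E : Type*} [NormedAddCommGroup E] [NormedSpace ℝ E] {a b : ℝ}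
    {u : ℝ → E} (hu : MemLp u 2 (volume.restrict (Ioo a b))) {θ : ℝ → ℝ} (hθ : Continuous θ) :
    Integrable (fun t => θ t • u t) (volume.restrict (Ioo a b)) := by
  have hu1 : IntegrableOn u (Ioo a b) := hu.integrable (by norm_num)
  obtain ⟨C, hC⟩ := (isCompact_Icc (a := a) (b := b)).exists_bound_of_continuousOn hθ.continuousOn
  refine hu1.bdd_smul C hθ.aestronglyMeasurable ?_
  filter_upwards [ae_restrict_mem measurableSet_Ioo] with t ht
  exact hC t (Ioo_subset_Icc_self ht)

theorem IsSobolevJet.add {E : Type*} [NormedAddCommGroup E] [NormedSpace ℝ E] {m : ℕ}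
    {a b : ℝ} {D D' : ℕ → ℝ → E} (h : IsSobolevJet m a b D) (h' : IsSobolevJet m a b D') :
    IsSobolevJet m a b (fun j t => D j t + D' j t) where
  memLp j hj := (h.memLp j hj).add (h'.memLp j hj)
  continuousOn j hj := (h.continuousOn j hj).add (h'.continuousOn j hj)
  weak j hj θ h1 h2 h3 := by
    have hd : Continuous (deriv θ) := h1.continuous_deriv (by simp)
    simp only [smul_add]
    rw [integral_add (integrable_smul_test (h.memLp j hj.le) hd)
        (integrable_smul_test (h'.memLp j hj.le) hd),
      integral_add (integrable_smul_test (h.memLp _ hj) h1.continuous)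
        (integrable_smul_test (h'.memLp _ hj) h1.continuous),
      h.weak j hj θ h1 h2 h3, h'.weak j hj θ h1 h2 h3, neg_add]

theorem IsSobolevJet.const_smul {E : Type*} [NormedAddCommGroup E] [NormedSpace ℝ E] {m : ℕ}
    {a b : ℝ} {D : ℕ → ℝ → E} (c : ℝ) (h : IsSobolevJet m a b D) :
    IsSobolevJet m a b (fun j t => c • D j t) where
  memLp j hj := (h.memLp j hj).const_smul c
  continuousOn j hj := (h.continuousOn j hj).const_smul c
  weak j hj θ h1 h2 h3 := by
    simp only [smul_comm _ c]
    rw [integral_smul, integral_smul, h.weak j hj θ h1 h2 h3, smul_neg]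

theorem isSobolevJet_zero {E : Type*} [NormedAddCommGroup E] [NormedSpace ℝ E] (m : ℕ)
    (a b : ℝ) : IsSobolevJet m a b (fun (_ : ℕ) (_ : ℝ) => (0 : E)) where
  memLp _ _ := MemLp.zero
  continuousOn _ _ := continuousOn_const
  weak _ _ _ _ _ _ := by simp

/-! ### The Banach spaces `H²(I)` and `H¹₀(I) ∩ H²(I)`, `I = (0, ℓ)` -/

/-- `L²(I)`. -/
abbrev L2 (ℓ : ℝ) : Type := Lp ℝ 2 (volume.restrict (Ioo (0 : ℝ) ℓ))

/-- `H²(I)`, realised as the space of triples `(w, w', w'')` in `L²(I)³` where `w'`, `w''` are the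
weak derivatives of `w`; the norm is the usual one, `‖w‖² = ‖w‖²_{L²} + ‖w'‖²_{L²} + ‖w''‖²_{L²}`. -/
def H2 (ℓ : ℝ) : Submodule ℝ (PiLp 2 (fun _ : Fin 3 => L2 ℓ)) where
  carrier := {w | ∃ D : ℕ → ℝ → ℝ, IsSobolevJet 2 0 ℓ D ∧
    ∀ i : Fin 3, w i =ᵐ[volume.restrict (Ioo 0 ℓ)] D i}
  zero_mem' := ⟨_, isSobolevJet_zero 2 0 ℓ, fun _ => Lp.coeFn_zero ..⟩
  add_mem' := by
    rintro w w' ⟨D, hD, h⟩ ⟨D', hD', h'⟩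
    refine ⟨_, hD.add hD', fun i => ?_⟩
    filter_upwards [h i, h' i, Lp.coeFn_add (w i) (w' i)] with x h1 h2 h3
    rw [PiLp.add_apply, h3, Pi.add_apply, h1, h2]
  smul_mem' := by
    rintro c w ⟨D, hD, h⟩
    refine ⟨_, hD.const_smul c, fun i => ?_⟩
    filter_upwards [h i, Lp.coeFn_smul c (w i)] with x h1 h3
    rw [PiLp.smul_apply, h3, Pi.smul_apply, h1]

/-- The `j`-th derivative of `w ∈ H²(I)` as a function: the continuous representative on `[0, ℓ]`
for `j = 0, 1`, a representative for `j = 2`. -/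
def jet {ℓ : ℝ} (w : H2 ℓ) : ℕ → ℝ → ℝ := w.2.choose

theorem isSobolevJet_jet {ℓ : ℝ} (w : H2 ℓ) :
    IsSobolevJet 2 0 ℓ (jet w) ∧
      ∀ i : Fin 3, w.1 i =ᵐ[volume.restrict (Ioo 0 ℓ)] jet w i :=
  w.2.choose_spec

/-- The value `w(x)`, `x ∈ [0, ℓ]`. -/
def val {ℓ : ℝ} (w : H2 ℓ) (x : ℝ) : ℝ := jet w 0 x

/-- The value `w'(x)`, `x ∈ [0, ℓ]`. -/
def dx {ℓ : ℝ} (w : H2 ℓ) (x : ℝ) : ℝ := jet w 1 x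

/-- The second derivative `w'' ∈ L²(I)`. -/
def dxx {ℓ : ℝ} (w : H2 ℓ) : L2 ℓ := w.1 2

/-- `H¹₀(I) ∩ H²(I)`, the functions `w ∈ H²(I)` with `w(0) = w(ℓ) = 0`. -/
def H2Zero (ℓ : ℝ) : Submodule ℝ (H2 ℓ) where
  carrier := {w | ∃ D : ℕ → ℝ → ℝ, IsSobolevJet 2 0 ℓ D ∧
    (∀ i : Fin 3, w.1 i =ᵐ[volume.restrict (Ioo 0 ℓ)] D i) ∧ D 0 0 = 0 ∧ D 0 ℓ = 0}
  zero_mem' := ⟨_, isSobolevJet_zero 2 0 ℓ, fun _ => Lp.coeFn_zero .., rfl, rfl⟩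
  add_mem' := by
    rintro w w' ⟨D, hD, h, ha, hb⟩ ⟨D', hD', h', ha', hb'⟩
    refine ⟨_, hD.add hD', fun i => ?_, by simp [ha, ha'], by simp [hb, hb']⟩
    filter_upwards [h i, h' i, Lp.coeFn_add (w.1 i) (w'.1 i)] with x h1 h2 h3
    rw [Submodule.coe_add, PiLp.add_apply, h3, Pi.add_apply, h1, h2]
  smul_mem' := by
    rintro c w ⟨D, hD, h, ha, hb⟩
    refine ⟨_, hD.const_smul c, fun i => ?_, by simp [ha], by simp [hb]⟩
    filter_upwards [h i, Lp.coeFn_smul c (w.1 i)] with x h1 h3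
    rw [Submodule.coe_smul, PiLp.smul_apply, h3, Pi.smul_apply, h1]


/-! ### Both spaces are complete, so Bochner integrals with values in them make sense -/

theorem exists_ae_eq_const {a b : ℝ} (hab : a < b) {f : ℝ → ℝ} (hf : IntegrableOn f (Ioo a b))
    (h : ∀ θ : ℝ → ℝ, ContDiff ℝ ∞ θ → HasCompactSupport θ → tsupport θ ⊆ Ioo a b →
      ∫ t in Ioo a b, deriv θ t * f t = 0) :
    ∃ C, ∀ᵐ x ∂(volume.restrict (Ioo a b)), f x = C := by
  let η : ContDiffBump ((a + b) / 2) := ⟨(b - a) / 8, (b - a) / 4, by linarith, by linarith⟩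
  have hη1 : ContDiff ℝ ∞ (η.normed volume) := η.contDiff_normed
  have hη2 : HasCompactSupport (η.normed volume) := η.hasCompactSupport_normed
  have hη3 : tsupport (η.normed volume) ⊆ Ioo a b := by
    rw [η.tsupport_normed_eq, Real.closedBall_eq_Icc]
    have e : η.rOut = (b - a) / 4 := rfl
    rw [e]
    intro x hx
    constructor <;> [skip; skip] <;> linarith [hx.1, hx.2]
  have hη4 : ∫ x, η.normed volume x = 1 := η.integral_normed
  set e := η.normed volume with he
  have hint : ∀ θ : ℝ → ℝ, Continuous θ → IntegrableOn (fun t => θ t * f t) (Ioo a b) := by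
    intro θ hθ
    obtain ⟨C, hC⟩ := (isCompact_Icc (a := a) (b := b)).exists_bound_of_continuousOn
      hθ.continuousOn
    refine Integrable.bdd_mul (c := C) hf hθ.aestronglyMeasurable ?_
    filter_upwards [ae_restrict_mem measurableSet_Ioo] with t ht
    exact hC t (Ioo_subset_Icc_self ht)
  refine ⟨∫ t in Ioo a b, e t * f t, ?_⟩
  set C := ∫ t in Ioo a b, e t * f t
  have key : ∀ g : ℝ → ℝ, ContDiff ℝ ∞ g → HasCompactSupport g → tsupport g ⊆ Ioo a b →
      ∫ x, g x • (f x - C) = 0 := by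
    intro θ h1 h2 h3
    let c := ∫ x, θ x
    let g : ℝ → ℝ := fun x => θ x - c * e x
    have hg : ContDiff ℝ ∞ g := h1.sub (contDiff_const.mul hη1)
    let G : ℝ → ℝ := fun x => ∫ t in a..x, g t
    have hG' : ∀ x, HasDerivAt G (g x) x := fun x =>
      intervalIntegral.integral_hasDerivAt_right (hg.continuous.intervalIntegrable _ _)
        (hg.continuous.stronglyMeasurableAtFilter _ _) hg.continuous.continuousAt
    have hdG : deriv G = g := funext fun x => (hG' x).deriv
    have hGs : ContDiff ℝ ∞ G := by
      rw [contDiff_infty_iff_deriv, hdG]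
      exact ⟨fun x => (hG' x).differentiableAt, hg⟩
    -- a compact interval containing the supports
    have hK : IsCompact (tsupport θ ∪ tsupport e) := IsCompact.union h2 hη2
    have hKs : tsupport θ ∪ tsupport e ⊆ Ioo a b := union_subset h3 hη3
    have hKne : (tsupport θ ∪ tsupport e).Nonempty := by
      by_contra hne
      rw [not_nonempty_iff_eq_empty, union_empty_iff] at hne
      have : e = 0 := tsupport_eq_empty_iff.1 hne.2
      rw [this] at hη4
      simp at hη4
    obtain ⟨a', ha', hmin⟩ := hK.exists_isLeast hKne
    obtain ⟨b', hb', hmax⟩ := hK.exists_isGreatest hKne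
    have ha := hKs ha'
    have hb := hKs hb'
    have hz : ∀ x, x ∉ Icc a' b' → g x = 0 := by
      intro x hx
      have hxK : x ∉ tsupport θ ∪ tsupport e := fun hh => hx ⟨hmin hh, hmax hh⟩
      rw [mem_union, not_or] at hxK
      simp [g, image_eq_zero_of_notMem_tsupport hxK.1, image_eq_zero_of_notMem_tsupport hxK.2]
    have hgint : ∫ x, g x = 0 := by
      have i1 : Integrable θ := h1.continuous.integrable_of_hasCompactSupport h2
      have i2 : Integrable e := hη1.continuous.integrable_of_hasCompactSupport hη2
      simp only [g]
      rw [integral_sub i1 (i2.const_mul c), integral_const_mul, hη4]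
      simp [c]
    have hGz : ∀ x, x ∉ Icc a' b' → G x = 0 := by
      intro x hx
      by_cases hxa : x < a'
      · apply intervalIntegral.integral_zero_ae
        refine Filter.Eventually.of_forall fun t ht => hz t fun htt => ?_
        have := (Set.uIoc_subset_uIcc ht).2
        have h5 : max a x < a' := max_lt ha.1 hxa
        exact absurd htt.1 (not_le.2 (lt_of_le_of_lt this h5))
      · have hxb : b' < x := by
          by_contra hh
          exact hx ⟨not_lt.1 hxa, not_lt.1 hh⟩
        have hax : a ≤ x := le_trans ha.1.le (not_lt.1 hxa)
        change ∫ t in a..x, g t = 0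
        rw [intervalIntegral.integral_of_le hax,
          setIntegral_eq_integral_of_forall_compl_eq_zero, hgint]
        intro t ht
        exact hz t fun htt => ht ⟨lt_of_lt_of_le ha.1 htt.1, htt.2.trans hxb.le⟩
    have hts : tsupport G ⊆ Icc a' b' :=
      closure_minimal (fun x hx => by
        by_contra hh
        exact hx (hGz x hh)) isClosed_Icc
    have hGc : HasCompactSupport G := HasCompactSupport.of_support_subset_isCompact isCompact_Icc
      ((subset_tsupport G).trans hts)
    have h0 := h G hGs hGc (hts.trans fun x hx => ⟨lt_of_lt_of_le ha.1 hx.1, lt_of_le_of_lt hx.2 hb.2⟩)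
    rw [hdG] at h0
    have hθ0 : ∀ t, t ∉ Ioo a b → θ t = 0 := fun t ht =>
      image_eq_zero_of_notMem_tsupport fun hh => ht (h3 hh)
    have hc : c = ∫ t in Ioo a b, θ t :=
      (setIntegral_eq_integral_of_forall_compl_eq_zero hθ0).symm
    rw [← setIntegral_eq_integral_of_forall_compl_eq_zero (s := Ioo a b)
      (fun t ht => by simp [hθ0 t ht])]
    have e1 : ∫ t in Ioo a b, g t * f t = (∫ t in Ioo a b, θ t * f t) - c * C := by
      rw [← integral_const_mul, ← integral_sub (hint θ h1.continuous)
        ((hint e hη1.continuous).const_mul c)]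
      congr 1
      funext t
      simp only [g]
      ring
    have e2 : ∫ t in Ioo a b, θ t • (f t - C) = (∫ t in Ioo a b, θ t * f t) - c * C := by
      rw [hc, ← integral_mul_const, ← integral_sub (hint θ h1.continuous)]
      · congr 1
        funext t
        simp only [smul_eq_mul]
        ring
      · exact ((h1.continuous.integrable_of_hasCompactSupport h2).mul_const C).integrableOn
    rw [e2, ← e1, h0]
  have hloc : LocallyIntegrableOn (fun x => f x - C) (Ioo a b) volume :=
    (hf.sub (integrableOn_const (by simp))).locallyIntegrableOn
  have := isOpen_Ioo.ae_eq_zero_of_integral_contDiff_smul_eq_zero hloc key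
  rw [ae_restrict_iff' measurableSet_Ioo]
  filter_upwards [this] with x hx hx'
  linarith [hx hx']

/-- On a bounded interval, a function with an integrable weak derivative is a primitive of it. -/
theorem HasWeakDeriv.exists_ae_eq_primitive {a b : ℝ} (hab : a < b) {u u' : ℝ → ℝ}
    (hu : IntegrableOn u (Ioo a b)) (hu' : IntegrableOn u' (Ioo a b))
    (h : HasWeakDeriv a b u u') :
    ∃ C, u =ᵐ[volume.restrict (Ioo a b)] fun x => C + ∫ t in a..x, u' t := by
  have hi : IntervalIntegrable u' volume a b := by
    rw [intervalIntegrable_iff_integrableOn_Ioo_of_le hab.le]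
    exact hu'
  have hac := hi.absolutelyContinuousOnInterval_intervalIntegral (c := a) left_mem_uIcc
  have hGc : ContinuousOn (fun x => ∫ t in a..x, u' t) (Icc a b) := by
    have := hac.continuousOn
    rwa [uIcc_of_le hab.le] at this
  have hGi : IntegrableOn (fun x => ∫ t in a..x, u' t) (Ioo a b) :=
    (hGc.integrableOn_Icc).mono_set Ioo_subset_Icc_self
  obtain ⟨C, hC⟩ := exists_ae_eq_const hab (f := fun x => u x - ∫ t in a..x, u' t)
    (hu.sub hGi) (by
      intro θ h1 h2 h3
      have hd : Continuous (deriv θ) := h1.continuous_deriv (by simp)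
      have hz : ∀ t, t ∉ Ioo a b → θ t = 0 := fun t ht =>
        image_eq_zero_of_notMem_tsupport fun hh => ht (h3 hh)
      have hbd : ∀ w : ℝ → ℝ, IntegrableOn w (Ioo a b) →
          IntegrableOn (fun t => deriv θ t * w t) (Ioo a b) := by
        intro w hw
        obtain ⟨K, hK⟩ := (isCompact_Icc (a := a) (b := b)).exists_bound_of_continuousOn
          hd.continuousOn
        refine Integrable.bdd_mul (c := K) hw hd.aestronglyMeasurable ?_
        filter_upwards [ae_restrict_mem measurableSet_Ioo] with t ht
        exact hK t (Ioo_subset_Icc_self ht)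
      have hp := hac.integral_mul_deriv_eq_deriv_mul
        (ContDiffOn.absolutelyContinuousOnInterval (h1.contDiffOn.of_le (by simp)))
      rw [hz a (by simp), hz b (by simp)] at hp
      simp only [mul_sub]
      rw [integral_sub (hbd u hu) (hbd _ hGi)]
      have hw := h θ h1 h2 h3
      simp only [smul_eq_mul] at hw
      rw [hw]
      rw [intervalIntegral.integral_of_le hab.le, integral_Ioc_eq_integral_Ioo] at hp
      have e1 : ∫ t in Ioo a b, deriv θ t * (∫ s in a..t, u' s) =
          ∫ t in Ioo a b, (∫ s in a..t, u' s) * deriv θ t := by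
        congr 1
        funext t
        ring
      have e2 : ∫ t in a..b, deriv (fun x => ∫ s in a..x, u' s) t * θ t =
          ∫ t in Ioo a b, θ t * u' t := by
        rw [intervalIntegral.integral_of_le hab.le, integral_Ioc_eq_integral_Ioo]
        apply setIntegral_congr_ae measurableSet_Ioo
        filter_upwards [hi.ae_hasDerivAt_integral] with t ht ht'
        have ht2 : t ∈ uIcc a b := by
          rw [uIcc_of_le hab.le]
          exact Ioo_subset_Icc_self ht'
        rw [(ht ht2 a left_mem_uIcc).deriv]
        ring
      rw [e1, hp, e2]
      ring)
  refine ⟨C, ?_⟩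
  filter_upwards [hC] with x hx
  linarith

theorem continuous_integral_mul {ℓ : ℝ} {θ : ℝ → ℝ} (hθ : Continuous θ) :
    Continuous (fun g : L2 ℓ => ∫ x in Ioo 0 ℓ, θ x * g x) := by
  have hm : MemLp θ 2 (volume.restrict (Ioo 0 ℓ)) := by
    obtain ⟨C, hC⟩ := (isCompact_Icc (a := (0 : ℝ)) (b := ℓ)).exists_bound_of_continuousOn
      hθ.continuousOn
    refine MemLp.of_bound hθ.aestronglyMeasurable C ?_
    filter_upwards [ae_restrict_mem measurableSet_Ioo] with t ht
    exact hC t (Ioo_subset_Icc_self ht)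
  have : (fun g : L2 ℓ => ∫ x in Ioo 0 ℓ, θ x * g x) = fun g : L2 ℓ => inner ℝ (hm.toLp θ) g := by
    funext g
    rw [MeasureTheory.L2.inner_def]
    apply integral_congr_ae
    filter_upwards [hm.coeFn_toLp] with x hx
    simp [hx, mul_comm]
  rw [this]
  exact continuous_const.inner continuous_id

theorem hasWeakDeriv_congr {a b : ℝ} {u v u' v' : ℝ → ℝ}
    (h1 : u =ᵐ[volume.restrict (Ioo a b)] v) (h2 : u' =ᵐ[volume.restrict (Ioo a b)] v')
    (h : HasWeakDeriv a b u u') : HasWeakDeriv a b v v' := by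
  intro θ t1 t2 t3
  have e1 : ∫ t in Ioo a b, deriv θ t • v t = ∫ t in Ioo a b, deriv θ t • u t := by
    apply integral_congr_ae
    filter_upwards [h1] with x hx
    rw [hx]
  have e2 : ∫ t in Ioo a b, θ t • v' t = ∫ t in Ioo a b, θ t • u' t := by
    apply integral_congr_ae
    filter_upwards [h2] with x hx
    rw [hx]
  rw [e1, e2, h θ t1 t2 t3]

theorem l2_integrableOn {ℓ : ℝ} (g : L2 ℓ) : IntegrableOn g (Ioo 0 ℓ) :=
  (Lp.memLp g).integrable (by norm_num)

theorem mem_H2_iff {ℓ : ℝ} (hℓ : 0 < ℓ) (w : PiLp 2 (fun _ : Fin 3 => L2 ℓ)) :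
    w ∈ H2 ℓ ↔ HasWeakDeriv 0 ℓ (w 0) (w 1) ∧ HasWeakDeriv 0 ℓ (w 1) (w 2) := by
  constructor
  · rintro ⟨D, hD, h⟩
    exact ⟨hasWeakDeriv_congr (h 0).symm (h 1).symm (hD.weak 0 (by norm_num)),
      hasWeakDeriv_congr (h 1).symm (h 2).symm (hD.weak 1 (by norm_num))⟩
  · rintro ⟨h0, h1⟩
    obtain ⟨c0, hc0⟩ := h0.exists_ae_eq_primitive hℓ (l2_integrableOn _) (l2_integrableOn _)
    obtain ⟨c1, hc1⟩ := h1.exists_ae_eq_primitive hℓ (l2_integrableOn _) (l2_integrableOn _)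
    have hcont : ∀ (c : ℝ) (g : L2 ℓ),
        ContinuousOn (fun x => c + ∫ t in (0 : ℝ)..x, g t) (Icc 0 ℓ) := by
      intro c g
      have hi : IntervalIntegrable g volume 0 ℓ := by
        rw [intervalIntegrable_iff_integrableOn_Ioo_of_le hℓ.le]
        exact l2_integrableOn g
      have := (hi.absolutelyContinuousOnInterval_intervalIntegral (c := 0)
        left_mem_uIcc).continuousOn
      rw [uIcc_of_le hℓ.le] at this
      exact continuousOn_const.add this
    let D : ℕ → ℝ → ℝ := fun j => match j with
      | 0 => fun x => c0 + ∫ t in (0 : ℝ)..x, w 1 t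
      | 1 => fun x => c1 + ∫ t in (0 : ℝ)..x, w 2 t
      | _ => w 2
    have hae : ∀ i : Fin 3, w i =ᵐ[volume.restrict (Ioo 0 ℓ)] D i := by
      intro i
      fin_cases i
      · exact hc0
      · exact hc1
      · exact Filter.EventuallyEq.rfl
    refine ⟨D, ⟨?_, ?_, ?_⟩, hae⟩
    · intro j hj
      have := (memLp_congr_ae (hae ⟨j, by omega⟩)).1 (Lp.memLp _)
      exact this
    · intro j hj
      interval_cases j
      · exact hcont _ _
      · exact hcont _ _
    · intro j hj
      interval_cases j
      · exact hasWeakDeriv_congr (hae 0) (hae 1) h0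
      · exact hasWeakDeriv_congr (hae 1) (hae 2) h1

theorem isClosed_H2 (ℓ : ℝ) : IsClosed (H2 ℓ : Set (PiLp 2 (fun _ : Fin 3 => L2 ℓ))) := by
  rcases le_or_gt ℓ 0 with hℓ | hℓ
  · have : (H2 ℓ : Set (PiLp 2 (fun _ : Fin 3 => L2 ℓ))) = univ := by
      refine eq_univ_of_forall fun w => ⟨_, isSobolevJet_zero 2 0 ℓ, fun i => ?_⟩
      have h0 : volume.restrict (Ioo 0 ℓ) = 0 := by
        rw [Ioo_eq_empty (not_lt.2 hℓ), Measure.restrict_empty]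
      simp [Filter.EventuallyEq, h0]
    rw [this]
    exact isClosed_univ
  · have hw : ∀ i j : Fin 3, IsClosed {w : PiLp 2 (fun _ : Fin 3 => L2 ℓ) |
        HasWeakDeriv 0 ℓ (w i) (w j)} := by
      intro i j
      simp only [HasWeakDeriv, ofPred_forall]
      refine isClosed_iInter fun θ => isClosed_iInter fun h1 => isClosed_iInter fun _ =>
        isClosed_iInter fun _ => isClosed_eq ?_ ?_
      · exact (continuous_integral_mul (h1.continuous_deriv (by simp))).comp
          (PiLp.continuous_apply 2 _ i)
      · exact ((continuous_integral_mul h1.continuous).comp (PiLp.continuous_apply 2 _ j)).neg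
    have : (H2 ℓ : Set (PiLp 2 (fun _ : Fin 3 => L2 ℓ))) =
        {w | HasWeakDeriv 0 ℓ (w 0) (w 1)} ∩ {w | HasWeakDeriv 0 ℓ (w 1) (w 2)} := by
      ext w
      exact mem_H2_iff hℓ w
    rw [this]
    exact (hw 0 1).inter (hw 1 2)

instance (ℓ : ℝ) : CompleteSpace (H2 ℓ) := (isClosed_H2 ℓ).completeSpace_coe

theorem jet_ftc {ℓ : ℝ} (hℓ : 0 < ℓ) {D : ℕ → ℝ → ℝ} (hD : IsSobolevJet 2 0 ℓ D) :
    ∃ C, EqOn (D 0) (fun x => C + ∫ t in (0 : ℝ)..x, D 1 t) (Icc 0 ℓ) := by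
  have hi0 : IntegrableOn (D 0) (Ioo 0 ℓ) := (hD.memLp 0 (by norm_num)).integrable (by norm_num)
  have hi1 : IntegrableOn (D 1) (Ioo 0 ℓ) := (hD.memLp 1 (by norm_num)).integrable (by norm_num)
  obtain ⟨C, hC⟩ := (hD.weak 0 (by norm_num)).exists_ae_eq_primitive hℓ hi0 hi1
  refine ⟨C, ?_⟩
  have hcont : ContinuousOn (fun x => C + ∫ t in (0 : ℝ)..x, D 1 t) (Icc 0 ℓ) := by
    have hi : IntervalIntegrable (D 1) volume 0 ℓ := by
      rw [intervalIntegrable_iff_integrableOn_Ioo_of_le hℓ.le]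
      exact hi1
    have := (hi.absolutelyContinuousOnInterval_intervalIntegral (c := 0)
      left_mem_uIcc).continuousOn
    rw [uIcc_of_le hℓ.le] at this
    exact continuousOn_const.add this
  exact Measure.eqOn_Icc_of_ae_eq volume hℓ.ne
    (by rwa [← restrict_Ioo_eq_restrict_Icc]) (hD.continuousOn 0 (by norm_num)) hcont

theorem jet_parts {ℓ : ℝ} (hℓ : 0 < ℓ) {D : ℕ → ℝ → ℝ} (hD : IsSobolevJet 2 0 ℓ D) :
    ∫ x in Ioo 0 ℓ, D 1 x = D 0 ℓ - D 0 0 ∧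
      (∫ x in Ioo 0 ℓ, D 0 x) + ∫ x in Ioo 0 ℓ, x * D 1 x = ℓ * D 0 ℓ := by
  obtain ⟨C, hC⟩ := jet_ftc hℓ hD
  have hc1 : ContinuousOn (D 1) (Icc 0 ℓ) := hD.continuousOn 1 (by norm_num)
  have hc0 : ContinuousOn (D 0) (Icc 0 ℓ) := hD.continuousOn 0 (by norm_num)
  have h0 := hC (left_mem_Icc.2 hℓ.le)
  have h1 := hC (right_mem_Icc.2 hℓ.le)
  simp only [intervalIntegral.integral_same, add_zero] at h0
  have hI : ∀ g : ℝ → ℝ, ∫ x in Ioo 0 ℓ, g x = ∫ x in (0 : ℝ)..ℓ, g x := fun g => by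
    rw [intervalIntegral.integral_of_le hℓ.le, integral_Ioc_eq_integral_Ioo]
  simp only [hI]
  refine ⟨by rw [h1, h0]; ring, ?_⟩
  have hd : ∀ x ∈ Ioo (0 : ℝ) ℓ, HasDerivAt (fun x => x * D 0 x) (1 * D 0 x + x * D 1 x) x := by
    intro x hx
    have hD1 : HasDerivAt (D 0) (D 1 x) x := by
      have hca : ContinuousAt (D 1) x := hc1.continuousAt (Icc_mem_nhds hx.1 hx.2)
      have : HasDerivAt (fun x => C + ∫ t in (0 : ℝ)..x, D 1 t) (D 1 x) x := by
        refine (intervalIntegral.integral_hasDerivAt_right ?_ ?_ hca).const_add C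
        · refine ContinuousOn.intervalIntegrable (hc1.mono ?_)
          rw [uIcc_of_le hx.1.le]
          exact Icc_subset_Icc_right hx.2.le
        · exact (hc1.mono Ioo_subset_Icc_self).stronglyMeasurableAtFilter isOpen_Ioo x hx
      exact this.congr_of_eventuallyEq (hC.eventuallyEq_of_mem (Icc_mem_nhds hx.1 hx.2))
    exact (hasDerivAt_id x).mul hD1
  have hi0 : IntervalIntegrable (D 0) volume 0 ℓ :=
    ContinuousOn.intervalIntegrable (by rwa [uIcc_of_le hℓ.le])
  have hi1 : IntervalIntegrable (fun x => x * D 1 x) volume 0 ℓ :=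
    ContinuousOn.intervalIntegrable (by
      rw [uIcc_of_le hℓ.le]
      exact continuousOn_id.mul hc1)
  have := intervalIntegral.integral_eq_sub_of_hasDerivAt_of_le hℓ.le
    (continuousOn_id.mul hc0) hd (by simpa using hi0.add hi1)
  simp only [one_mul, Pi.mul_apply, id_eq, zero_mul, sub_zero] at this
  rw [← intervalIntegral.integral_add hi0 hi1, this]

theorem isClosed_H2Zero (ℓ : ℝ) : IsClosed (H2Zero ℓ : Set (H2 ℓ)) := by
  rcases le_or_gt ℓ 0 with hℓ | hℓ
  · have : (H2Zero ℓ : Set (H2 ℓ)) = univ := by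
      refine eq_univ_of_forall fun w => ⟨_, isSobolevJet_zero 2 0 ℓ, fun i => ?_, rfl, rfl⟩
      have h0 : volume.restrict (Ioo 0 ℓ) = 0 := by
        rw [Ioo_eq_empty (not_lt.2 hℓ), Measure.restrict_empty]
      simp [Filter.EventuallyEq, h0]
    rw [this]
    exact isClosed_univ
  · have : (H2Zero ℓ : Set (H2 ℓ)) = {w | ∫ x in Ioo 0 ℓ, (1 : ℝ) * w.1 1 x = 0} ∩
        {w | (∫ x in Ioo 0 ℓ, (1 : ℝ) * w.1 0 x) + ∫ x in Ioo 0 ℓ, x * w.1 1 x = 0} := by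
      have key : ∀ (w : H2 ℓ) (D : ℕ → ℝ → ℝ), IsSobolevJet 2 0 ℓ D →
          (∀ i : Fin 3, w.1 i =ᵐ[volume.restrict (Ioo 0 ℓ)] D i) →
          ∫ x in Ioo 0 ℓ, (1 : ℝ) * w.1 1 x = D 0 ℓ - D 0 0 ∧
          (∫ x in Ioo 0 ℓ, (1 : ℝ) * w.1 0 x) + ∫ x in Ioo 0 ℓ, x * w.1 1 x = ℓ * D 0 ℓ := by
        intro w D hD h
        obtain ⟨p1, p2⟩ := jet_parts hℓ hD
        have e1 : ∫ x in Ioo 0 ℓ, (1 : ℝ) * w.1 1 x = ∫ x in Ioo 0 ℓ, D 1 x := by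
          apply integral_congr_ae
          filter_upwards [h 1] with x hx
          rw [one_mul, hx]
          rfl
        have e0 : ∫ x in Ioo 0 ℓ, (1 : ℝ) * w.1 0 x = ∫ x in Ioo 0 ℓ, D 0 x := by
          apply integral_congr_ae
          filter_upwards [h 0] with x hx
          rw [one_mul, hx]
          rfl
        have e2 : ∫ x in Ioo 0 ℓ, x * w.1 1 x = ∫ x in Ioo 0 ℓ, x * D 1 x := by
          apply integral_congr_ae
          filter_upwards [h 1] with x hx
          rw [hx]
          rfl
        rw [e0, e1, e2]
        exact ⟨p1, p2⟩
      ext w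
      constructor
      · rintro ⟨D, hD, h, ha, hb⟩
        obtain ⟨k1, k2⟩ := key w D hD h
        exact ⟨k1.trans (by rw [ha, hb, sub_zero]), k2.trans (by rw [hb, mul_zero])⟩
      · rintro ⟨h1, h2⟩
        obtain ⟨hD, h⟩ := isSobolevJet_jet w
        obtain ⟨k1, k2⟩ := key w _ hD h
        have hb : jet w 0 ℓ = 0 := by
          rcases mul_eq_zero.1 (k2.symm.trans h2) with h | h
          · exact absurd h hℓ.ne'
          · exact h
        have ha : jet w 0 0 = 0 := by
          have := k1.symm.trans h1
          linarith
        exact ⟨_, hD, h, ha, hb⟩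
    rw [this]
    have hc : ∀ i : Fin 3, Continuous fun w : H2 ℓ => w.1 i := fun i =>
      (PiLp.continuous_apply 2 _ i).comp continuous_subtype_val
    exact (isClosed_eq ((continuous_integral_mul continuous_const).comp (hc 1))
      continuous_const).inter (isClosed_eq (((continuous_integral_mul continuous_const).comp
        (hc 0)).add ((continuous_integral_mul continuous_id).comp (hc 1))) continuous_const)

instance (ℓ : ℝ) : CompleteSpace (H2Zero ℓ) := (isClosed_H2Zero ℓ).completeSpace_coe

/-! ### The inverse problem -/

/-- The constants and the given functions of the problem: `I = (0, ℓ)`, time interval `(0, T)`,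
`u₀`, `u₁` initial data, `u₂` the initial value of `u_tt`, `φ` the sensor, `f` the measurement. -/
structure Data where
  ℓ : ℝ
  T : ℝ
  β : ℝ
  p : ℝ
  q : ℝ
  u₀ : ℝ → ℝ
  u₁ : ℝ → ℝ
  u₂ : ℝ → ℝ
  φ : ℝ → ℝ
  f : ℝ → ℝ

namespace Data

/-- The derivatives of `u₀ ∈ H⁴(I)`. -/
def u₀D (d : Data) (j : ℕ) : ℝ → ℝ := wderiv 4 0 d.ℓ d.u₀ j

/-- The derivatives of `u₁ ∈ H⁴(I)`. -/
def u₁D (d : Data) (j : ℕ) : ℝ → ℝ := wderiv 4 0 d.ℓ d.u₁ j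

/-- The derivatives of `u₂ ∈ H²(I)`. -/
def u₂D (d : Data) (j : ℕ) : ℝ → ℝ := wderiv 2 0 d.ℓ d.u₂ j

/-- The derivatives of `φ ∈ H³(I)`. -/
def φD (d : Data) (j : ℕ) : ℝ → ℝ := wderiv 3 0 d.ℓ d.φ j

/-- The derivatives of `f ∈ H⁴(0, T)`. -/
def fD (d : Data) (j : ℕ) : ℝ → ℝ := wderiv 4 0 d.T d.f j

/-- `v₀(x) = u₁(x) - u₁(ℓ) x/ℓ`. -/
def v₀ (d : Data) (x : ℝ) : ℝ := d.u₁ x - d.u₁ d.ℓ * (x / d.ℓ)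

/-- `v₁(x) = u₂(x) - u₂(ℓ) x/ℓ`. -/
def v₁ (d : Data) (x : ℝ) : ℝ := d.u₂ x - d.u₂ d.ℓ * (x / d.ℓ)

/-- `α`, the inverse of the integral of `φ' u₀''` over `I`. -/
def α (d : Data) : ℝ := (∫ x in (0 : ℝ)..d.ℓ, d.φD 1 x * d.u₀D 2 x)⁻¹

/-- The prescribed initial value `k(0)` of the kernel. -/
def k₀ (d : Data) : ℝ := d.α * (d.fD 3 0 + ∫ x in (0 : ℝ)..d.ℓ, d.v₀ x * d.φD 3 x)

/-- The weight `φ - β φ''` of the measurement. -/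
def weight (d : Data) (x : ℝ) : ℝ := d.φ x - d.β * d.φD 2 x

/-- `ψ`, the primitive of `φ` vanishing at `0`, minus `β φ'`. -/
def ψ (d : Data) (x : ℝ) : ℝ := (∫ s in (0 : ℝ)..x, d.φ s) - d.β * d.φD 1 x

/-- The prescribed initial value of `y''`. -/
def yTwo₀ (d : Data) : ℝ :=
  (d.ψ d.ℓ)⁻¹ * (d.fD 1 0 - d.k₀ * d.f 0 +
    ∫ x in (0 : ℝ)..d.ℓ, d.ψ x * (d.u₁D 2 x - d.k₀ * d.u₀D 2 x))

/-- `w ∈ H²(I)` and `(1 - β d²/dx²) w = g` almost everywhere on `I`. -/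
def IsResolvent (d : Data) (g w : ℝ → ℝ) : Prop :=
  MemH 2 0 d.ℓ w ∧
    ∀ᵐ x ∂(volume.restrict (Ioo 0 d.ℓ)), w x - d.β * wderiv 2 0 d.ℓ w 2 x = g x

/-- The standing assumptions on the data. No boundary condition is built into the inverse of
`1 - β d²/dx²`: `u₂(0) = 0` is part of `v₁ ∈ H¹₀(I)`, the value `u₂(ℓ)` is arbitrary, and the
condition on `f'''(0)` does not depend on the choice of `w`. -/
structure Assumptions (d : Data) : Prop where
  ℓ_pos : 0 < d.ℓ
  T_pos : 0 < d.T
  β_pos : 0 < d.β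
  p_pos : 0 < d.p
  q_pos : 0 < d.q
  u₀_mem : MemH 4 0 d.ℓ d.u₀
  u₁_mem : MemH 4 0 d.ℓ d.u₁
  φ_mem : MemH 3 0 d.ℓ d.φ
  φ_zero : ∀ j < 3, d.φD j 0 = 0 ∧ d.φD j d.ℓ = 0
  u₂_eq : d.IsResolvent (d.u₀D 2) d.u₂
  v₀_mem : MemH 2 0 d.ℓ d.v₀ ∧ d.v₀ 0 = 0 ∧ d.v₀ d.ℓ = 0
  v₁_mem : MemH 2 0 d.ℓ d.v₁ ∧ d.v₁ 0 = 0 ∧ d.v₁ d.ℓ = 0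
  α_ne : ∫ x in (0 : ℝ)..d.ℓ, d.φD 1 x * d.u₀D 2 x ≠ 0
  f_mem : MemH 4 0 d.T d.f
  f_zero : ∫ x in (0 : ℝ)..d.ℓ, d.weight x * d.u₀D 1 x = d.f 0
  f_one : ∫ x in (0 : ℝ)..d.ℓ, d.weight x * d.u₁D 1 x = d.fD 1 0
  f_two : ∫ x in (0 : ℝ)..d.ℓ, d.weight x * d.u₂D 1 x = d.fD 2 0
  f_three : ∃ w : ℝ → ℝ, d.IsResolvent (fun x => d.u₁D 3 x - d.k₀ * d.u₀D 3 x) w ∧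
    ∫ x in (0 : ℝ)..d.ℓ, d.weight x * w x = d.fD 3 0
  ψ_ne : d.ψ d.ℓ ≠ 0

/-- The time derivatives of `v ∈ H²(0, T; H¹₀(I) ∩ H²(I))`. -/
def vD (d : Data) (v : ℝ → H2Zero d.ℓ) (j : ℕ) : ℝ → H2Zero d.ℓ := wderiv 2 0 d.T v j

/-- The derivatives of `k ∈ H¹(0, T)`. -/
def kD (d : Data) (k : ℝ → ℝ) (j : ℕ) : ℝ → ℝ := wderiv 1 0 d.T k j

/-- The derivatives of `y ∈ H³(0, T)`. -/
def yD (d : Data) (y : ℝ → ℝ) (j : ℕ) : ℝ → ℝ := wderiv 3 0 d.T y j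

/-- The `j`-th derivative of `z = p y' + q y`, for `j ≤ 2`. -/
def zD (d : Data) (y : ℝ → ℝ) (j : ℕ) (t : ℝ) : ℝ := d.p * d.yD y (j + 1) t + d.q * d.yD y j t

/-- The time derivatives of `u ∈ H³(0, T; H²(I))`. -/
def uD (d : Data) (u : ℝ → H2 d.ℓ) (j : ℕ) : ℝ → H2 d.ℓ := wderiv 3 0 d.T u j

/-- `G[v_xx](t)`, which is `f'(t) + ∫ ψ v_xx(t) dx` divided by `ψ(ℓ)`. -/
def G (d : Data) (v : ℝ → H2Zero d.ℓ) (t : ℝ) : ℝ :=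
  (d.ψ d.ℓ)⁻¹ * (d.fD 1 t + ∫ x in (0 : ℝ)..d.ℓ, d.ψ x * dxx (v t : H2 d.ℓ) x)

/-- The time derivative of `G[v_xx]`, which is `f''(t) + ∫ ψ v_xxt(t) dx` divided by `ψ(ℓ)`. -/
def GPrime (d : Data) (v : ℝ → H2Zero d.ℓ) (t : ℝ) : ℝ :=
  (d.ψ d.ℓ)⁻¹ * (d.fD 2 t + ∫ x in (0 : ℝ)..d.ℓ, d.ψ x * dxx (d.vD v 1 t : H2 d.ℓ) x)

/-- The number `f(0) + ∫ ψ u₀'' dx` divided by `ψ(ℓ)`. -/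
def GHat₀ (d : Data) : ℝ :=
  (d.ψ d.ℓ)⁻¹ * (d.f 0 + ∫ x in (0 : ℝ)..d.ℓ, d.ψ x * d.u₀D 2 x)

/-- The wave equation for `v`,
`v_tt - v_xx - β v_xxtt + k(t) u₀'' + ∫_0^t k(t-s) v_xx(s) ds = z'' x/ℓ`
almost everywhere in `I × (0, T)`; the integral is a Bochner integral in `L²(I)`. -/
def WaveEquation (d : Data) (v : ℝ → H2Zero d.ℓ) (k y : ℝ → ℝ) : Prop :=
  ∀ᵐ t ∂(volume.restrict (Ioo 0 d.T)), ∀ᵐ x ∂(volume.restrict (Ioo 0 d.ℓ)),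
    val (d.vD v 2 t : H2 d.ℓ) x - dxx (v t : H2 d.ℓ) x - d.β * dxx (d.vD v 2 t : H2 d.ℓ) x
      + k t * d.u₀D 2 x + (∫ s in (0 : ℝ)..t, k (t - s) • dxx (v s : H2 d.ℓ) : L2 d.ℓ) x
      = d.zD y 2 t * (x / d.ℓ)

/-- The equivalent problem: `(v, k, y)` has the regularity
`H²(0, T; H¹₀(I) ∩ H²(I)) × H¹(0, T) × H³(0, T)` and solves the integro-differential system, with
`k(0)` and `y''(0)` prescribed by the data. The boundary conditions `v(0, t) = v(ℓ, t) = 0` are part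
of the type of `v`. -/
structure IsEquivalentSolution (d : Data) (v : ℝ → H2Zero d.ℓ) (k y : ℝ → ℝ) : Prop where
  v_mem : MemH 2 0 d.T v
  k_mem : MemH 1 0 d.T k
  y_mem : MemH 3 0 d.T y
  wave : d.WaveEquation v k y
  v_init : ∀ x ∈ Icc 0 d.ℓ, val (v 0 : H2 d.ℓ) x = d.v₀ x
  vt_init : ∀ x ∈ Icc 0 d.ℓ, val (d.vD v 1 0 : H2 d.ℓ) x = d.v₁ x
  k_init : k 0 = d.k₀
  y_init : d.yD y 2 0 = d.yTwo₀
  k_eq : ∀ᵐ t ∂(volume.restrict (Ioo 0 d.T)),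
    d.kD k 1 t = d.α * (d.fD 4 t
      + (∫ x in (0 : ℝ)..d.ℓ, val (d.vD v 1 t : H2 d.ℓ) x * d.φD 3 x)
      - k 0 * (∫ x in (0 : ℝ)..d.ℓ, val (v t : H2 d.ℓ) x * d.φD 3 x)
      - ∫ s in (0 : ℝ)..t, ∫ x in (0 : ℝ)..d.ℓ,
          d.kD k 1 (t - s) * val (v s : H2 d.ℓ) x * d.φD 3 x)
  y_eq : ∀ᵐ t ∂(volume.restrict (Ioo 0 d.T)),
    d.yD y 3 t = d.GPrime v t - d.kD k 1 t * d.GHat₀ - k 0 * d.G v t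
      - ∫ s in (0 : ℝ)..t, d.kD k 1 (t - s) * d.G v s

/-- The inverse problem in the variables `(v, k, y)`: the wave equation with homogeneous Dirichlet
conditions, the acoustic boundary condition at `x = ℓ`, the initial conditions and the integral
overdetermination condition. -/
structure IsInverseSolution (d : Data) (v : ℝ → H2Zero d.ℓ) (k y : ℝ → ℝ) : Prop where
  v_mem : MemH 2 0 d.T v
  k_mem : MemH 1 0 d.T k
  y_mem : MemH 3 0 d.T y
  wave : d.WaveEquation v k y
  boundary : ∀ t ∈ Ioo 0 d.T,
    dx (v t : H2 d.ℓ) d.ℓ - (∫ s in (0 : ℝ)..t, k (t - s) * dx (v s : H2 d.ℓ) d.ℓ)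
      = d.yD y 2 t + k t * d.u₀D 1 d.ℓ
        + 1 / d.ℓ * (d.zD y 0 t - ∫ s in (0 : ℝ)..t, k (t - s) * d.zD y 0 s)
  v_init : ∀ x ∈ Icc 0 d.ℓ, val (v 0 : H2 d.ℓ) x = d.v₀ x
  vt_init : ∀ x ∈ Icc 0 d.ℓ, val (d.vD v 1 0 : H2 d.ℓ) x = d.v₁ x
  overdetermination : ∀ t ∈ Ioo 0 d.T,
    ∫ x in (0 : ℝ)..d.ℓ, d.weight x * (dx (v t : H2 d.ℓ) x - d.zD y 0 t / d.ℓ) = d.fD 1 t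

/-- The original inverse problem for the velocity potential `u ∈ H³(0, T; H²(I))`, the memory
kernel `k ∈ H¹(0, T)` and the displacement `y ∈ H³(0, T)`. -/
structure IsOriginalSolution (d : Data) (u : ℝ → H2 d.ℓ) (k y : ℝ → ℝ) : Prop where
  u_mem : MemH 3 0 d.T u
  k_mem : MemH 1 0 d.T k
  y_mem : MemH 3 0 d.T y
  wave : ∀ᵐ t ∂(volume.restrict (Ioo 0 d.T)), ∀ᵐ x ∂(volume.restrict (Ioo 0 d.ℓ)),
    val (d.uD u 2 t) x - dxx (u t) x - d.β * dxx (d.uD u 2 t) x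
      + (∫ s in (0 : ℝ)..t, k (t - s) • dxx (u s) : L2 d.ℓ) x = 0
  left : ∀ t ∈ Ioo 0 d.T, val (u t) 0 = 0
  right : ∀ t ∈ Ioo 0 d.T,
    dx (u t) d.ℓ - (∫ s in (0 : ℝ)..t, k s * dx (u (t - s)) d.ℓ) = d.yD y 1 t
  acoustic : ∀ t ∈ Ioo 0 d.T, val (d.uD u 1 t) d.ℓ = - d.p * d.yD y 1 t - d.q * y t
  u_init : ∀ x ∈ Icc 0 d.ℓ, val (u 0) x = d.u₀ x
  ut_init : ∀ x ∈ Icc 0 d.ℓ, val (d.uD u 1 0) x = d.u₁ x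
  overdetermination : ∀ t ∈ Icc 0 d.T,
    ∫ x in (0 : ℝ)..d.ℓ, d.weight x * dx (u t) x = d.f t

end Data

end

end AcousticInverse

open AcousticInverse

/-! The operator `1 - β ∂ₓ²` acts on `v_tt`. Let `R` be its inverse under Dirichlet conditions.
Applying `R` turns the wave equation into `v'' = B v - k b - k * B v + z'' e`, with `B = R ∂ₓ²`, `b
= R u₀''`, `e = R(x/ℓ)`, an equation in `H¹₀ ∩ H²` with bounded operators only (`wave_iff`). No
semigroup is needed: the problem behaves like an ordinary integro-differential equation.

The two side conditions become integral equations. Testing the wave equation with `φ'`, whose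
boundary terms vanish, gives the second time derivative of the measurement as `k/α - ∫ φ''' v + k *
∫ φ''' v` (`wave_paired`). Hence the overdetermination condition amounts to two initial values
together with `k = α (f''' + ∫ φ''' v - k * ∫ φ''' v)`. Once it holds, an integration by parts
against `ψ` gives `v_x(ℓ) - z/ℓ = G`, and the acoustic condition reads `y'' = G - u₀'(ℓ) k - k * G`
(`boundary_iff`). The compatibility conditions identify `u₀'(ℓ)` with the constant `Ĝ₀`. The
equations for `k'` and `y'''` in the equivalent problem are the time derivatives of these two, and
the prescribed `k(0)` and `y''(0)` are their values at `t = 0`.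

The whole system is one equation `W(t) = g(t) + ∫₀ᵗ (A W(s) + κ(W(t-s)) P W(s)) ds` for the state `W
= (v, v' - p y'' e, k * B v, k, y'', F₁)`, where `F₁ = f'/ψ(ℓ)`. The quadratic term is a
convolution, so multiplication by `exp(-σ t)` preserves its form. The weight makes the linear part
and the interaction with `g` of size `1/σ`, and the remaining self-interaction is small on a small
ball around the weighted `g`. The contraction principle then works on all of `[0, T]` at once
(`volterra_exists`), and the same weight gives uniqueness (`volterra_unique`). Regularity follows by
bootstrapping through the equations for `k`, then `y''`, then `v'`.

Only `y''` enters the integral system, so the equivalent problem leaves an affine part of `y` free.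
The overdetermination condition fixes it: it forces `z(0) = -u₁(ℓ)` and `z'(0) = -u₂(ℓ)`, from which
`y'(0)` and then `y(0)` are found on dividing by `q`.

For the original problem put `v = u_t + z x/ℓ`. Each condition on `u` is an identity between
absolutely continuous functions of time, hence equivalent to its value at `0` and its derivative
almost everywhere (`IsPrimitiveOn.eqOn_iff`). The derivatives are the conditions on `v`, and the
values at `0` are matched by the data. The extra hypothesis on `u₂(ℓ)` makes `u₂` agree at `x = ℓ`
with the `u_tt(0)` that the boundary conditions force. -/

set_option linter.unusedSectionVars false

namespace AcousticInverse

/-! ### Primitives of integrable functions with values in a Banach space -/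

/-- `u` is a primitive on `[a, b]` of the integrable function `u'`. -/
structure IsPrimitiveOn {E : Type*} [NormedAddCommGroup E] [NormedSpace ℝ E] (a b : ℝ)
    (u u' : ℝ → E) : Prop where
  integrable : IntegrableOn u' (Ioo a b)
  eq : ∀ t ∈ Icc a b, u t = u a + ∫ s in a..t, u' s

section Primitive

variable {E F : Type*} [NormedAddCommGroup E] [NormedSpace ℝ E] [NormedAddCommGroup F]
  [NormedSpace ℝ F] {a b : ℝ} {u u' w w' : ℝ → E}

theorem intervalIntegrable_of_integrableOn_Ioo {f : ℝ → E} (hf : IntegrableOn f (Ioo a b))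
    {s t : ℝ} (hs : s ∈ Icc a b) (ht : t ∈ Icc a b) : IntervalIntegrable f volume s t := by
  have h1 : IntegrableOn f (Icc a b) := by rwa [integrableOn_Icc_iff_integrableOn_Ioo]
  refine (h1.mono_set ?_).intervalIntegrable
  have e := uIcc_of_le (hs.1.trans hs.2)
  rw [← e] at hs ht ⊢
  exact uIcc_subset_uIcc hs ht

theorem integrableOn_Ioo_of_continuousOn {f : ℝ → E} (hf : ContinuousOn f (Icc a b)) :
    IntegrableOn f (Ioo a b) :=
  hf.integrableOn_Icc.mono_set Ioo_subset_Icc_self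

theorem memLp_Ioo_of_continuousOn {f : ℝ → E} (hf : ContinuousOn f (Icc a b)) :
    MemLp f 2 (volume.restrict (Ioo a b)) := by
  obtain ⟨C, hC⟩ := isCompact_Icc.exists_bound_of_continuousOn hf
  refine MemLp.of_bound (integrableOn_Ioo_of_continuousOn hf).aestronglyMeasurable C ?_
  filter_upwards [ae_restrict_mem measurableSet_Ioo] with t ht
  exact hC t (Ioo_subset_Icc_self ht)

theorem integrableOn_Ioo_of_memLp {f : ℝ → E} (hf : MemLp f 2 (volume.restrict (Ioo a b))) :
    IntegrableOn f (Ioo a b) :=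
  hf.integrable (by norm_num)

theorem integral_congr_ae_Ioo {f g : ℝ → E} (h : f =ᵐ[volume.restrict (Ioo a b)] g) {s t : ℝ}
    (hs : s ∈ Icc a b) (ht : t ∈ Icc a b) : ∫ x in s..t, f x = ∫ x in s..t, g x := by
  apply intervalIntegral.integral_congr_ae_restrict
  rw [restrict_Ioo_eq_restrict_Icc] at h
  refine ae_restrict_of_ae_restrict_of_subset ?_ h
  have e := uIcc_of_le (hs.1.trans hs.2)
  rw [← e] at hs ht ⊢
  exact uIoc_subset_uIcc.trans (uIcc_subset_uIcc hs ht)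

theorem integral_Ioo_eq (hab : a ≤ b) (f : ℝ → E) : ∫ x in Ioo a b, f x = ∫ x in a..b, f x := by
  rw [intervalIntegral.integral_of_le hab, integral_Ioc_eq_integral_Ioo]

namespace IsPrimitiveOn

theorem continuousOn (h : IsPrimitiveOn a b u u') : ContinuousOn u (Icc a b) := by
  rcases lt_or_ge b a with hab | hab
  · rw [Icc_eq_empty (not_le.2 hab)]
    exact continuousOn_empty _
  have h1 : IntegrableOn u' (uIcc a b) := by
    rw [uIcc_of_le hab, integrableOn_Icc_iff_integrableOn_Ioo]
    exact h.integrable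
  have h2 := intervalIntegral.continuousOn_primitive_interval h1
  rw [uIcc_of_le hab] at h2
  exact (continuousOn_const.add h2).congr h.eq

theorem sub_eq (h : IsPrimitiveOn a b u u') {s t : ℝ} (hs : s ∈ Icc a b) (ht : t ∈ Icc a b) :
    u t - u s = ∫ x in s..t, u' x := by
  have ha : a ∈ Icc a b := left_mem_Icc.2 (hs.1.trans hs.2)
  rw [h.eq t ht, h.eq s hs, add_sub_add_left_eq_sub, intervalIntegral.integral_interval_sub_left
    (intervalIntegrable_of_integrableOn_Ioo h.integrable ha ht)
    (intervalIntegrable_of_integrableOn_Ioo h.integrable ha hs)]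

theorem mono (h : IsPrimitiveOn a b u u') {c d : ℝ} (hc : c ∈ Icc a b) (hd : d ∈ Icc a b) :
    IsPrimitiveOn c d u u' where
  integrable := h.integrable.mono_set (Ioo_subset_Ioo hc.1 hd.2)
  eq t ht := by
    rw [← h.sub_eq hc ⟨hc.1.trans ht.1, ht.2.trans hd.2⟩]
    abel

theorem congr (h : IsPrimitiveOn a b u u') (h1 : EqOn u w (Icc a b))
    (h2 : u' =ᵐ[volume.restrict (Ioo a b)] w') : IsPrimitiveOn a b w w' where
  integrable := Integrable.congr h.integrable h2
  eq t ht := by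
    have ha : a ∈ Icc a b := left_mem_Icc.2 (ht.1.trans ht.2)
    rw [← h1 ht, ← h1 ha, h.eq t ht, integral_congr_ae_Ioo h2 ha ht]

theorem clm [CompleteSpace E] [CompleteSpace F] (h : IsPrimitiveOn a b u u') (L : E →L[ℝ] F) :
    IsPrimitiveOn a b (fun t => L (u t)) (fun t => L (u' t)) where
  integrable := L.integrable_comp h.integrable
  eq t ht := by
    have ha : a ∈ Icc a b := left_mem_Icc.2 (ht.1.trans ht.2)
    rw [h.eq t ht, map_add, L.intervalIntegral_comp_comm
      (intervalIntegrable_of_integrableOn_Ioo h.integrable ha ht)]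

theorem add (h : IsPrimitiveOn a b u u') (h' : IsPrimitiveOn a b w w') :
    IsPrimitiveOn a b (fun t => u t + w t) (fun t => u' t + w' t) where
  integrable := Integrable.add h.integrable h'.integrable
  eq t ht := by
    have ha : a ∈ Icc a b := left_mem_Icc.2 (ht.1.trans ht.2)
    rw [h.eq t ht, h'.eq t ht, intervalIntegral.integral_add
      (intervalIntegrable_of_integrableOn_Ioo h.integrable ha ht)
      (intervalIntegrable_of_integrableOn_Ioo h'.integrable ha ht)]
    abel

theorem const_smul (h : IsPrimitiveOn a b u u') (c : ℝ) :
    IsPrimitiveOn a b (fun t => c • u t) (fun t => c • u' t) where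
  integrable := Integrable.smul c h.integrable
  eq t ht := by
    rw [h.eq t ht, intervalIntegral.integral_smul, smul_add]

theorem sub (h : IsPrimitiveOn a b u u') (h' : IsPrimitiveOn a b w w') :
    IsPrimitiveOn a b (fun t => u t - w t) (fun t => u' t - w' t) := by
  simpa [sub_eq_add_neg] using h.add (h'.const_smul (-1))

theorem const (c : E) : IsPrimitiveOn a b (fun _ => c) (fun _ => 0) where
  integrable := by simp
  eq t _ := by simp

theorem smul_const [CompleteSpace E] {k k' : ℝ → ℝ} (h : IsPrimitiveOn a b k k') (e : E) :
    IsPrimitiveOn a b (fun t => k t • e) (fun t => k' t • e) :=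
  h.clm ((ContinuousLinearMap.id ℝ ℝ).smulRight e)

theorem const_mul {k k' : ℝ → ℝ} (h : IsPrimitiveOn a b k k') (c : ℝ) :
    IsPrimitiveOn a b (fun t => c * k t) (fun t => c * k' t) :=
  h.const_smul c

theorem of_integral {g : ℝ → E} (hg : IntegrableOn g (Ioo a b)) (c : E) :
    IsPrimitiveOn a b (fun t => c + ∫ s in a..t, g s) g where
  integrable := hg
  eq t _ := by simp

theorem eqOn_of_ae_eq (h : IsPrimitiveOn a b u u') (h' : IsPrimitiveOn a b w w')
    (h0 : u a = w a) (h1 : u' =ᵐ[volume.restrict (Ioo a b)] w') : EqOn u w (Icc a b) := by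
  intro t ht
  rw [h.eq t ht, h'.eq t ht, h0,
    integral_congr_ae_Ioo h1 (left_mem_Icc.2 (ht.1.trans ht.2)) ht]

/-- Integration by parts. -/
theorem integral_mul_add {u u' w w' : ℝ → ℝ} (hab : a ≤ b) (h : IsPrimitiveOn a b u u')
    (h' : IsPrimitiveOn a b w w') :
    (∫ x in a..b, u' x * w x) + ∫ x in a..b, u x * w' x = u b * w b - u a * w a := by
  have ha : a ∈ Icc a b := left_mem_Icc.2 hab
  have hb : b ∈ Icc a b := right_mem_Icc.2 hab
  have hi := intervalIntegrable_of_integrableOn_Ioo h.integrable ha hb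
  have hi' := intervalIntegrable_of_integrableOn_Ioo h'.integrable ha hb
  -- Integration by parts for absolutely continuous functions is applied to the explicit primitives,
  -- whose derivatives are known almost everywhere; `u` and `w` agree with them only on `[a, b]`.
  have key : ∀ c c' : ℝ, (∫ x in a..b, u' x * (c' + ∫ s in a..x, w' s)) +
      ∫ x in a..b, (c + ∫ s in a..x, u' s) * w' x =
      (c + ∫ s in a..b, u' s) * (c' + ∫ s in a..b, w' s) - c * c' := by
    intro c c'
    have hac : AbsolutelyContinuousOnInterval (fun x => c + ∫ s in a..x, u' s) a b :=
      ((LipschitzWith.const c).lipschitzOnWith).absolutelyContinuousOnInterval.add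
        (hi.absolutelyContinuousOnInterval_intervalIntegral left_mem_uIcc)
    have hac' : AbsolutelyContinuousOnInterval (fun x => c' + ∫ s in a..x, w' s) a b :=
      ((LipschitzWith.const c').lipschitzOnWith).absolutelyContinuousOnInterval.add
        (hi'.absolutelyContinuousOnInterval_intervalIntegral left_mem_uIcc)
    have hp := hac.integral_mul_deriv_eq_deriv_mul hac'
    have e1 : ∫ x in a..b, (c + ∫ s in a..x, u' s) * deriv (fun x => c' + ∫ s in a..x, w' s) x =
        ∫ x in a..b, (c + ∫ s in a..x, u' s) * w' x := by
      apply intervalIntegral.integral_congr_ae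
      filter_upwards [hi'.ae_hasDerivAt_integral] with x hx hx'
      rw [((hx (uIoc_subset_uIcc hx') a left_mem_uIcc).const_add c').deriv]
    have e2 : ∫ x in a..b, deriv (fun x => c + ∫ s in a..x, u' s) x * (c' + ∫ s in a..x, w' s) =
        ∫ x in a..b, u' x * (c' + ∫ s in a..x, w' s) := by
      apply intervalIntegral.integral_congr_ae
      filter_upwards [hi.ae_hasDerivAt_integral] with x hx hx'
      rw [((hx (uIoc_subset_uIcc hx') a left_mem_uIcc).const_add c).deriv]
    rw [e1, e2] at hp
    simp only [intervalIntegral.integral_same, add_zero] at hp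
    linarith
  have e1 : ∫ x in a..b, u' x * w x = ∫ x in a..b, u' x * (w a + ∫ s in a..x, w' s) := by
    apply intervalIntegral.integral_congr
    rw [uIcc_of_le hab]
    intro x hx
    simp only
    rw [h'.eq x hx]
  have e2 : ∫ x in a..b, u x * w' x = ∫ x in a..b, (u a + ∫ s in a..x, u' s) * w' x := by
    apply intervalIntegral.integral_congr
    rw [uIcc_of_le hab]
    intro x hx
    simp only
    rw [h.eq x hx]
  rw [e1, e2, key, ← h.eq b hb, ← h'.eq b hb]

theorem of_contDiff {θ : ℝ → ℝ} (h : ContDiff ℝ ∞ θ) : IsPrimitiveOn a b θ (deriv θ) where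
  integrable := integrableOn_Ioo_of_continuousOn (h.continuous_deriv (by simp)).continuousOn
  eq t _ := by
    rw [intervalIntegral.integral_deriv_eq_sub
      (fun x _ => h.differentiable (by simp) x)
      ((h.continuous_deriv (by simp)).intervalIntegrable _ _)]
    ring

end IsPrimitiveOn

/-! ### Weak derivatives and primitives -/

/-- Continuous functionals separate points and commute with the integrals, so scalar integration by
parts is enough; the test function vanishes at both end points. -/
theorem IsPrimitiveOn.hasWeakDeriv [CompleteSpace E] (hab : a < b) (h : IsPrimitiveOn a b u u') :
    HasWeakDeriv a b u u' := by
  intro θ h1 h2 h3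
  have hz : ∀ t, t ∉ Ioo a b → θ t = 0 := fun t ht =>
    image_eq_zero_of_notMem_tsupport fun hh => ht (h3 hh)
  have hd : Continuous (deriv θ) := h1.continuous_deriv (by simp)
  have hbd : ∀ {g : ℝ → E} {η : ℝ → ℝ}, IntegrableOn g (Ioo a b) → Continuous η →
      IntegrableOn (fun t => η t • g t) (Ioo a b) := by
    intro g η hg hη
    obtain ⟨K, hK⟩ := (isCompact_Icc (a := a) (b := b)).exists_bound_of_continuousOn
      hη.continuousOn
    refine Integrable.bdd_smul hg K hη.aestronglyMeasurable ?_
    filter_upwards [ae_restrict_mem measurableSet_Ioo] with t ht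
    exact hK t (Ioo_subset_Icc_self ht)
  have hi1 := hbd (integrableOn_Ioo_of_continuousOn h.continuousOn) hd
  have hi2 := hbd h.integrable h1.continuous
  rw [eq_neg_iff_add_eq_zero]
  refine SeparatingDual.eq_zero_of_forall_dual_eq_zero (R := ℝ) fun L => ?_
  rw [map_add, ← L.integral_comp_comm hi1, ← L.integral_comp_comm hi2]
  simp only [map_smul, smul_eq_mul]
  rw [integral_Ioo_eq hab.le, integral_Ioo_eq hab.le]
  have := (IsPrimitiveOn.of_contDiff (a := a) (b := b) h1).integral_mul_add hab.le (h.clm L)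
  rw [this, hz a (by simp), hz b (by simp)]
  simp

/-- After composition with a functional, the scalar theorem gives a primitive almost everywhere, up
to a constant. Continuity of `u` makes this hold at every point of `[a, b]`, and the functionals
separate points. -/
theorem HasWeakDeriv.isPrimitiveOn [CompleteSpace E] (hab : a < b)
    (hu : ContinuousOn u (Icc a b)) (hu' : IntegrableOn u' (Ioo a b))
    (h : HasWeakDeriv a b u u') : IsPrimitiveOn a b u u' where
  integrable := hu'
  eq t ht := by
    have ha : a ∈ Icc a b := left_mem_Icc.2 hab.le
    rw [← sub_eq_zero]
    refine SeparatingDual.eq_zero_of_forall_dual_eq_zero (R := ℝ) fun L => ?_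
    have hL : HasWeakDeriv a b (fun t => L (u t)) (fun t => L (u' t)) := by
      intro θ h1 h2 h3
      have hd : Continuous (deriv θ) := h1.continuous_deriv (by simp)
      have hbd : ∀ {g : ℝ → E} {η : ℝ → ℝ}, IntegrableOn g (Ioo a b) → Continuous η →
          IntegrableOn (fun t => η t • g t) (Ioo a b) := by
        intro g η hg hη
        obtain ⟨K, hK⟩ := (isCompact_Icc (a := a) (b := b)).exists_bound_of_continuousOn
          hη.continuousOn
        refine Integrable.bdd_smul hg K hη.aestronglyMeasurable ?_
        filter_upwards [ae_restrict_mem measurableSet_Ioo] with t ht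
        exact hK t (Ioo_subset_Icc_self ht)
      have := congrArg L (h θ h1 h2 h3)
      rw [map_neg, ← L.integral_comp_comm (hbd (integrableOn_Ioo_of_continuousOn hu) hd),
        ← L.integral_comp_comm (hbd hu' h1.continuous)] at this
      simpa using this
    have hLc : ContinuousOn (fun t => L (u t)) (Icc a b) := L.continuous.comp_continuousOn hu
    have hLi : IntegrableOn (fun t => L (u' t)) (Ioo a b) := L.integrable_comp hu'
    obtain ⟨C, hC⟩ := hL.exists_ae_eq_primitive hab (integrableOn_Ioo_of_continuousOn hLc) hLi
    have hP := IsPrimitiveOn.of_integral hLi C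
    have hE := Measure.eqOn_Icc_of_ae_eq volume hab.ne
      (by rwa [← restrict_Ioo_eq_restrict_Icc]) hLc hP.continuousOn
    have e1 := hE ht
    have e2 := hE ha
    simp only [intervalIntegral.integral_same, add_zero] at e1 e2
    rw [map_sub, map_add, ← L.intervalIntegral_comp_comm
      (intervalIntegrable_of_integrableOn_Ioo hu' ha ht), e1, e2, sub_self]

/-- The zero function is a primitive of `u' - w'`, so this difference integrates to zero against
every test function and vanishes almost everywhere. -/
theorem IsPrimitiveOn.ae_eq [CompleteSpace E] (hab : a < b) (h : IsPrimitiveOn a b u u')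
    (h' : IsPrimitiveOn a b w w') (he : EqOn u w (Icc a b)) :
    u' =ᵐ[volume.restrict (Ioo a b)] w' := by
  have hl : LocallyIntegrableOn (fun x => u' x - w' x) (Ioo a b) volume :=
    IntegrableOn.locallyIntegrableOn (Integrable.sub h.integrable h'.integrable)
  have hp : IsPrimitiveOn a b (fun _ => (0 : E)) (fun x => u' x - w' x) :=
    (h.sub h').congr (fun t ht => by simp [he ht]) Filter.EventuallyEq.rfl
  have := isOpen_Ioo.ae_eq_zero_of_integral_contDiff_smul_eq_zero hl (fun θ h1 h2 h3 => by
    have h4 := hp.hasWeakDeriv hab θ h1 h2 h3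
    simp only [smul_zero, integral_zero, zero_eq_neg] at h4
    rw [← h4, setIntegral_eq_integral_of_forall_compl_eq_zero]
    intro x hx
    rw [image_eq_zero_of_notMem_tsupport fun hh => hx (h3 hh), zero_smul])
  rw [Filter.EventuallyEq, ae_restrict_iff' measurableSet_Ioo]
  filter_upwards [this] with x hx hx'
  exact sub_eq_zero.1 (hx hx')

theorem eqOn_Icc_of_ae_eq_Ioo (hab : a < b) (hu : ContinuousOn u (Icc a b))
    (hw : ContinuousOn w (Icc a b)) (h : u =ᵐ[volume.restrict (Ioo a b)] w) :
    EqOn u w (Icc a b) :=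
  Measure.eqOn_Icc_of_ae_eq volume hab.ne (by rwa [← restrict_Ioo_eq_restrict_Icc]) hu hw

theorem eqOn_Icc_of_eqOn_Ioo (hab : a < b) (hu : ContinuousOn u (Icc a b))
    (hw : ContinuousOn w (Icc a b)) (h : EqOn u w (Ioo a b)) : EqOn u w (Icc a b) :=
  eqOn_Icc_of_ae_eq_Ioo hab hu hw
    ((ae_restrict_mem measurableSet_Ioo).mono fun _ ht => h ht)

/-! ### Sobolev jets as chains of primitives -/

theorem IsSobolevJet.isPrimitiveOn [CompleteSpace E] (hab : a < b) {m : ℕ} {D : ℕ → ℝ → E}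
    (h : IsSobolevJet m a b D) {j : ℕ} (hj : j < m) : IsPrimitiveOn a b (D j) (D (j + 1)) :=
  (h.weak j hj).isPrimitiveOn hab (h.continuousOn j hj) (integrableOn_Ioo_of_memLp (h.memLp (j + 1) hj))

theorem IsSobolevJet.of_isPrimitiveOn [CompleteSpace E] (hab : a < b) {m : ℕ} {D : ℕ → ℝ → E}
    (h : ∀ j < m, IsPrimitiveOn a b (D j) (D (j + 1)))
    (hm : MemLp (D m) 2 (volume.restrict (Ioo a b))) : IsSobolevJet m a b D where
  memLp j hj := by
    rcases hj.lt_or_eq with hj | rfl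
    · exact memLp_Ioo_of_continuousOn (h j hj).continuousOn
    · exact hm
  continuousOn j hj := (h j hj).continuousOn
  weak j hj := (h j hj).hasWeakDeriv hab

/-- Induction on the order: equal functions have almost everywhere equal derivatives, and below the
top order continuity makes them equal everywhere. Hence the choice made in `wderiv` is harmless: any
jet of `u` computes it. -/
theorem IsSobolevJet.congr_jet [CompleteSpace E] (hab : a < b) {m : ℕ} {D D' : ℕ → ℝ → E}
    (h : IsSobolevJet m a b D) (h' : IsSobolevJet m a b D') (h0 : EqOn (D 0) (D' 0) (Icc a b)) :
    (∀ j < m, EqOn (D j) (D' j) (Icc a b)) ∧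
      ∀ j ≤ m, j ≠ 0 → D j =ᵐ[volume.restrict (Ioo a b)] D' j := by
  have key : ∀ j < m, EqOn (D j) (D' j) (Icc a b) := by
    intro j
    induction j with
    | zero => exact fun _ => h0
    | succ j ih =>
      intro hj
      have hj' : j < m := by omega
      exact eqOn_Icc_of_ae_eq_Ioo hab (h.continuousOn _ hj) (h'.continuousOn _ hj)
        ((h.isPrimitiveOn hab hj').ae_eq hab (h'.isPrimitiveOn hab hj') (ih hj'))
  refine ⟨key, fun j hj hj0 => ?_⟩
  obtain ⟨i, rfl⟩ := Nat.exists_eq_succ_of_ne_zero hj0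
  exact (h.isPrimitiveOn hab hj).ae_eq hab (h'.isPrimitiveOn hab hj) (key i hj)

theorem IsSobolevJet.memH {m : ℕ} {D : ℕ → ℝ → E} (h : IsSobolevJet m a b D)
    (h0 : EqOn (D 0) u (Icc a b)) : MemH m a b u := ⟨D, h, h0⟩

theorem IsSobolevJet.wderiv_eqOn [CompleteSpace E] (hab : a < b) {m : ℕ} {D : ℕ → ℝ → E}
    (h : IsSobolevJet m a b D) (h0 : EqOn (D 0) u (Icc a b)) {j : ℕ} (hj : j < m) :
    EqOn (wderiv m a b u j) (D j) (Icc a b) :=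
  ((isSobolevJet_wderiv (h.memH h0)).1.congr_jet hab h
    ((isSobolevJet_wderiv (h.memH h0)).2.trans h0.symm)).1 j hj

theorem IsSobolevJet.wderiv_ae_eq [CompleteSpace E] (hab : a < b) {m : ℕ} {D : ℕ → ℝ → E}
    (h : IsSobolevJet m a b D) (h0 : EqOn (D 0) u (Icc a b)) {j : ℕ} (hj : j ≤ m) (hj0 : j ≠ 0) :
    wderiv m a b u j =ᵐ[volume.restrict (Ioo a b)] D j :=
  ((isSobolevJet_wderiv (h.memH h0)).1.congr_jet hab h
    ((isSobolevJet_wderiv (h.memH h0)).2.trans h0.symm)).2 j hj hj0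

theorem MemH.isPrimitiveOn [CompleteSpace E] (hab : a < b) {m : ℕ} (h : MemH m a b u) {j : ℕ}
    (hj : j < m) : IsPrimitiveOn a b (wderiv m a b u j) (wderiv m a b u (j + 1)) :=
  (isSobolevJet_wderiv h).1.isPrimitiveOn hab hj

theorem MemH.memLp {m : ℕ} (h : MemH m a b u) {j : ℕ} (hj : j ≤ m) :
    MemLp (wderiv m a b u j) 2 (volume.restrict (Ioo a b)) :=
  (isSobolevJet_wderiv h).1.memLp j hj

theorem MemH.continuousOn_wderiv {m : ℕ} (h : MemH m a b u) {j : ℕ} (hj : j < m) :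
    ContinuousOn (wderiv m a b u j) (Icc a b) :=
  (isSobolevJet_wderiv h).1.continuousOn j hj

theorem MemH.wderiv_zero {m : ℕ} (h : MemH m a b u) : EqOn (wderiv m a b u 0) u (Icc a b) :=
  (isSobolevJet_wderiv h).2

theorem MemH.continuousOn {m : ℕ} (h : MemH m a b u) (hm : 0 < m) : ContinuousOn u (Icc a b) :=
  (h.continuousOn_wderiv hm).congr h.wderiv_zero.symm

end Primitive

end AcousticInverse

namespace AcousticInverse

/-! ### Convolution on a bounded time interval -/

section Conv

variable {E F : Type*} [NormedAddCommGroup E] [NormedSpace ℝ E] [NormedAddCommGroup F]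
  [NormedSpace ℝ F] {T : ℝ}

/-- The convolution `∫_0^t k(t-s) g(s) ds`. -/
noncomputable def conv (k : ℝ → ℝ) (g : ℝ → E) (t : ℝ) : E := ∫ s in (0 : ℝ)..t, k (t - s) • g s

/-- For `t ∈ [0, T]` the arguments `s` and `t - s` stay in `[0, T]`, so both factors may be replaced
by continuous extensions to the line. -/
theorem conv_congr {k k' : ℝ → ℝ} {g g' : ℝ → E} (hk : EqOn k k' (Icc 0 T))
    (hg : EqOn g g' (Icc 0 T)) : EqOn (conv k g) (conv k' g') (Icc 0 T) := by
  intro t ht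
  apply intervalIntegral.integral_congr
  rw [uIcc_of_le ht.1]
  intro s hs
  simp only
  rw [hk ⟨by linarith [hs.2], by linarith [hs.1, ht.2]⟩, hg ⟨hs.1, hs.2.trans ht.2⟩]

/-- A continuous function on `[0, T]` extends to a continuous function on the line. -/
theorem exists_continuous_extension (hT : 0 ≤ T) {g : ℝ → E} (hg : ContinuousOn g (Icc 0 T)) :
    ∃ G : ℝ → E, Continuous G ∧ EqOn g G (Icc 0 T) :=
  ⟨IccExtend hT ((Icc 0 T).domRestrict g), (continuousOn_iff_continuous_domRestrict.1 hg).Icc_extend',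
    fun t ht => by rw [IccExtend_of_mem _ _ ht]; rfl⟩

theorem continuous_conv {k : ℝ → ℝ} {g : ℝ → E} (hk : Continuous k) (hg : Continuous g) :
    Continuous (conv k g) :=
  intervalIntegral.continuous_parametric_intervalIntegral_of_continuous
    (f := fun t s => k (t - s) • g s) (by fun_prop) continuous_id

theorem continuousOn_conv {k : ℝ → ℝ} {g : ℝ → E} (hk : ContinuousOn k (Icc 0 T))
    (hg : ContinuousOn g (Icc 0 T)) : ContinuousOn (conv k g) (Icc 0 T) := by
  rcases lt_or_ge T 0 with hT | hT
  · rw [Icc_eq_empty (not_le.2 hT)]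
    exact continuousOn_empty _
  obtain ⟨K, hK, hkK⟩ := exists_continuous_extension hT hk
  obtain ⟨G, hG, hgG⟩ := exists_continuous_extension hT hg
  exact (continuous_conv hK hG).continuousOn.congr (conv_congr hkK hgG)

theorem conv_zero (k : ℝ → ℝ) (g : ℝ → E) : conv k g 0 = 0 := by simp [conv]

theorem intervalIntegrable_conv {k : ℝ → ℝ} {g : ℝ → E} (hk : ContinuousOn k (Icc 0 T))
    (hg : ContinuousOn g (Icc 0 T)) {t : ℝ} (ht : t ∈ Icc 0 T) :
    IntervalIntegrable (fun s => k (t - s) • g s) volume 0 t := by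
  apply ContinuousOn.intervalIntegrable
  rw [uIcc_of_le ht.1]
  refine ContinuousOn.smul (hk.comp (by fun_prop) fun s hs => ?_)
    (hg.mono (Icc_subset_Icc_right ht.2))
  exact ⟨by linarith [hs.2], by linarith [hs.1, ht.2]⟩

theorem map_conv [CompleteSpace E] [CompleteSpace F] {k : ℝ → ℝ} {g : ℝ → E}
    (hk : ContinuousOn k (Icc 0 T)) (hg : ContinuousOn g (Icc 0 T)) (L : E →L[ℝ] F) {t : ℝ}
    (ht : t ∈ Icc 0 T) : L (conv k g t) = conv k (fun s => L (g s)) t := by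
  rw [conv, ← L.intervalIntegral_comp_comm (intervalIntegrable_conv hk hg ht)]
  simp [conv]

theorem conv_const_mul (k g : ℝ → ℝ) (c t : ℝ) :
    conv k (fun s => c * g s) t = c * conv k g t := by
  simp only [conv, smul_eq_mul]
  rw [← intervalIntegral.integral_const_mul]
  congr 1
  funext s
  ring

theorem conv_sub {k : ℝ → ℝ} {g h : ℝ → E}
    (hk : ContinuousOn k (Icc 0 T)) (hg : ContinuousOn g (Icc 0 T))
    (hh : ContinuousOn h (Icc 0 T)) {t : ℝ}
    (ht : t ∈ Icc 0 T) : conv k (fun s => g s - h s) t = conv k g t - conv k h t := by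
  simp only [conv, smul_sub]
  exact intervalIntegral.integral_sub (intervalIntegrable_conv hk hg ht)
    (intervalIntegrable_conv hk hh ht)

theorem conv_eq_reflect (k : ℝ → ℝ) (g : ℝ → E) (t : ℝ) :
    conv k g t = ∫ s in (0 : ℝ)..t, k s • g (t - s) := by
  have := intervalIntegral.integral_comp_sub_left (a := 0) (b := t)
    (fun s => k s • g (t - s)) t
  simp only [sub_sub_cancel, sub_self, sub_zero] at this
  exact this

/-- Fubini on the triangle `s ≤ τ`, written as an indicator on the square `(0, t]²`. -/
theorem integral_triangle_swap {f : ℝ → ℝ → E} (hf : Continuous f.uncurry) {t : ℝ} (ht : 0 ≤ t) :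
    ∫ τ in (0 : ℝ)..t, ∫ s in (0 : ℝ)..τ, f τ s = ∫ s in (0 : ℝ)..t, ∫ τ in s..t, f τ s := by
  have hind : ∀ τ s : ℝ, (Iic τ).indicator (f τ) s = (Ici s).indicator (fun τ => f τ s) τ :=
    fun τ s => by simp [indicator_apply]
  have e1 : ∫ τ in (0 : ℝ)..t, ∫ s in (0 : ℝ)..τ, f τ s =
      ∫ τ in Ioc 0 t, ∫ s in Ioc 0 t, (Iic τ).indicator (f τ) s := by
    rw [intervalIntegral.integral_of_le ht]
    refine setIntegral_congr_fun measurableSet_Ioc fun τ hτ => ?_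
    rw [setIntegral_indicator measurableSet_Iic, intervalIntegral.integral_of_le hτ.1.le,
      Ioc_inter_Iic, min_eq_right hτ.2]
  have e2 : ∫ s in (0 : ℝ)..t, ∫ τ in s..t, f τ s =
      ∫ s in Ioc 0 t, ∫ τ in Ioc 0 t, (Iic τ).indicator (f τ) s := by
    rw [intervalIntegral.integral_of_le ht]
    refine setIntegral_congr_fun measurableSet_Ioc fun s hs => ?_
    simp only [hind]
    rw [setIntegral_indicator measurableSet_Ici, intervalIntegral.integral_of_le hs.2,
      ← integral_Icc_eq_integral_Ioc]
    congr 2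
    ext x
    simp only [mem_Icc, mem_inter_iff, mem_Ioc, mem_Ici]
    constructor
    · rintro ⟨h1, h2⟩
      exact ⟨⟨lt_of_lt_of_le hs.1 h1, h2⟩, h1⟩
    · rintro ⟨⟨_, h2⟩, h1⟩
      exact ⟨h1, h2⟩
  rw [e1, e2]
  apply integral_integral_swap
  have hm : MeasurableSet {p : ℝ × ℝ | p.2 ≤ p.1} := measurableSet_le measurable_snd measurable_fst
  have : (Function.uncurry fun τ s => (Iic τ).indicator (f τ) s) =
      {p : ℝ × ℝ | p.2 ≤ p.1}.indicator f.uncurry := by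
    ext ⟨τ, s⟩
    simp [indicator_apply, Function.uncurry]
  rw [this, Measure.prod_restrict]
  refine Integrable.indicator ?_ hm
  refine (hf.continuousOn.integrableOn_compact
    ((isCompact_Icc (a := (0 : ℝ)) (b := t)).prod (isCompact_Icc (a := (0 : ℝ)) (b := t)))).mono_set ?_
  exact prod_mono Ioc_subset_Icc_self Ioc_subset_Icc_self

/-- The convolution of a continuous kernel with a continuously differentiable function. -/
theorem IsPrimitiveOn.conv [CompleteSpace E] {k : ℝ → ℝ} {g g' : ℝ → E}
    (hk : ContinuousOn k (Icc 0 T)) (hg : IsPrimitiveOn 0 T g g')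
    (hg' : ContinuousOn g' (Icc 0 T)) :
    IsPrimitiveOn 0 T (conv k g) (fun t => k t • g 0 + AcousticInverse.conv k g' t) where
  integrable := integrableOn_Ioo_of_continuousOn
    ((hk.smul continuousOn_const).add (continuousOn_conv hk hg'))
  eq t ht := by
    have hT : 0 ≤ T := ht.1.trans ht.2
    have h0 : (0 : ℝ) ∈ Icc 0 T := left_mem_Icc.2 hT
    obtain ⟨K, hK, hkK⟩ := exists_continuous_extension hT hk
    obtain ⟨G', hG', hgG'⟩ := exists_continuous_extension hT hg'
    have hsub : ∀ s ∈ Icc 0 T, g s = g 0 + ∫ r in (0 : ℝ)..s, G' r := by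
      intro s hs
      rw [hg.eq s hs]
      congr 1
      apply intervalIntegral.integral_congr
      rw [uIcc_of_le hs.1]
      exact fun r hr => hgG' ⟨hr.1, hr.2.trans hs.2⟩
    -- With `g(t - s) = g(0) + ∫₀^{t-s} g'`, the shift `r = τ - s` turns the inner integral into one
    -- over `[s, t]`; it remains to exchange the order of integration over the triangle.
    have e1 : AcousticInverse.conv k g t =
        ∫ s in (0 : ℝ)..t, (K s • g 0 + ∫ τ in s..t, K s • G' (τ - s)) := by
      rw [conv_eq_reflect]
      apply intervalIntegral.integral_congr
      rw [uIcc_of_le ht.1]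
      intro s hs
      simp only
      rw [hsub (t - s) ⟨by linarith [hs.2], by linarith [hs.1, ht.2]⟩, smul_add,
        intervalIntegral.integral_smul, intervalIntegral.integral_comp_sub_right, sub_self,
        hkK ⟨hs.1, hs.2.trans ht.2⟩]
    have e2 : ∫ τ in (0 : ℝ)..t, (k τ • g 0 + AcousticInverse.conv k g' τ) =
        ∫ τ in (0 : ℝ)..t, (K τ • g 0 + ∫ s in (0 : ℝ)..τ, K s • G' (τ - s)) := by
      apply intervalIntegral.integral_congr
      rw [uIcc_of_le ht.1]
      intro τ hτ
      have hτ' : τ ∈ Icc 0 T := ⟨hτ.1, hτ.2.trans ht.2⟩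
      simp only
      rw [← conv_eq_reflect, hkK hτ', conv_congr hkK hgG' hτ']
    have hc2 : Continuous fun τ => ∫ s in (0 : ℝ)..τ, K s • G' (τ - s) :=
      intervalIntegral.continuous_parametric_intervalIntegral_of_continuous
        (f := fun τ s => K s • G' (τ - s)) (by fun_prop) continuous_id
    have hc1 : Continuous fun s => ∫ τ in s..t, K s • G' (τ - s) := by
      have : (fun s => ∫ τ in s..t, K s • G' (τ - s)) =
          fun s => - ∫ τ in t..s, K s • G' (τ - s) := by
        funext s
        rw [intervalIntegral.integral_symm]
      rw [this]
      exact (intervalIntegral.continuous_parametric_intervalIntegral_of_continuous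
        (f := fun s τ => K s • G' (τ - s)) (by fun_prop) continuous_id).neg
    have hc0 : Continuous fun s => K s • g 0 := by fun_prop
    rw [conv_zero, zero_add, e1, e2, intervalIntegral.integral_add (hc0.intervalIntegrable _ _)
      (hc1.intervalIntegrable _ _), intervalIntegral.integral_add (hc0.intervalIntegrable _ _)
      (hc2.intervalIntegrable _ _)]
    congr 1
    exact (integral_triangle_swap (f := fun τ s => K s • G' (τ - s)) (by fun_prop) ht.1).symm

/-- Prepares integration by parts in `∫ k(t-s) g(s) ds`, where the kernel runs backwards. -/
theorem IsPrimitiveOn.reflect {t : ℝ} (ht : 0 ≤ t) {k κ : ℝ → ℝ} (hk : IsPrimitiveOn 0 t k κ) :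
    IsPrimitiveOn 0 t (fun s => k (t - s)) (fun s => - κ (t - s)) where
  integrable := by
    have h := intervalIntegrable_of_integrableOn_Ioo hk.integrable (left_mem_Icc.2 ht)
      (right_mem_Icc.2 ht)
    have := (h.comp_sub_left t).symm
    simp only [sub_self, sub_zero] at this
    rw [intervalIntegrable_iff_integrableOn_Ioo_of_le ht] at this
    exact Integrable.neg this
  eq s hs := by
    rw [intervalIntegral.integral_neg, intervalIntegral.integral_comp_sub_left, sub_zero,
      ← hk.sub_eq ⟨by linarith [hs.2], by linarith [hs.1]⟩ (right_mem_Icc.2 ht)]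
    ring

/-- Both expressions for the derivative of a convolution agree. -/
theorem conv_deriv_comm {k κ g g' : ℝ → ℝ} (hk : IsPrimitiveOn 0 T k κ)
    (hg : IsPrimitiveOn 0 T g g') {t : ℝ} (ht : t ∈ Icc 0 T) :
    k 0 * g t + conv κ g t = k t * g 0 + conv k g' t := by
  have h0 : (0 : ℝ) ∈ Icc 0 T := left_mem_Icc.2 (ht.1.trans ht.2)
  have := ((hk.mono h0 ht).reflect ht.1).integral_mul_add ht.1 (hg.mono h0 ht)
  simp only [sub_self, sub_zero, neg_mul, intervalIntegral.integral_neg] at this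
  simp only [AcousticInverse.conv, smul_eq_mul]
  linarith

end Conv

/-! ### A quadratic Volterra equation of convolution type -/

section Volterra

variable {E : Type*} [NormedAddCommGroup E] [NormedSpace ℝ E] {T : ℝ}

open Real

/-- The exponentially weighted Volterra operator. -/
noncomputable def volterra (A P : E →L[ℝ] E) (κ : E →L[ℝ] ℝ) (σ : ℝ) (a : ℝ → E) (t : ℝ) : E :=
  ∫ s in (0 : ℝ)..t, (exp (-σ * (t - s)) • A (a s) + κ (a (t - s)) • P (a s))

theorem continuous_volterra (A P : E →L[ℝ] E) (κ : E →L[ℝ] ℝ) (σ : ℝ) {a : ℝ → E}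
    (ha : Continuous a) : Continuous (volterra A P κ σ a) :=
  intervalIntegral.continuous_parametric_intervalIntegral_of_continuous
    (f := fun t s => exp (-σ * (t - s)) • A (a s) + κ (a (t - s)) • P (a s))
    (by fun_prop) continuous_id

theorem intervalIntegrable_volterra (A P : E →L[ℝ] E) (κ : E →L[ℝ] ℝ) (σ : ℝ) {a : ℝ → E}
    (ha : ContinuousOn a (Icc 0 T)) {t : ℝ} (ht : t ∈ Icc 0 T) :
    IntervalIntegrable (fun s => exp (-σ * (t - s)) • A (a s) + κ (a (t - s)) • P (a s))
      volume 0 t := by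
  obtain ⟨a', ha', h⟩ := exists_continuous_extension (ht.1.trans ht.2) ha
  have hc : Continuous fun s => exp (-σ * (t - s)) • A (a' s) + κ (a' (t - s)) • P (a' s) := by
    fun_prop
  refine (hc.intervalIntegrable 0 t).congr fun s hs => ?_
  rw [uIoc_of_le ht.1] at hs
  rw [h ⟨hs.1.le, hs.2.trans ht.2⟩, h ⟨by linarith [hs.2], by linarith [hs.1, ht.2]⟩]

/-- Source of every factor `1/σ` gained from the exponential weight. -/
theorem integral_exp_neg_le {σ : ℝ} (hσ : 0 < σ) {t : ℝ} :
    ∫ s in (0 : ℝ)..t, exp (-σ * s) ≤ 1 / σ := by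
  have hd : ∀ s ∈ uIcc 0 t, HasDerivAt (fun s => -exp (-σ * s) / σ) (exp (-σ * s)) s := by
    intro s _
    have h1 : HasDerivAt (fun s => -σ * s) (-σ) s := by
      simpa using (hasDerivAt_id s).const_mul (-σ)
    have := (h1.exp.neg).div_const σ
    exact this.congr_deriv (by rw [mul_neg, neg_neg, mul_div_assoc, div_self hσ.ne', mul_one])
  rw [intervalIntegral.integral_eq_sub_of_hasDerivAt hd
    ((by fun_prop : Continuous fun s => exp (-σ * s)).intervalIntegrable _ _)]
  have := div_pos (exp_pos (-σ * t)) hσ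
  simp only [mul_zero, exp_zero, neg_div]
  linarith

/-- Only the parts with exponential decay at one of the two ends gain `1/σ`; the constant part costs
a factor `T` and has to be small by itself. -/
theorem norm_integral_le_of_exp_bound {σ : ℝ} (hσ : 0 < σ) {f : ℝ → E} {t : ℝ}
    (ht : t ∈ Icc 0 T) {C₁ C₂ C₃ : ℝ} (h1 : 0 ≤ C₁) (h2 : 0 ≤ C₂) (h3 : 0 ≤ C₃)
    (hf : ∀ s ∈ Icc 0 t, ‖f s‖ ≤ C₁ * exp (-σ * (t - s)) + C₂ * exp (-σ * s) + C₃) :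
    ‖∫ s in (0 : ℝ)..t, f s‖ ≤ (C₁ + C₂) / σ + C₃ * T := by
  have hc1 : Continuous fun s => C₁ * exp (-σ * (t - s)) := by fun_prop
  have hc2 : Continuous fun s => C₂ * exp (-σ * s) := by fun_prop
  have hc12 : Continuous fun s => C₁ * exp (-σ * (t - s)) + C₂ * exp (-σ * s) := hc1.add hc2
  have hb := intervalIntegral.norm_integral_le_of_norm_le (μ := volume) ht.1
    (Filter.Eventually.of_forall fun s hs => hf s ⟨hs.1.le, hs.2⟩)
    ((hc12.add continuous_const).intervalIntegrable 0 t)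
  refine hb.trans ?_
  rw [intervalIntegral.integral_add (hc12.intervalIntegrable _ _) (by simp),
    intervalIntegral.integral_add (hc1.intervalIntegrable _ _) (hc2.intervalIntegrable _ _),
    intervalIntegral.integral_const_mul, intervalIntegral.integral_const_mul,
    intervalIntegral.integral_comp_sub_left (fun s => exp (-σ * s)), sub_self, sub_zero]
  simp only [intervalIntegral.integral_const, sub_zero, smul_eq_mul]
  have i1 := mul_le_mul_of_nonneg_left (integral_exp_neg_le hσ (t := t)) h1
  have i2 := mul_le_mul_of_nonneg_left (integral_exp_neg_le hσ (t := t)) h2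
  have i3 := mul_le_mul_of_nonneg_right ht.2 h3
  have : (C₁ + C₂) / σ = C₁ * (1 / σ) + C₂ * (1 / σ) := by ring
  rw [this]
  linarith

/-- The quadratic term is split as `κ(a - b) P a + κ(b) P(a - b)`, so one factor is always the
difference. The decaying part `M exp(-σ s)` of the other factor contributes `M/σ`, its uniform part
contributes `ρ T`. -/
theorem norm_volterra_sub_le (A P : E →L[ℝ] E) (κ : E →L[ℝ] ℝ) {σ : ℝ} (hσ : 0 < σ)
    {a b : ℝ → E} (ha : ContinuousOn a (Icc 0 T)) (hb : ContinuousOn b (Icc 0 T)) {M ρ δ : ℝ}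
    (hM : 0 ≤ M) (hρ : 0 ≤ ρ) (hδ : 0 ≤ δ) (ha' : ∀ s ∈ Icc 0 T, ‖a s‖ ≤ M * exp (-σ * s) + ρ)
    (hb' : ∀ s ∈ Icc 0 T, ‖b s‖ ≤ M * exp (-σ * s) + ρ) (hab : ∀ s ∈ Icc 0 T, ‖a s - b s‖ ≤ δ)
    {t : ℝ} (ht : t ∈ Icc 0 T) :
    ‖volterra A P κ σ a t - volterra A P κ σ b t‖ ≤
      ((‖A‖ + 2 * (‖κ‖ * ‖P‖) * M) / σ + 2 * (‖κ‖ * ‖P‖) * ρ * T) * δ := by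
  have hK : 0 ≤ ‖κ‖ * ‖P‖ := by positivity
  rw [volterra, volterra, ← intervalIntegral.integral_sub
    (intervalIntegrable_volterra A P κ σ ha ht) (intervalIntegrable_volterra A P κ σ hb ht)]
  refine (norm_integral_le_of_exp_bound hσ ht (C₁ := (‖A‖ + ‖κ‖ * ‖P‖ * M) * δ)
    (C₂ := ‖κ‖ * ‖P‖ * M * δ) (C₃ := 2 * (‖κ‖ * ‖P‖) * ρ * δ) (by positivity) (by positivity)
    (by positivity) fun s hs => ?_).trans (le_of_eq (by ring))
  have hs1 : s ∈ Icc 0 T := ⟨hs.1, hs.2.trans ht.2⟩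
  have hs2 : t - s ∈ Icc 0 T := ⟨by linarith [hs.2], by linarith [hs.1, ht.2]⟩
  have e : exp (-σ * (t - s)) • A (a s) + κ (a (t - s)) • P (a s) -
      (exp (-σ * (t - s)) • A (b s) + κ (b (t - s)) • P (b s)) =
      exp (-σ * (t - s)) • A (a s - b s) + κ (a (t - s) - b (t - s)) • P (a s) +
        κ (b (t - s)) • P (a s - b s) := by
    simp only [map_sub, smul_sub, sub_smul]
    abel
  rw [e]
  have n1 : ‖exp (-σ * (t - s)) • A (a s - b s)‖ ≤ exp (-σ * (t - s)) * (‖A‖ * δ) := by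
    rw [norm_smul, Real.norm_eq_abs, abs_of_pos (exp_pos _)]
    gcongr
    exact A.le_of_opNorm_le_of_le le_rfl (hab s hs1)
  have n2 : ‖κ (a (t - s) - b (t - s)) • P (a s)‖ ≤
      (‖κ‖ * δ) * (‖P‖ * (M * exp (-σ * s) + ρ)) := by
    rw [norm_smul]
    gcongr
    · exact κ.le_of_opNorm_le_of_le le_rfl (hab _ hs2)
    · exact P.le_of_opNorm_le_of_le le_rfl (ha' s hs1)
  have n3 : ‖κ (b (t - s)) • P (a s - b s)‖ ≤
      (‖κ‖ * (M * exp (-σ * (t - s)) + ρ)) * (‖P‖ * δ) := by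
    rw [norm_smul]
    gcongr
    · exact κ.le_of_opNorm_le_of_le le_rfl (hb' _ hs2)
    · exact P.le_of_opNorm_le_of_le le_rfl (hab s hs1)
  refine (norm_add₃_le.trans (add_le_add_three n1 n2 n3)).trans (le_of_eq (by ring))

/-- The weight passes through the quadratic term unchanged because `exp(-σ(t-s)) exp(-σ s) = exp(-σ
t)`; only the linear term keeps a kernel. -/
theorem volterra_exp_smul (A P : E →L[ℝ] E) (κ : E →L[ℝ] ℝ) (σ : ℝ) (w : ℝ → E) (t : ℝ) :
    volterra A P κ σ (fun s => exp (-σ * s) • w s) t =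
      exp (-σ * t) • ∫ s in (0 : ℝ)..t, (A (w s) + κ (w (t - s)) • P (w s)) := by
  rw [volterra, ← intervalIntegral.integral_smul]
  congr 1
  funext s
  have e : exp (-σ * t) = exp (-σ * (t - s)) * exp (-σ * s) := by
    rw [← exp_add]
    ring_nf
  simp only [map_smul, smul_add, smul_smul, smul_eq_mul, e]
  congr 2
  ring

/-- Compare the two weighted solutions where their distance `δ` is maximal. Both are bounded by `M
exp(-σ s)`, so the Lipschitz estimate with `ρ = 0` gives `δ ≤ (L/σ) δ`, and `L/σ ≤ 1/2` forces `δ =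
0`. -/
theorem volterra_unique (A P : E →L[ℝ] E) (κ : E →L[ℝ] ℝ) {g w w' : ℝ → E}
    (hw : ContinuousOn w (Icc 0 T)) (hw' : ContinuousOn w' (Icc 0 T))
    (h : ∀ t ∈ Icc 0 T, w t = g t + ∫ s in (0 : ℝ)..t, (A (w s) + κ (w (t - s)) • P (w s)))
    (h' : ∀ t ∈ Icc 0 T, w' t = g t + ∫ s in (0 : ℝ)..t, (A (w' s) + κ (w' (t - s)) • P (w' s))) :
    EqOn w w' (Icc 0 T) := by
  intro t₀ ht₀
  obtain ⟨N₁, hN₁⟩ := isCompact_Icc.exists_bound_of_continuousOn hw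
  obtain ⟨N₂, hN₂⟩ := isCompact_Icc.exists_bound_of_continuousOn hw'
  set M := max N₁ N₂
  have hM : 0 ≤ M := ((norm_nonneg _).trans (hN₁ t₀ ht₀)).trans (le_max_left _ _)
  set L := ‖A‖ + 2 * (‖κ‖ * ‖P‖) * M
  have hL : 0 ≤ L := by positivity
  set σ := 2 * L + 1
  have hσ : 0 < σ := by positivity
  have hc : ∀ {w : ℝ → E}, ContinuousOn w (Icc 0 T) →
      ContinuousOn (fun s => exp (-σ * s) • w s) (Icc 0 T) := fun hw =>
    (by fun_prop : Continuous fun s => exp (-σ * s)).continuousOn.smul hw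
  obtain ⟨t, ht, hmax⟩ := isCompact_Icc.exists_isMaxOn ⟨t₀, ht₀⟩ ((hc hw).sub (hc hw')).norm
  set δ := ‖exp (-σ * t) • w t - exp (-σ * t) • w' t‖
  have hn : ∀ {w : ℝ → E} {N : ℝ}, N ≤ M → (∀ s ∈ Icc 0 T, ‖w s‖ ≤ N) →
      ∀ s ∈ Icc 0 T, ‖exp (-σ * s) • w s‖ ≤ M * exp (-σ * s) + 0 := by
    intro w N hN hw s hs
    rw [norm_smul, Real.norm_eq_abs, abs_of_pos (exp_pos _), mul_comm, add_zero]
    gcongr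
    exact (hw s hs).trans hN
  have key := norm_volterra_sub_le A P κ hσ (hc hw) (hc hw') hM le_rfl (norm_nonneg _)
    (hn (le_max_left _ _) hN₁) (hn (le_max_right _ _) hN₂) (fun s hs => hmax hs) ht
  have e : volterra A P κ σ (fun s => exp (-σ * s) • w s) t -
      volterra A P κ σ (fun s => exp (-σ * s) • w' s) t =
      exp (-σ * t) • w t - exp (-σ * t) • w' t := by
    rw [volterra_exp_smul, volterra_exp_smul, h t ht, h' t ht, smul_add, smul_add]
    abel
  simp only [Pi.sub_apply] at key
  rw [e, mul_zero, zero_mul, add_zero] at key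
  have hlt : L / σ ≤ 1 / 2 := by
    rw [div_le_div_iff₀ hσ two_pos]
    simp only [σ]
    linarith
  have hδ : δ ≤ 0 := by
    have h5 : δ ≤ L / σ * δ := key
    nlinarith [norm_nonneg (exp (-σ * t) • w t - exp (-σ * t) • w' t)]
  have h0 : ‖exp (-σ * t₀) • w t₀ - exp (-σ * t₀) • w' t₀‖ ≤ 0 := (hmax ht₀).trans hδ
  rw [norm_le_zero_iff, ← smul_sub, smul_eq_zero] at h0
  exact sub_eq_zero.1 (h0.resolve_left (exp_pos _).ne')

/-- Write the weighted unknown as `γ + r`, with `γ` the weighted inhomogeneity. Then `r` is a fixed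
point of a contraction of a small ball of `C([0, T], E)`: the self-interaction of `r` is controlled
by the radius `ρ`, all else by `1/σ`. The radius is fixed first, then `σ`, so `T` is not restricted.
-/
theorem volterra_exists [CompleteSpace E] (hT : 0 ≤ T) (A P : E →L[ℝ] E) (κ : E →L[ℝ] ℝ)
    {g : ℝ → E} (hg : ContinuousOn g (Icc 0 T)) :
    ∃ w : ℝ → E, ContinuousOn w (Icc 0 T) ∧
      ∀ t ∈ Icc 0 T, w t = g t + ∫ s in (0 : ℝ)..t, (A (w s) + κ (w (t - s)) • P (w s)) := by
  obtain ⟨g', hg', hgg'⟩ := exists_continuous_extension hT hg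
  obtain ⟨M, hM'⟩ := isCompact_Icc.exists_bound_of_continuousOn hg'.continuousOn
  have h0T : (0 : ℝ) ∈ Icc 0 T := left_mem_Icc.2 hT
  have hM : 0 ≤ M := (norm_nonneg _).trans (hM' 0 h0T)
  set K := ‖κ‖ * ‖P‖
  have hK : 0 ≤ K := by positivity
  -- Chosen so that `2 K ρ T ≤ 1/4`: the uniform part of the ball uses half of the contraction
  -- constant `1/2`.
  set ρ := 1 / (8 * (K * T + 1))
  have hρ : 0 < ρ := by positivity
  have hρ' : 2 * K * ρ * T ≤ 1 / 4 := by
    have : 2 * K * ρ * T = (K * T) / (4 * (K * T + 1)) := by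
      simp only [ρ]
      field_simp
      ring
    rw [this, div_le_div_iff₀ (by positivity) (by norm_num)]
    nlinarith [mul_nonneg hK hT]
  set L := ‖A‖ + 2 * K * M
  have hL : 0 ≤ L := by positivity
  -- The first summand gives `L/σ ≤ 1/4`, the other half of the contraction constant. The second
  -- gives `L M/σ ≤ ρ/2`, so the image of `0` lies in the ball of half the radius.
  set σ := 4 * L + 2 * (L * M) / ρ + 1
  have hσ : 0 < σ := by positivity
  have hσ1 : L / σ ≤ 1 / 4 := by
    rw [div_le_div_iff₀ hσ (by norm_num)]
    have : 0 ≤ 2 * (L * M) / ρ := by positivity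
    simp only [σ]
    linarith
  have hσ2 : L * M / σ ≤ ρ / 2 := by
    rw [div_le_iff₀ hσ]
    have e : ρ / 2 * σ = ρ / 2 * (4 * L + 1) + L * M := by
      simp only [σ]
      field_simp
      ring
    rw [e]
    have : 0 ≤ ρ / 2 * (4 * L + 1) := by positivity
    linarith
  set γ : ℝ → E := fun s => exp (-σ * s) • g' s
  have hγ : Continuous γ := by fun_prop
  have hγn : ∀ s ∈ Icc 0 T, ‖γ s‖ ≤ M * exp (-σ * s) := by
    intro s hs
    simp only [γ]
    rw [norm_smul, Real.norm_eq_abs, abs_of_pos (exp_pos _), mul_comm]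
    gcongr
    exact hM' s hs
  let ext : C(Icc 0 T, E) → ℝ → E := fun r => IccExtend hT r
  have hext : ∀ r, Continuous (ext r) := fun r => r.continuous.Icc_extend'
  have hextn : ∀ r r' : C(Icc 0 T, E), ∀ s ∈ Icc 0 T, ‖ext r s - ext r' s‖ ≤ dist r r' := by
    intro r r' s hs
    simp only [ext]
    rw [IccExtend_of_mem _ _ hs, IccExtend_of_mem _ _ hs, ← dist_eq_norm]
    exact ContinuousMap.dist_apply_le_dist _
  have hext0 : ∀ s, ext 0 s = 0 := fun s => rfl
  let Φ : C(Icc 0 T, E) → C(Icc 0 T, E) := fun r =>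
    ⟨fun t => volterra A P κ σ (fun s => γ s + ext r s) t,
      (continuous_volterra A P κ σ (hγ.add (hext r))).comp continuous_subtype_val⟩
  have hbound : ∀ r ∈ Metric.closedBall (0 : C(Icc 0 T, E)) ρ, ∀ s ∈ Icc 0 T,
      ‖γ s + ext r s‖ ≤ M * exp (-σ * s) + ρ := by
    intro r hr s hs
    refine (norm_add_le _ _).trans (add_le_add (hγn s hs) ?_)
    have := hextn r 0 s hs
    rw [hext0, sub_zero] at this
    exact this.trans hr
  have hlip : ∀ r ∈ Metric.closedBall (0 : C(Icc 0 T, E)) ρ,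
      ∀ r' ∈ Metric.closedBall (0 : C(Icc 0 T, E)) ρ, dist (Φ r) (Φ r') ≤ 1 / 2 * dist r r' := by
    intro r hr r' hr'
    rw [ContinuousMap.dist_le (by positivity)]
    rintro ⟨t, ht⟩
    rw [dist_eq_norm]
    refine (norm_volterra_sub_le A P κ hσ (hγ.add (hext r)).continuousOn
      (hγ.add (hext r')).continuousOn hM hρ.le (dist_nonneg (x := r) (y := r')) (hbound r hr) (hbound r' hr')
      (fun s hs => ?_) ht).trans ?_
    · rw [Pi.add_apply, Pi.add_apply, add_sub_add_left_eq_sub]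
      exact hextn r r' s hs
    · gcongr
      change L / σ + 2 * K * ρ * T ≤ 1 / 2
      linarith
  have h00 : dist (Φ 0) 0 ≤ ρ / 2 := by
    rw [ContinuousMap.dist_le (by positivity)]
    rintro ⟨t, ht⟩
    rw [dist_eq_norm]
    -- The estimate is applied to `γ` and the zero function, with `ρ = 0` and `δ = M`.
    change ‖volterra A P κ σ (fun s => γ s + ext 0 s) t - 0‖ ≤ _
    have hz : volterra A P κ σ (fun _ => (0 : E)) t = 0 := by simp [volterra]
    simp only [hext0, add_zero]
    rw [← hz]
    refine (norm_volterra_sub_le A P κ hσ hγ.continuousOn continuousOn_const hM le_rfl hM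
      (fun s hs => by simpa using hγn s hs) (fun s hs => by simp; positivity)
      (fun s hs => ?_) ht).trans ?_
    · rw [sub_zero]
      refine (hγn s hs).trans (mul_le_of_le_one_right hM ?_)
      rw [exp_le_one_iff]
      nlinarith [hs.1]
    · rw [mul_zero, zero_mul, add_zero, div_mul_eq_mul_div]
      exact hσ2
  have hmaps : MapsTo Φ (Metric.closedBall (0 : C(Icc 0 T, E)) ρ)
      (Metric.closedBall (0 : C(Icc 0 T, E)) ρ) := by
    intro r hr
    have h1 := hlip r hr 0 (Metric.mem_closedBall_self hρ.le)
    have h2 : dist r 0 ≤ ρ := hr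
    rw [Metric.mem_closedBall]
    linarith [dist_triangle (Φ r) (Φ 0) 0]
  have hcontr : ContractingWith (1 / 2) (hmaps.restrict Φ _ _) := by
    refine ⟨by rw [← NNReal.coe_lt_coe]; norm_num, LipschitzWith.of_dist_le_mul fun r r' => ?_⟩
    exact_mod_cast hlip r r.2 r' r'.2
  obtain ⟨r, hr, hfix, -⟩ := hcontr.exists_fixedPoint'
    (Metric.isClosed_closedBall (x := (0 : C(Icc 0 T, E))) (ε := ρ)).isComplete hmaps
    (Metric.mem_closedBall_self (x := (0 : C(Icc 0 T, E))) hρ.le) (edist_ne_top _ _)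
  have hr : ∀ t ∈ Icc 0 T, ext r t = volterra A P κ σ (fun s => γ s + ext r s) t := by
    intro t ht
    have := congrArg (fun q : C(Icc 0 T, E) => q ⟨t, ht⟩) hfix.eq
    simp only [ext]
    rw [IccExtend_of_mem _ _ ht]
    exact this.symm
  -- Removing the weight from `γ + r` gives the solution.
  refine ⟨fun t => g' t + exp (σ * t) • ext r t, ?_, fun t ht => ?_⟩
  · have := hext r
    exact Continuous.continuousOn (by fun_prop)
  · have e : (fun s => γ s + ext r s) =
        fun s => exp (-σ * s) • (g' s + exp (σ * s) • ext r s) := by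
      funext s
      rw [smul_add, smul_smul, ← exp_add]
      simp [γ]
    have h1 := hr t ht
    rw [e, volterra_exp_smul] at h1
    simp only
    rw [h1, smul_smul, ← exp_add, hgg' ht]
    simp

end Volterra

end AcousticInverse

namespace AcousticInverse

/-! ### Continuous functionals on `L²(I)` and `H²(I)` -/

section Space

variable {ℓ : ℝ}

open Classical in
/-- The functional `h ↦ ∫ g h dx` on `L²(I)`, for `g ∈ L²(I)`. -/
noncomputable def pair (ℓ : ℝ) (g : ℝ → ℝ) : L2 ℓ →L[ℝ] ℝ :=
  if hg : MemLp g 2 (volume.restrict (Ioo 0 ℓ)) then innerSL ℝ (hg.toLp g) else 0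

theorem pair_apply (hℓ : 0 < ℓ) {g : ℝ → ℝ} (hg : MemLp g 2 (volume.restrict (Ioo 0 ℓ)))
    (h : L2 ℓ) : pair ℓ g h = ∫ x in (0 : ℝ)..ℓ, g x * h x := by
  rw [pair, dif_pos hg, innerSL_apply_apply, MeasureTheory.L2.inner_def, ← integral_Ioo_eq hℓ.le]
  apply integral_congr_ae
  filter_upwards [hg.coeFn_toLp] with x hx
  simp [hx, mul_comm]

theorem pair_apply_of_ae_eq (hℓ : 0 < ℓ) {g : ℝ → ℝ}
    (hg : MemLp g 2 (volume.restrict (Ioo 0 ℓ))) {h : L2 ℓ} {h' : ℝ → ℝ}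
    (hh : h =ᵐ[volume.restrict (Ioo 0 ℓ)] h') :
    pair ℓ g h = ∫ x in (0 : ℝ)..ℓ, g x * h' x := by
  rw [pair_apply hℓ hg]
  refine integral_congr_ae_Ioo (a := 0) (b := ℓ) ?_ (left_mem_Icc.2 hℓ.le) (right_mem_Icc.2 hℓ.le)
  filter_upwards [hh] with x hx
  rw [hx]

/-- The `i`-th derivative of `w ∈ H²(I)` as an element of `L²(I)`. -/
noncomputable def coord (ℓ : ℝ) (i : Fin 3) : H2 ℓ →L[ℝ] L2 ℓ :=
  (PiLp.proj (𝕜 := ℝ) 2 (fun _ : Fin 3 => L2 ℓ) i).comp (H2 ℓ).subtypeL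

theorem coord_two (w : H2 ℓ) : coord ℓ 2 w = dxx w := rfl

theorem coord_ae_eq_jet (w : H2 ℓ) (i : Fin 3) :
    coord ℓ i w =ᵐ[volume.restrict (Ioo 0 ℓ)] jet w i :=
  (isSobolevJet_jet w).2 i

theorem coord_zero_ae_eq (w : H2 ℓ) : coord ℓ 0 w =ᵐ[volume.restrict (Ioo 0 ℓ)] val w :=
  coord_ae_eq_jet w 0

theorem coord_one_ae_eq (w : H2 ℓ) : coord ℓ 1 w =ᵐ[volume.restrict (Ioo 0 ℓ)] dx w :=
  coord_ae_eq_jet w 1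

theorem isPrimitiveOn_val (hℓ : 0 < ℓ) (w : H2 ℓ) : IsPrimitiveOn 0 ℓ (val w) (dx w) :=
  (isSobolevJet_jet w).1.isPrimitiveOn hℓ (by norm_num : 0 < 2)

theorem isPrimitiveOn_dx (hℓ : 0 < ℓ) (w : H2 ℓ) : IsPrimitiveOn 0 ℓ (dx w) (dxx w) :=
  ((isSobolevJet_jet w).1.isPrimitiveOn hℓ (by norm_num : 1 < 2)).congr (eqOn_refl _ _)
    (coord_ae_eq_jet w 2).symm

/-- The jet attached to `w` is chosen; its continuous members are determined by the `L²` class of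
`w` alone. -/
theorem eqOn_jet (hℓ : 0 < ℓ) (w : H2 ℓ) {D : ℕ → ℝ → ℝ} (hD : IsSobolevJet 2 0 ℓ D)
    (h : w.1 0 =ᵐ[volume.restrict (Ioo 0 ℓ)] D 0) : ∀ j < 2, EqOn (jet w j) (D j) (Icc 0 ℓ) := by
  obtain ⟨hj, hw⟩ := isSobolevJet_jet w
  exact (hj.congr_jet hℓ hD (eqOn_Icc_of_ae_eq_Ioo hℓ (hj.continuousOn 0 (by norm_num))
    (hD.continuousOn 0 (by norm_num)) ((hw 0).symm.trans h))).1

theorem ext_H2 (hℓ : 0 < ℓ) {w w' : H2 ℓ} (h : EqOn (val w) (val w') (Icc 0 ℓ)) : w = w' := by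
  obtain ⟨hj, hw⟩ := isSobolevJet_jet w
  obtain ⟨hj', hw'⟩ := isSobolevJet_jet w'
  have key := (hj.congr_jet hℓ hj' h).2
  have h0 : jet w 0 =ᵐ[volume.restrict (Ioo 0 ℓ)] jet w' 0 :=
    (ae_restrict_mem measurableSet_Ioo).mono fun _ ht => h (Ioo_subset_Icc_self ht)
  apply Subtype.ext
  apply PiLp.ext
  intro i
  apply Lp.ext
  refine (hw i).trans (Filter.EventuallyEq.trans ?_ (hw' i).symm)
  fin_cases i
  · exact h0
  · exact key 1 (by norm_num) (by norm_num)
  · exact key 2 (by norm_num) (by norm_num)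

/-- The element of `H²(I)` with a given jet. -/
noncomputable def ofJet (D : ℕ → ℝ → ℝ) (hD : IsSobolevJet 2 0 ℓ D) : H2 ℓ :=
  ⟨WithLp.toLp 2 fun i : Fin 3 => (hD.memLp i (by omega)).toLp (D i), D, hD,
    fun i => (hD.memLp i (by omega)).coeFn_toLp⟩

theorem coord_ofJet {D : ℕ → ℝ → ℝ} (hD : IsSobolevJet 2 0 ℓ D) (i : Fin 3) :
    coord ℓ i (ofJet D hD) =ᵐ[volume.restrict (Ioo 0 ℓ)] D i :=
  (hD.memLp i (by omega)).coeFn_toLp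

theorem val_ofJet (hℓ : 0 < ℓ) {D : ℕ → ℝ → ℝ} (hD : IsSobolevJet 2 0 ℓ D) :
    EqOn (val (ofJet D hD)) (D 0) (Icc 0 ℓ) :=
  eqOn_jet hℓ _ hD (coord_ofJet hD 0) 0 (by norm_num)

theorem dx_ofJet (hℓ : 0 < ℓ) {D : ℕ → ℝ → ℝ} (hD : IsSobolevJet 2 0 ℓ D) :
    EqOn (dx (ofJet D hD)) (D 1) (Icc 0 ℓ) :=
  eqOn_jet hℓ _ hD (coord_ofJet hD 0) 1 (by norm_num)

theorem dxx_ofJet {D : ℕ → ℝ → ℝ} (hD : IsSobolevJet 2 0 ℓ D) :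
    dxx (ofJet D hD) =ᵐ[volume.restrict (Ioo 0 ℓ)] D 2 :=
  coord_ofJet hD 2

theorem memLp_const_one : MemLp (fun _ : ℝ => (1 : ℝ)) 2 (volume.restrict (Ioo 0 ℓ)) :=
  memLp_const 1

theorem memLp_id_Ioo : MemLp (fun x : ℝ => x) 2 (volume.restrict (Ioo 0 ℓ)) :=
  memLp_Ioo_of_continuousOn continuousOn_id

/-- The value at the right end point of an absolutely continuous function, as a combination of
integrals. -/
theorem IsPrimitiveOn.value_right (hℓ : 0 < ℓ) {u u' : ℝ → ℝ} (h : IsPrimitiveOn 0 ℓ u u') :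
    u ℓ = ℓ⁻¹ * ((∫ x in (0 : ℝ)..ℓ, 1 * u x) + ∫ x in (0 : ℝ)..ℓ, x * u' x) := by
  have hid : IsPrimitiveOn 0 ℓ (fun x : ℝ => x) (fun _ => 1) :=
    ⟨integrableOn_Ioo_of_continuousOn continuousOn_const, fun t _ => by simp⟩
  have := hid.integral_mul_add hℓ.le h
  rw [this]
  field_simp
  ring

/-- The value at `ℓ` of the `i`-th derivative, if the `j`-th derivative is its derivative. -/
noncomputable def rightValue (ℓ : ℝ) (i j : Fin 3) : H2 ℓ →L[ℝ] ℝ :=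
  ℓ⁻¹ • ((pair ℓ fun _ => 1).comp (coord ℓ i) + (pair ℓ fun x => x).comp (coord ℓ j))

/-- The functional `w ↦ w(x)` on `H²(I)`. -/
noncomputable def valL (ℓ x : ℝ) : H2 ℓ →L[ℝ] ℝ :=
  rightValue ℓ 0 1 - (pair ℓ ((Ioo x ℓ).indicator fun _ => 1)).comp (coord ℓ 1)

/-- The functional `w ↦ w'(ℓ)` on `H²(I)`. -/
noncomputable def dxL (ℓ : ℝ) : H2 ℓ →L[ℝ] ℝ := rightValue ℓ 1 2

/-- `w(x) = w(ℓ) - ∫ₓ^ℓ w'`, and `w(ℓ)` is itself a combination of integrals of `w` and `x w'`.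
Point values are thus bounded functionals on `H²(I)`. -/
theorem valL_apply (hℓ : 0 < ℓ) {x : ℝ} (hx : x ∈ Icc 0 ℓ) (w : H2 ℓ) : valL ℓ x w = val w x := by
  have hp := isPrimitiveOn_val hℓ w
  have hr : rightValue ℓ 0 1 w = val w ℓ := by
    rw [hp.value_right hℓ, ← pair_apply_of_ae_eq hℓ memLp_const_one (coord_zero_ae_eq w),
      ← pair_apply_of_ae_eq hℓ memLp_id_Ioo (coord_one_ae_eq w)]
    rfl
  have hi : pair ℓ ((Ioo x ℓ).indicator fun _ => 1) (coord ℓ 1 w) = val w ℓ - val w x := by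
    rw [pair_apply_of_ae_eq hℓ (memLp_const_one.indicator measurableSet_Ioo) (coord_one_ae_eq w),
      hp.sub_eq hx (right_mem_Icc.2 hℓ.le), ← integral_Ioo_eq hℓ.le, ← integral_Ioo_eq hx.2]
    have : ∀ s, (Ioo x ℓ).indicator (fun _ => (1 : ℝ)) s * dx w s = (Ioo x ℓ).indicator (dx w) s :=
      fun s => by simp [indicator_apply]
    simp only [this]
    rw [setIntegral_indicator measurableSet_Ioo, inter_eq_right.2 (Ioo_subset_Ioo_left hx.1)]
  change rightValue ℓ 0 1 w - pair ℓ ((Ioo x ℓ).indicator fun _ => 1) (coord ℓ 1 w) = _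
  rw [hr, hi]
  ring

theorem dxL_apply (hℓ : 0 < ℓ) (w : H2 ℓ) : dxL ℓ w = dx w ℓ := by
  rw [(isPrimitiveOn_dx hℓ w).value_right hℓ,
    ← pair_apply_of_ae_eq hℓ memLp_const_one (coord_one_ae_eq w),
    ← pair_apply hℓ memLp_id_Ioo (dxx w)]
  rfl

theorem mem_H2Zero_iff (hℓ : 0 < ℓ) (w : H2 ℓ) : w ∈ H2Zero ℓ ↔ val w 0 = 0 ∧ val w ℓ = 0 := by
  constructor
  · rintro ⟨D, hD, h, h0, h1⟩
    have := eqOn_jet hℓ w hD (h 0) 0 (by norm_num)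
    exact ⟨(this (left_mem_Icc.2 hℓ.le)).trans h0, (this (right_mem_Icc.2 hℓ.le)).trans h1⟩
  · rintro ⟨h0, h1⟩
    exact ⟨jet w, (isSobolevJet_jet w).1, (isSobolevJet_jet w).2, h0, h1⟩

theorem val_zero_of_H2Zero (hℓ : 0 < ℓ) (w : H2Zero ℓ) : val (w : H2 ℓ) 0 = 0 :=
  ((mem_H2Zero_iff hℓ _).1 w.2).1

theorem val_right_of_H2Zero (hℓ : 0 < ℓ) (w : H2Zero ℓ) : val (w : H2 ℓ) ℓ = 0 :=
  ((mem_H2Zero_iff hℓ _).1 w.2).2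

theorem ext_H2Zero (hℓ : 0 < ℓ) {w w' : H2Zero ℓ}
    (h : EqOn (val (w : H2 ℓ)) (val (w' : H2 ℓ)) (Icc 0 ℓ)) : w = w' :=
  Subtype.ext (ext_H2 hℓ h)

theorem IsSobolevJet.of_le {E : Type*} [NormedAddCommGroup E] [NormedSpace ℝ E] {m n : ℕ}
    {a b : ℝ} {D : ℕ → ℝ → E} (h : IsSobolevJet m a b D) (hn : n ≤ m) : IsSobolevJet n a b D where
  memLp j hj := h.memLp j (hj.trans hn)
  continuousOn j hj := h.continuousOn j (hj.trans_le hn)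
  weak j hj := h.weak j (hj.trans_le hn)

/-! ### The resolvent of the second derivative -/

/-- The operator `w ↦ w - β w''` from `H²(I)` to `L²(I)`. -/
noncomputable def helmholtz (ℓ β : ℝ) : H2 ℓ →L[ℝ] L2 ℓ := coord ℓ 0 - β • coord ℓ 2

theorem helmholtz_ae_eq (β : ℝ) (w : H2 ℓ) : helmholtz ℓ β w =ᵐ[volume.restrict (Ioo 0 ℓ)]
    fun x => val w x - β * dxx w x := by
  change ⇑(coord ℓ 0 w - β • coord ℓ 2 w) =ᵐ[_] _
  filter_upwards [Lp.coeFn_sub (coord ℓ 0 w) (β • coord ℓ 2 w), Lp.coeFn_smul β (coord ℓ 2 w),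
    coord_zero_ae_eq w] with x h1 h2 h3
  rw [h1, Pi.sub_apply, h2, Pi.smul_apply, h3]
  rfl

/-- Energy identity: if `w = β w''` and `w` vanishes at both ends, integration by parts gives `∫ w'²
+ β⁻¹ ∫ w² = 0`. -/
theorem helmholtz_injective (hℓ : 0 < ℓ) {β : ℝ} (hβ : 0 < β) {w : H2Zero ℓ}
    (h : helmholtz ℓ β (w : H2 ℓ) = 0) : w = 0 := by
  have hv := isPrimitiveOn_val hℓ (w : H2 ℓ)
  have hd := isPrimitiveOn_dx hℓ (w : H2 ℓ)
  have h0 : (0 : ℝ) ∈ Icc 0 ℓ := left_mem_Icc.2 hℓ.le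
  have h1 : ℓ ∈ Icc 0 ℓ := right_mem_Icc.2 hℓ.le
  have hp := hv.integral_mul_add hℓ.le hd
  rw [val_zero_of_H2Zero hℓ, val_right_of_H2Zero hℓ, zero_mul, zero_mul, sub_zero] at hp
  have hz : (fun x => val (w : H2 ℓ) x * dxx (w : H2 ℓ) x) =ᵐ[volume.restrict (Ioo 0 ℓ)]
      fun x => β⁻¹ * (val (w : H2 ℓ) x * val (w : H2 ℓ) x) := by
    have h2 := helmholtz_ae_eq β (w : H2 ℓ)
    rw [h] at h2
    filter_upwards [h2, Lp.coeFn_zero ℝ 2 (volume.restrict (Ioo 0 ℓ))] with x hx hx0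
    rw [hx0, Pi.zero_apply] at hx
    have : val (w : H2 ℓ) x = β * dxx (w : H2 ℓ) x := by linarith
    rw [this]
    field_simp
  rw [integral_congr_ae_Ioo hz h0 h1, intervalIntegral.integral_const_mul] at hp
  have hn1 : 0 ≤ ∫ x in (0 : ℝ)..ℓ, dx (w : H2 ℓ) x * dx (w : H2 ℓ) x :=
    intervalIntegral.integral_nonneg hℓ.le fun x _ => mul_self_nonneg _
  have hn2 : 0 ≤ ∫ x in (0 : ℝ)..ℓ, val (w : H2 ℓ) x * val (w : H2 ℓ) x :=
    intervalIntegral.integral_nonneg hℓ.le fun x _ => mul_self_nonneg _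
  have hβ' : 0 < β⁻¹ := inv_pos.2 hβ
  have hz2 : ∫ x in (0 : ℝ)..ℓ, val (w : H2 ℓ) x * val (w : H2 ℓ) x = 0 := by
    nlinarith [mul_nonneg hβ'.le hn2]
  refine ext_H2Zero hℓ fun x hx => ?_
  have hzero : EqOn (val ((0 : H2Zero ℓ) : H2 ℓ)) 0 (Icc 0 ℓ) := fun x hx => by
    rw [← valL_apply hℓ hx]
    simp
  rw [hzero hx]
  by_contra hne
  have hc : ContinuousOn (fun x => val (w : H2 ℓ) x * val (w : H2 ℓ) x) (Icc 0 ℓ) :=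
    hv.continuousOn.mul hv.continuousOn
  have hpos := intervalIntegral.integral_pos hℓ hc (fun _ _ => mul_self_nonneg _)
    ⟨x, hx, mul_self_pos.2 hne⟩
  linarith

/-- Shooting: take a particular solution vanishing at `0` and correct its value at `ℓ` by a multiple
of the homogeneous solution `η` with `η(0) = 0`, `η'(0) = 1`. Here `η(ℓ) ≠ 0`, since otherwise
injectivity would give `η = 0`. -/
theorem helmholtz_surjective (hℓ : 0 < ℓ) {β : ℝ} (hβ : 0 < β) (g : L2 ℓ) :
    ∃ w : H2Zero ℓ, helmholtz ℓ β (w : H2 ℓ) = g := by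
  have solve : ∀ (g : L2 ℓ) (c : ℝ), ∃ w : H2 ℓ, helmholtz ℓ β w = g ∧ val w 0 = 0 ∧
      dx w 0 = c := by
    intro g c
    have hgi : IntegrableOn (fun x => -β⁻¹ * g x) (Ioo 0 ℓ) :=
      Integrable.const_mul (l2_integrableOn g) _
    have hG := IsPrimitiveOn.of_integral hgi c
    -- The initial value problem as a first-order system for `(w, w')`; the Volterra theorem is used
    -- in the variable `x` with no quadratic part.
    obtain ⟨W, hW, hWe⟩ := volterra_exists hℓ.le
      ((ContinuousLinearMap.snd ℝ ℝ ℝ).prod (β⁻¹ • ContinuousLinearMap.fst ℝ ℝ ℝ)) 0 0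
      (g := fun x => ((0 : ℝ), c + ∫ s in (0 : ℝ)..x, -β⁻¹ * g s))
      (continuousOn_const.prodMk hG.continuousOn)
    have hW1 : ContinuousOn (fun x => (W x).1) (Icc 0 ℓ) := continuous_fst.comp_continuousOn hW
    have hW2 : ContinuousOn (fun x => (W x).2) (Icc 0 ℓ) := continuous_snd.comp_continuousOn hW
    have hWp : IsPrimitiveOn 0 ℓ (fun x => W x - ((0 : ℝ), c + ∫ s in (0 : ℝ)..x, -β⁻¹ * g s))
        (fun x => ((W x).2, β⁻¹ * (W x).1)) := by
      refine ⟨integrableOn_Ioo_of_continuousOn (hW2.prodMk (continuousOn_const.mul hW1)), ?_⟩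
      intro t ht
      have e0 := hWe 0 (left_mem_Icc.2 hℓ.le)
      simp only [intervalIntegral.integral_same, add_zero] at e0
      rw [hWe t ht, e0]
      simp
    have hp1 : IsPrimitiveOn 0 ℓ (fun x => (W x).1) (fun x => (W x).2) := by
      simpa using hWp.clm (ContinuousLinearMap.fst ℝ ℝ ℝ)
    have hp2 : IsPrimitiveOn 0 ℓ (fun x => (W x).2) (fun x => β⁻¹ * ((W x).1 - g x)) :=
      ((hWp.clm (ContinuousLinearMap.snd ℝ ℝ ℝ)).add hG).congr (fun x _ => by simp)
        (Filter.Eventually.of_forall fun x => by simp; ring)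
    have hL : MemLp (fun x => β⁻¹ * ((W x).1 - g x)) 2 (volume.restrict (Ioo 0 ℓ)) :=
      ((memLp_Ioo_of_continuousOn hW1).sub (Lp.memLp g)).const_mul _
    let D : ℕ → ℝ → ℝ := fun j => match j with
      | 0 => fun x => (W x).1
      | 1 => fun x => (W x).2
      | _ => fun x => β⁻¹ * ((W x).1 - g x)
    have hD : IsSobolevJet 2 0 ℓ D := by
      refine IsSobolevJet.of_isPrimitiveOn hℓ (fun j hj => ?_) hL
      interval_cases j
      · exact hp1
      · exact hp2
    have e0 := hWe 0 (left_mem_Icc.2 hℓ.le)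
    simp only [intervalIntegral.integral_same, add_zero] at e0
    refine ⟨ofJet D hD, ?_, ?_, ?_⟩
    · apply Lp.ext
      filter_upwards [helmholtz_ae_eq β (ofJet D hD), dxx_ofJet hD,
        ae_restrict_mem measurableSet_Ioo] with x h1 h2 hx
      rw [h1, h2, val_ofJet hℓ hD (Ioo_subset_Icc_self hx)]
      simp only [D]
      field_simp
      ring
    · rw [val_ofJet hℓ hD (left_mem_Icc.2 hℓ.le)]
      simp [D, e0]
    · rw [dx_ofJet hℓ hD (left_mem_Icc.2 hℓ.le)]
      simp [D, e0]
  have h0m : (0 : ℝ) ∈ Icc 0 ℓ := left_mem_Icc.2 hℓ.le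
  have h1m : ℓ ∈ Icc 0 ℓ := right_mem_Icc.2 hℓ.le
  obtain ⟨w, hw, hw0, -⟩ := solve g 0
  obtain ⟨η, hη, hη0, hη1⟩ := solve 0 1
  have hne : val η ℓ ≠ 0 := by
    intro h
    have hz := helmholtz_injective hℓ hβ (w := ⟨η, (mem_H2Zero_iff hℓ η).2 ⟨hη0, h⟩⟩) hη
    have hη' : η = 0 := congrArg Subtype.val hz
    have hd : EqOn (dx (0 : H2 ℓ)) (fun _ => 0) (Icc 0 ℓ) :=
      eqOn_jet hℓ 0 (isSobolevJet_zero 2 0 ℓ) (Lp.coeFn_zero ..) 1 (by norm_num)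
    rw [hη', hd h0m] at hη1
    exact zero_ne_one hη1
  refine ⟨⟨w - (val w ℓ / val η ℓ) • η, (mem_H2Zero_iff hℓ _).2 ⟨?_, ?_⟩⟩, ?_⟩
  · rw [← valL_apply hℓ h0m, map_sub, map_smul, valL_apply hℓ h0m, valL_apply hℓ h0m, hw0, hη0]
    simp
  · rw [← valL_apply hℓ h1m, map_sub, map_smul, valL_apply hℓ h1m, valL_apply hℓ h1m, smul_eq_mul,
      div_mul_cancel₀ _ hne, sub_self]
  · simp [hw, hη]

/-- The open mapping theorem: a bounded bijection of Banach spaces has a bounded inverse. -/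
theorem exists_continuous_inverse {E F : Type*} [NormedAddCommGroup E] [NormedSpace ℝ E]
    [CompleteSpace E] [NormedAddCommGroup F] [NormedSpace ℝ F] [CompleteSpace F] (R : E →L[ℝ] F)
    (hinj : ∀ w, R w = 0 → w = 0) (hsurj : ∀ g, ∃ w, R w = g) :
    ∃ S : F →L[ℝ] E, (∀ g, R (S g) = g) ∧ ∀ w, S (R w) = w := by
  let e := ContinuousLinearEquiv.ofBijective R (LinearMap.ker_eq_bot'.2 hinj)
    (LinearMap.range_eq_top.2 hsurj)
  exact ⟨e.symm, fun g => e.apply_symm_apply g, fun w => e.symm_apply_apply w⟩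

theorem exists_resolvent (hℓ : 0 < ℓ) {β : ℝ} (hβ : 0 < β) : ∃ S : L2 ℓ →L[ℝ] H2Zero ℓ,
    (∀ g, helmholtz ℓ β (S g : H2 ℓ) = g) ∧
      ∀ w : H2Zero ℓ, S (helmholtz ℓ β (w : H2 ℓ)) = w := by
  have h1 := fun w : H2Zero ℓ => helmholtz_injective hℓ hβ (w := w)
  have h2 := helmholtz_surjective hℓ hβ
  have h3 := @exists_continuous_inverse (H2Zero ℓ) (L2 ℓ) (Submodule.normedAddCommGroup _)
    (Submodule.normedSpace _) inferInstance inferInstance inferInstance inferInstance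
    ((helmholtz ℓ β).comp (H2Zero ℓ).subtypeL) h1
  exact h3 h2

end Space

end AcousticInverse

namespace AcousticInverse

/-! ### The integral system in an abstract Banach space -/

section System

variable {V : Type*} [NormedAddCommGroup V] [NormedSpace ℝ V] [CompleteSpace V] {T : ℝ}

/-- The coefficients and the data of the integral system. -/
structure SystemData (V : Type*) [NormedAddCommGroup V] [NormedSpace ℝ V] where
  (α p q γ : ℝ)
  B : V →L[ℝ] V
  (b e v₀ v₁ : V)
  (Lφ Lψ : V →L[ℝ] ℝ)
  (F₁ F₃ : ℝ → ℝ)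

/-- The integral system for `v`, its derivative `r`, the kernel `k` and `h = y''`. -/
structure SystemData.IsSolution (D : SystemData V) (T : ℝ) (v r : ℝ → V) (k h : ℝ → ℝ) :
    Prop where
  k_cont : ContinuousOn k (Icc 0 T)
  h_cont : ContinuousOn h (Icc 0 T)
  r_cont : ContinuousOn r (Icc 0 T)
  v_prim : IsPrimitiveOn 0 T v r
  v_init : v 0 = D.v₀
  r_eq : ∀ t ∈ Icc 0 T, r t = D.v₁ + (D.p * (h t - h 0)) • D.e +
    ∫ s in (0 : ℝ)..t, (D.B (v s) - k s • D.b - conv k (fun s => D.B (v s)) s +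
      (D.q * h s) • D.e)
  k_eq : ∀ t ∈ Icc 0 T, k t = D.α * (D.F₃ t + D.Lφ (v t) - conv k (fun s => D.Lφ (v s)) t)
  h_eq : ∀ t ∈ Icc 0 T, h t = D.F₁ t + D.Lψ (v t) - D.γ * k t -
    conv k (fun s => D.F₁ s + D.Lψ (v s)) t

/-! ### Reduction of the integral system to the quadratic Volterra equation -/

namespace SystemData

variable (D : SystemData V)

/-- The components are `v`, `v' - p h e`, `k * B v`, `k`, `h` and `F₁`. -/
abbrev State (V : Type*) : Type _ := V × V × V × ℝ × ℝ × ℝ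

open ContinuousLinearMap in
/-- The linear map `v' = (v' - p h e) + p h e` on states. -/
noncomputable def stateDeriv : State V →L[ℝ] V :=
  (fst ℝ V _).comp (snd ℝ V _) +
    ((fst ℝ ℝ ℝ).comp ((snd ℝ ℝ _).comp ((snd ℝ V _).comp ((snd ℝ V _).comp
      (snd ℝ V _))))).smulRight (D.p • D.e)

open ContinuousLinearMap in
/-- The linear part of the Volterra equation. -/
noncomputable def linearPart : State V →L[ℝ] State V :=
  D.stateDeriv.prod <|
    (D.B.comp (fst ℝ V _) -
      ((fst ℝ ℝ _).comp ((snd ℝ V _).comp ((snd ℝ V _).comp (snd ℝ V _)))).smulRight D.b -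
      (fst ℝ V _).comp ((snd ℝ V _).comp (snd ℝ V _)) +
      ((fst ℝ ℝ ℝ).comp ((snd ℝ ℝ _).comp ((snd ℝ V _).comp ((snd ℝ V _).comp
        (snd ℝ V _))))).smulRight (D.q • D.e)).prod <|
    (0 : State V →L[ℝ] V).prod <|
    (D.α • D.Lφ.comp D.stateDeriv).prod <|
    (D.Lψ.comp D.stateDeriv - (D.γ * D.α) • D.Lφ.comp D.stateDeriv).prod 0

open ContinuousLinearMap in
/-- The factor of the kernel in the quadratic part of the Volterra equation. -/
noncomputable def quadraticPart : State V →L[ℝ] State V :=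
  (0 : State V →L[ℝ] V).prod <|
    (0 : State V →L[ℝ] V).prod <|
    (D.B.comp (fst ℝ V _)).prod <|
    ((-D.α) • D.Lφ.comp (fst ℝ V (V × V × ℝ × ℝ × ℝ))).prod <|
    ((D.γ * D.α) • D.Lφ.comp (fst ℝ V (V × V × ℝ × ℝ × ℝ)) -
      (snd ℝ ℝ ℝ).comp ((snd ℝ ℝ _).comp ((snd ℝ V _).comp ((snd ℝ V _).comp (snd ℝ V _)))) -
      D.Lψ.comp (fst ℝ V _)).prod 0

open ContinuousLinearMap in
/-- The kernel component of a state. -/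
noncomputable def kernelPart (V : Type*) [NormedAddCommGroup V] [NormedSpace ℝ V] :
    State V →L[ℝ] ℝ :=
  (fst ℝ ℝ _).comp ((snd ℝ V _).comp ((snd ℝ V _).comp (snd ℝ V _)))

/-- The value `h(0)` that the integral system forces. -/
noncomputable def hInit : ℝ :=
  D.F₁ 0 + D.Lψ D.v₀ - D.γ * (D.α * (D.F₃ 0 + D.Lφ D.v₀))

/-- The inhomogeneous part of the Volterra equation. -/
noncomputable def inhomogeneity (t : ℝ) : State V :=
  (D.v₀, D.v₁ - (D.p * D.hInit) • D.e, 0, D.α * (D.F₃ t + D.Lφ D.v₀),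
    D.F₁ t + D.Lψ D.v₀ - D.γ * (D.α * (D.F₃ t + D.Lφ D.v₀)), D.F₁ t)

/-- Lets the vector equation be read one component at a time, with the quadratic part as a genuine
convolution with the kernel component. -/
theorem map_volterra_rhs {Y : Type*} [NormedAddCommGroup Y] [NormedSpace ℝ Y] [CompleteSpace Y]
    (π : State V →L[ℝ] Y) {W : ℝ → State V} (hW : ContinuousOn W (Icc 0 T)) {t : ℝ}
    (ht : t ∈ Icc 0 T) :
    π (D.inhomogeneity t + ∫ s in (0 : ℝ)..t,
        (D.linearPart (W s) + kernelPart V (W (t - s)) • D.quadraticPart (W s))) =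
      π (D.inhomogeneity t) + (∫ s in (0 : ℝ)..t, π (D.linearPart (W s))) +
        conv (fun s => (W s).2.2.2.1) (fun s => π (D.quadraticPart (W s))) t := by
  have hl : ContinuousOn (fun s => D.linearPart (W s)) (Icc 0 T) :=
    D.linearPart.continuous.comp_continuousOn hW
  have hq : ContinuousOn (fun s => D.quadraticPart (W s)) (Icc 0 T) :=
    D.quadraticPart.continuous.comp_continuousOn hW
  have hk : ContinuousOn (fun s => (W s).2.2.2.1) (Icc 0 T) :=
    (kernelPart V).continuous.comp_continuousOn hW
  have i1 : IntervalIntegrable (fun s => D.linearPart (W s)) volume 0 t :=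
    (hl.mono (by rw [uIcc_of_le ht.1]; exact Icc_subset_Icc_right ht.2)).intervalIntegrable
  have i2 := intervalIntegrable_conv hk hq ht
  have e : ∫ s in (0 : ℝ)..t,
      (D.linearPart (W s) + kernelPart V (W (t - s)) • D.quadraticPart (W s)) =
      (∫ s in (0 : ℝ)..t, D.linearPart (W s)) +
        conv (fun s => (W s).2.2.2.1) (fun s => D.quadraticPart (W s)) t :=
    intervalIntegral.integral_add i1 i2
  rw [e, map_add, map_add, map_conv hk hq π ht, ← π.intervalIntegral_comp_comm i1, add_assoc]

theorem continuousOn_inhomogeneity (h1 : ContinuousOn D.F₁ (Icc 0 T))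
    (h3 : ContinuousOn D.F₃ (Icc 0 T)) : ContinuousOn D.inhomogeneity (Icc 0 T) := by
  unfold inhomogeneity
  fun_prop

variable {D}

/-- The state of a solution. -/
noncomputable def IsSolution.state (D : SystemData V) (v r : ℝ → V) (k h : ℝ → ℝ) (t : ℝ) :
    State V :=
  (v t, r t - (D.p * h t) • D.e, conv k (fun s => D.B (v s)) t, k t, h t, D.F₁ t)

/-- At `t = 0` the convolutions vanish, so `h(0)` is explicit in the data. This is why the equation
for `v'`, in which `h(0)` occurs, has a known inhomogeneity. -/
theorem IsSolution.h_zero {v r : ℝ → V} {k h : ℝ → ℝ} (H : D.IsSolution T v r k h) (hT : 0 ≤ T) :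
    h 0 = D.hInit := by
  have h0 : (0 : ℝ) ∈ Icc 0 T := left_mem_Icc.2 hT
  rw [H.h_eq 0 h0, H.k_eq 0 h0, H.v_init, conv_zero, conv_zero, hInit, sub_zero, sub_zero]

theorem IsSolution.continuousOn_state {v r : ℝ → V} {k h : ℝ → ℝ} (H : D.IsSolution T v r k h)
    (h1 : ContinuousOn D.F₁ (Icc 0 T)) :
    ContinuousOn (IsSolution.state D v r k h) (Icc 0 T) := by
  have hv := H.v_prim.continuousOn
  have hr := H.r_cont
  have hk := H.k_cont
  have hh := H.h_cont
  have hc : ContinuousOn (conv k fun s => D.B (v s)) (Icc 0 T) :=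
    continuousOn_conv hk (D.B.continuous.comp_continuousOn hv)
  unfold IsSolution.state
  fun_prop

/-- Each auxiliary component removes one obstacle. `v' - p h e` absorbs the term of `v'` outside the
integral. `k * B v` makes the twice integrated convolution linear in the state. `F₁` as a component
makes `k * F₁` quadratic. In the equations for `k` and `h`, `L v` is written as `L v₀ + ∫ L v'`, and
`k` is eliminated from the second by the first. -/
theorem IsSolution.volterra {v r : ℝ → V} {k h : ℝ → ℝ} (H : D.IsSolution T v r k h)
    (h1 : ContinuousOn D.F₁ (Icc 0 T)) :
    ∀ t ∈ Icc 0 T, IsSolution.state D v r k h t = D.inhomogeneity t + ∫ s in (0 : ℝ)..t,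
      (D.linearPart (IsSolution.state D v r k h s) +
        kernelPart V (IsSolution.state D v r k h (t - s)) •
          D.quadraticPart (IsSolution.state D v r k h s)) := by
  intro t ht
  have hT : 0 ≤ T := ht.1.trans ht.2
  have h0 : (0 : ℝ) ∈ Icc 0 T := left_mem_Icc.2 hT
  have hv := H.v_prim.continuousOn
  have hW := H.continuousOn_state h1
  have hd : ∀ s, D.stateDeriv (IsSolution.state D v r k h s) = r s := by
    intro s
    simp [stateDeriv, IsSolution.state, smul_smul, mul_comm]
  have hfun : ∀ L : V →L[ℝ] ℝ, L (v t) - L D.v₀ = ∫ s in (0 : ℝ)..t, L (r s) := fun L => by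
    rw [← H.v_init]
    exact (H.v_prim.clm L).sub_eq h0 ht
  have hφc : ContinuousOn (fun s => D.Lφ (v s)) (Icc 0 T) := D.Lφ.continuous.comp_continuousOn hv
  have hψc : ContinuousOn (fun s => D.Lψ (v s)) (Icc 0 T) := D.Lψ.continuous.comp_continuousOn hv
  have hri : ∀ L : V →L[ℝ] ℝ, IntervalIntegrable (fun s => L (r s)) volume 0 t := fun L =>
    intervalIntegrable_of_integrableOn_Ioo (H.v_prim.clm L).integrable h0 ht
  set R := D.inhomogeneity t + ∫ s in (0 : ℝ)..t,
      (D.linearPart (IsSolution.state D v r k h s) +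
        kernelPart V (IsSolution.state D v r k h (t - s)) •
          D.quadraticPart (IsSolution.state D v r k h s)) with hR
  have c1 : v t = R.1 := by
    have := D.map_volterra_rhs (ContinuousLinearMap.fst ℝ V _) hW ht
    rw [← hR] at this
    simp [linearPart, quadraticPart, inhomogeneity, hd, conv] at this
    rw [this, H.v_prim.eq t ht, H.v_init]
  have c2 : r t - (D.p * h t) • D.e = R.2.1 := by
    have := D.map_volterra_rhs ((ContinuousLinearMap.fst ℝ V _).comp
      (ContinuousLinearMap.snd ℝ V _)) hW ht
    rw [← hR] at this
    simp [linearPart, quadraticPart, inhomogeneity, conv] at this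
    rw [this, H.r_eq t ht, H.h_zero hT]
    simp only [IsSolution.state, conv, mul_sub, sub_smul, smul_smul, mul_comm D.q]
    abel
  have c3 : conv k (fun s => D.B (v s)) t = R.2.2.1 := by
    have := D.map_volterra_rhs ((ContinuousLinearMap.fst ℝ V _).comp
      ((ContinuousLinearMap.snd ℝ V _).comp (ContinuousLinearMap.snd ℝ V _))) hW ht
    rw [← hR] at this
    simp [linearPart, quadraticPart, inhomogeneity] at this
    rw [this]
    rfl
  have c4 : k t = R.2.2.2.1 := by
    have := D.map_volterra_rhs (kernelPart V) hW ht
    rw [← hR] at this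
    simp [linearPart, quadraticPart, inhomogeneity, kernelPart, hd] at this
    rw [this, H.k_eq t ht, ← hfun D.Lφ]
    have e : conv (fun s => (IsSolution.state D v r k h s).2.2.2.1)
        (fun s => -(D.α * D.Lφ (IsSolution.state D v r k h s).1)) t =
        -(D.α * conv k (fun s => D.Lφ (v s)) t) := by
      simp only [← neg_mul]
      rw [conv_const_mul]
      rfl
    rw [e]
    ring
  have c5 : h t = R.2.2.2.2.1 := by
    have := D.map_volterra_rhs ((ContinuousLinearMap.fst ℝ ℝ ℝ).comp
      ((ContinuousLinearMap.snd ℝ ℝ _).comp ((ContinuousLinearMap.snd ℝ V _).comp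
      ((ContinuousLinearMap.snd ℝ V _).comp (ContinuousLinearMap.snd ℝ V _))))) hW ht
    rw [← hR] at this
    simp [linearPart, quadraticPart, inhomogeneity, hd] at this
    have e : conv (fun s => (IsSolution.state D v r k h s).2.2.2.1)
        (fun s => D.γ * D.α * D.Lφ (IsSolution.state D v r k h s).1 -
          (IsSolution.state D v r k h s).2.2.2.2.2 - D.Lψ (IsSolution.state D v r k h s).1) t =
        D.γ * D.α * conv k (fun s => D.Lφ (v s)) t -
          conv k (fun s => D.F₁ s + D.Lψ (v s)) t := by
      rw [← conv_const_mul, ← conv_sub (g := fun s => D.γ * D.α * D.Lφ (v s))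
        (h := fun s => D.F₁ s + D.Lψ (v s)) H.k_cont (continuousOn_const.mul hφc) (h1.add hψc) ht]
      simp [IsSolution.state, sub_sub]
    rw [e, intervalIntegral.integral_sub (hri _) ((hri _).const_mul _),
      intervalIntegral.integral_const_mul, ← hfun D.Lφ, ← hfun D.Lψ] at this
    rw [this, H.h_eq t ht, H.k_eq t ht]
    ring
  have c6 : D.F₁ t = R.2.2.2.2.2 := by
    have := D.map_volterra_rhs ((ContinuousLinearMap.snd ℝ ℝ ℝ).comp
      ((ContinuousLinearMap.snd ℝ ℝ _).comp ((ContinuousLinearMap.snd ℝ V _).comp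
      ((ContinuousLinearMap.snd ℝ V _).comp (ContinuousLinearMap.snd ℝ V _))))) hW ht
    rw [← hR] at this
    simp [linearPart, quadraticPart, inhomogeneity, conv] at this
    rw [this]
  exact Prod.ext c1 (Prod.ext c2 (Prod.ext c3 (Prod.ext c4 (Prod.ext c5 c6))))

theorem IsSolution.unique {v r v' r' : ℝ → V} {k h k' h' : ℝ → ℝ}
    (H : D.IsSolution T v r k h) (H' : D.IsSolution T v' r' k' h')
    (h1 : ContinuousOn D.F₁ (Icc 0 T)) :
    EqOn v v' (Icc 0 T) ∧ EqOn k k' (Icc 0 T) ∧ EqOn h h' (Icc 0 T) := by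
  have key := volterra_unique D.linearPart D.quadraticPart (kernelPart V)
    (H.continuousOn_state h1) (H'.continuousOn_state h1) (H.volterra h1) (H'.volterra h1)
  exact ⟨fun t ht => congrArg (fun W => W.1) (key ht),
    fun t ht => congrArg (fun W => W.2.2.2.1) (key ht),
    fun t ht => congrArg (fun W => W.2.2.2.2.1) (key ht)⟩

variable (D) in
-- The components of the Volterra solution are read back. The third and the sixth are first
-- recognised as `k * B v` and `F₁`; then `L v₀ + ∫ L v'` is recombined into `L v`.
theorem exists_isSolution (hT : 0 ≤ T) (h1 : ContinuousOn D.F₁ (Icc 0 T))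
    (h3 : ContinuousOn D.F₃ (Icc 0 T)) :
    ∃ (v r : ℝ → V) (k h : ℝ → ℝ), D.IsSolution T v r k h := by
  obtain ⟨W, hW, hWe⟩ := volterra_exists hT D.linearPart D.quadraticPart (kernelPart V)
    (D.continuousOn_inhomogeneity h1 h3)
  have h0 : (0 : ℝ) ∈ Icc 0 T := left_mem_Icc.2 hT
  have hv : ContinuousOn (fun t => (W t).1) (Icc 0 T) := by fun_prop
  have hk : ContinuousOn (fun t => (W t).2.2.2.1) (Icc 0 T) := by fun_prop
  have hh : ContinuousOn (fun t => (W t).2.2.2.2.1) (Icc 0 T) := by fun_prop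
  have hr : ContinuousOn (fun t => D.stateDeriv (W t)) (Icc 0 T) :=
    D.stateDeriv.continuous.comp_continuousOn hW
  have c1 : ∀ t ∈ Icc 0 T, (W t).1 = D.v₀ + ∫ s in (0 : ℝ)..t, D.stateDeriv (W s) := by
    intro t ht
    have := (congrArg (ContinuousLinearMap.fst ℝ V _) (hWe t ht)).trans
      (D.map_volterra_rhs (ContinuousLinearMap.fst ℝ V _) hW ht)
    simpa [linearPart, quadraticPart, inhomogeneity, conv] using this
  have c3 : EqOn (fun t => (W t).2.2.1) (conv (fun t => (W t).2.2.2.1) fun s => D.B (W s).1)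
      (Icc 0 T) := by
    intro t ht
    let π : State V →L[ℝ] V := (ContinuousLinearMap.fst ℝ V _).comp
      ((ContinuousLinearMap.snd ℝ V _).comp (ContinuousLinearMap.snd ℝ V _))
    have := (congrArg π (hWe t ht)).trans (D.map_volterra_rhs π hW ht)
    simpa [π, linearPart, quadraticPart, inhomogeneity] using this
  have hprim : IsPrimitiveOn 0 T (fun t => (W t).1) (fun t => D.stateDeriv (W t)) :=
    ⟨integrableOn_Ioo_of_continuousOn hr, fun t ht => by
      have := c1 0 h0
      simp only [intervalIntegral.integral_same, add_zero] at this
      rw [this]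
      exact c1 t ht⟩
  have hv0 : (W 0).1 = D.v₀ := by simpa using c1 0 h0
  have hfun : ∀ (L : V →L[ℝ] ℝ), ∀ t ∈ Icc 0 T, 
      ∫ s in (0 : ℝ)..t, L (D.stateDeriv (W s)) = L (W t).1 - L D.v₀ := fun L t ht => by
    rw [← hv0]
    exact ((hprim.clm L).sub_eq h0 ht).symm
  have hφc : ContinuousOn (fun s => D.Lφ (W s).1) (Icc 0 T) :=
    D.Lφ.continuous.comp_continuousOn hv
  have hψc : ContinuousOn (fun s => D.Lψ (W s).1) (Icc 0 T) :=
    D.Lψ.continuous.comp_continuousOn hv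
  have c4 : ∀ t ∈ Icc 0 T, (W t).2.2.2.1 = D.α * (D.F₃ t + D.Lφ (W t).1 -
      conv (fun t => (W t).2.2.2.1) (fun s => D.Lφ (W s).1) t) := by
    intro t ht
    have := (congrArg (kernelPart V) (hWe t ht)).trans (D.map_volterra_rhs (kernelPart V) hW ht)
    simp only [linearPart, quadraticPart, inhomogeneity, kernelPart, ContinuousLinearMap.comp_apply,
      ContinuousLinearMap.coe_fst', ContinuousLinearMap.coe_snd', ContinuousLinearMap.prod_apply,
      _root_.smul_apply, smul_eq_mul,
      intervalIntegral.integral_const_mul, hfun _ t ht, conv_const_mul] at this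
    rw [this]
    ring
  have c6 : ∀ t ∈ Icc 0 T, (W t).2.2.2.2.2 = D.F₁ t := by
    intro t ht
    let π : State V →L[ℝ] ℝ := (ContinuousLinearMap.snd ℝ ℝ ℝ).comp
      ((ContinuousLinearMap.snd ℝ ℝ _).comp ((ContinuousLinearMap.snd ℝ V _).comp
      ((ContinuousLinearMap.snd ℝ V _).comp (ContinuousLinearMap.snd ℝ V _))))
    have := (congrArg π (hWe t ht)).trans (D.map_volterra_rhs π hW ht)
    simpa [π, linearPart, quadraticPart, inhomogeneity, conv] using this
  have hri : ∀ L : V →L[ℝ] ℝ, ∀ t ∈ Icc 0 T,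
      IntervalIntegrable (fun s => L (D.stateDeriv (W s))) volume 0 t := fun L t ht =>
    intervalIntegrable_of_integrableOn_Ioo (hprim.clm L).integrable h0 ht
  have c5 : ∀ t ∈ Icc 0 T, (W t).2.2.2.2.1 = D.F₁ t + D.Lψ (W t).1 - D.γ * (W t).2.2.2.1 -
      conv (fun t => (W t).2.2.2.1) (fun s => D.F₁ s + D.Lψ (W s).1) t := by
    intro t ht
    let π : State V →L[ℝ] ℝ := (ContinuousLinearMap.fst ℝ ℝ ℝ).comp
      ((ContinuousLinearMap.snd ℝ ℝ _).comp ((ContinuousLinearMap.snd ℝ V _).comp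
      ((ContinuousLinearMap.snd ℝ V _).comp (ContinuousLinearMap.snd ℝ V _))))
    have := (congrArg π (hWe t ht)).trans (D.map_volterra_rhs π hW ht)
    have e : conv (fun s => (W s).2.2.2.1) (fun s => D.γ * D.α * D.Lφ (W s).1 -
        (W s).2.2.2.2.2 - D.Lψ (W s).1) t =
        D.γ * D.α * conv (fun s => (W s).2.2.2.1) (fun s => D.Lφ (W s).1) t -
          conv (fun s => (W s).2.2.2.1) (fun s => D.F₁ s + D.Lψ (W s).1) t := by
      rw [← conv_const_mul, ← conv_sub (g := fun s => D.γ * D.α * D.Lφ (W s).1)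
        (h := fun s => D.F₁ s + D.Lψ (W s).1) hk (continuousOn_const.mul hφc) (h1.add hψc) ht]
      refine conv_congr (eqOn_refl _ _) (fun s hs => ?_) ht
      simp only [c6 s hs]
      ring
    simp only [π, linearPart, quadraticPart, inhomogeneity, ContinuousLinearMap.comp_apply,
      ContinuousLinearMap.coe_fst', ContinuousLinearMap.coe_snd', ContinuousLinearMap.prod_apply,
      _root_.smul_apply, _root_.sub_apply, smul_eq_mul, e] at this
    rw [intervalIntegral.integral_sub (hri _ t ht) ((hri _ t ht).const_mul _),
      intervalIntegral.integral_const_mul, hfun D.Lφ t ht, hfun D.Lψ t ht] at this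
    rw [this, c4 t ht]
    ring
  have hh0 : (W 0).2.2.2.2.1 = D.hInit := by
    rw [c5 0 h0, c4 0 h0, hv0, conv_zero, conv_zero, hInit, sub_zero, sub_zero]
  refine ⟨fun t => (W t).1, fun t => D.stateDeriv (W t), fun t => (W t).2.2.2.1,
    fun t => (W t).2.2.2.2.1, hk, hh, hr, hprim, hv0, fun t ht => ?_, c4, c5⟩
  let π : State V →L[ℝ] V := (ContinuousLinearMap.fst ℝ V _).comp
    (ContinuousLinearMap.snd ℝ V _)
  have := (congrArg π (hWe t ht)).trans (D.map_volterra_rhs π hW ht)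
  simp [π, linearPart, quadraticPart, inhomogeneity] at this
  have e0 : conv (fun s => (W s).2.2.2.1) (fun _ => (0 : V)) t = 0 := by simp [conv]
  have ei : ∫ s in (0 : ℝ)..t, (D.B (W s).1 - (W s).2.2.2.1 • D.b - (W s).2.2.1 +
      (W s).2.2.2.2.1 • D.q • D.e) = ∫ s in (0 : ℝ)..t, (D.B (W s).1 - (W s).2.2.2.1 • D.b -
      conv (fun t => (W t).2.2.2.1) (fun s => D.B (W s).1) s + (D.q * (W s).2.2.2.2.1) • D.e) := by
    apply intervalIntegral.integral_congr
    rw [uIcc_of_le ht.1]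
    intro s hs
    simp only
    rw [← c3 ⟨hs.1, hs.2.trans ht.2⟩, smul_smul, mul_comm D.q]
  rw [e0, ei] at this
  rw [hh0, stateDeriv]
  simp only [_root_.add_apply, ContinuousLinearMap.comp_apply,
    ContinuousLinearMap.coe_fst', ContinuousLinearMap.coe_snd', ContinuousLinearMap.smulRight_apply]
  rw [this, mul_sub, sub_smul, smul_smul, mul_comm (W t).2.2.2.2.1]
  abel

end SystemData

end System

end AcousticInverse

namespace AcousticInverse

/-! ### Solutions of the evolution problem with Sobolev regularity -/

section Regularity

variable {E : Type*} [NormedAddCommGroup E] [NormedSpace ℝ E] [CompleteSpace E] {a b T : ℝ}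

/-- The device by which every condition is differentiated or integrated in time without loss: an
identity equals its initial value plus its derivative almost everywhere. -/
theorem IsPrimitiveOn.eqOn_iff (hab : a < b) {u u' w w' : ℝ → E} (h : IsPrimitiveOn a b u u')
    (h' : IsPrimitiveOn a b w w') :
    EqOn u w (Icc a b) ↔ u a = w a ∧ u' =ᵐ[volume.restrict (Ioo a b)] w' :=
  ⟨fun he => ⟨he (left_mem_Icc.2 hab.le), h.ae_eq hab h' he⟩, fun he => h.eqOn_of_ae_eq h' he.1 he.2⟩

theorem MemH.isPrimitiveOn_zero (hab : a < b) {m : ℕ} {u : ℝ → E} (h : MemH m a b u)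
    (hm : 0 < m) : IsPrimitiveOn a b u (wderiv m a b u 1) :=
  (h.isPrimitiveOn hab hm).congr h.wderiv_zero Filter.EventuallyEq.rfl

/-- The derivative of a convolution falls on the kernel if that is weakly differentiable. -/
theorem IsPrimitiveOn.conv_left {k κ g g' : ℝ → ℝ} (hk : IsPrimitiveOn 0 T k κ)
    (hg : IsPrimitiveOn 0 T g g') (hg' : ContinuousOn g' (Icc 0 T)) :
    IsPrimitiveOn 0 T (AcousticInverse.conv k g)
      (fun t => k 0 * g t + AcousticInverse.conv κ g t) := by
  refine (IsPrimitiveOn.conv hk.continuousOn hg hg').congr (eqOn_refl _ _) ?_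
  filter_upwards [ae_restrict_mem measurableSet_Ioo] with t ht
  exact (conv_deriv_comm hk hg (Ioo_subset_Icc_self ht)).symm

theorem exists_memH_one (hT : 0 < T) {u u' : ℝ → E} (h : IsPrimitiveOn 0 T u u')
    (h' : MemLp u' 2 (volume.restrict (Ioo 0 T))) :
    MemH 1 0 T u ∧ wderiv 1 0 T u 1 =ᵐ[volume.restrict (Ioo 0 T)] u' := by
  let D : ℕ → ℝ → E := fun j => match j with
    | 0 => u
    | _ => u'
  have hD : IsSobolevJet 1 0 T D := by
    refine IsSobolevJet.of_isPrimitiveOn hT (fun j hj => ?_) h'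
    interval_cases j
    exact h
  exact ⟨hD.memH (eqOn_refl _ _), hD.wderiv_ae_eq hT (eqOn_refl _ _) le_rfl one_ne_zero⟩

theorem exists_memH_two (hT : 0 < T) {u u' u'' : ℝ → E} (h : IsPrimitiveOn 0 T u u')
    (h' : IsPrimitiveOn 0 T u' u'') (h'' : MemLp u'' 2 (volume.restrict (Ioo 0 T))) :
    MemH 2 0 T u ∧ EqOn (wderiv 2 0 T u 1) u' (Icc 0 T) ∧
      wderiv 2 0 T u 2 =ᵐ[volume.restrict (Ioo 0 T)] u'' := by
  let D : ℕ → ℝ → E := fun j => match j with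
    | 0 => u
    | 1 => u'
    | _ => u''
  have hD : IsSobolevJet 2 0 T D := by
    refine IsSobolevJet.of_isPrimitiveOn hT (fun j hj => ?_) h''
    interval_cases j
    · exact h
    · exact h'
  exact ⟨hD.memH (eqOn_refl _ _), hD.wderiv_eqOn hT (eqOn_refl _ _) (by norm_num),
    hD.wderiv_ae_eq hT (eqOn_refl _ _) le_rfl two_ne_zero⟩

theorem exists_memH_three (hT : 0 < T) {u u' u'' u''' : ℝ → E} (h : IsPrimitiveOn 0 T u u')
    (h' : IsPrimitiveOn 0 T u' u'') (h'' : IsPrimitiveOn 0 T u'' u''')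
    (h''' : MemLp u''' 2 (volume.restrict (Ioo 0 T))) :
    MemH 3 0 T u ∧ EqOn (wderiv 3 0 T u 1) u' (Icc 0 T) ∧
      EqOn (wderiv 3 0 T u 2) u'' (Icc 0 T) ∧
      wderiv 3 0 T u 3 =ᵐ[volume.restrict (Ioo 0 T)] u''' := by
  let D : ℕ → ℝ → E := fun j => match j with
    | 0 => u
    | 1 => u'
    | 2 => u''
    | _ => u'''
  have hD : IsSobolevJet 3 0 T D := by
    refine IsSobolevJet.of_isPrimitiveOn hT (fun j hj => ?_) h'''
    interval_cases j
    · exact h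
    · exact h'
    · exact h''
  exact ⟨hD.memH (eqOn_refl _ _), hD.wderiv_eqOn hT (eqOn_refl _ _) (by norm_num),
    hD.wderiv_eqOn hT (eqOn_refl _ _) (by norm_num),
    hD.wderiv_ae_eq hT (eqOn_refl _ _) le_rfl three_ne_zero⟩

end Regularity

/-! ### Integrated and differentiated forms of the abstract problem -/

namespace SystemData

variable {V : Type*} [NormedAddCommGroup V] [NormedSpace ℝ V] [CompleteSpace V] {T : ℝ}

/-- The evolution equation for `v` with its initial conditions. -/
structure IsEvolution (D : SystemData V) (T : ℝ) (v : ℝ → V) (k y : ℝ → ℝ) : Prop where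
  v_mem : MemH 2 0 T v
  k_mem : MemH 1 0 T k
  y_mem : MemH 3 0 T y
  v_init : v 0 = D.v₀
  vt_init : wderiv 2 0 T v 1 0 = D.v₁
  wave : ∀ᵐ t ∂(volume.restrict (Ioo 0 T)), wderiv 2 0 T v 2 t = D.B (v t) - k t • D.b -
    conv k (fun s => D.B (v s)) t +
      (D.p * wderiv 3 0 T y 3 t + D.q * wderiv 3 0 T y 2 t) • D.e

/-- The integrated equation for the kernel. -/
def KernelEquation (D : SystemData V) (T : ℝ) (v : ℝ → V) (k : ℝ → ℝ) : Prop :=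
  ∀ t ∈ Icc 0 T, k t = D.α * (D.F₃ t + D.Lφ (v t) - conv k (fun s => D.Lφ (v s)) t)

/-- The integrated equation for the displacement. -/
def DisplacementEquation (D : SystemData V) (T : ℝ) (v : ℝ → V) (k y : ℝ → ℝ) : Prop :=
  ∀ t ∈ Icc 0 T, wderiv 3 0 T y 2 t = D.F₁ t + D.Lψ (v t) - D.γ * k t -
    conv k (fun s => D.F₁ s + D.Lψ (v s)) t

variable {D : SystemData V} {v : ℝ → V} {k y : ℝ → ℝ}

/-- The evolution equation is integrated once in time. The term `p y''' e` becomes `p (y'' - y''(0))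
e`, so only the continuous function `h = y''` is left in the system. -/
theorem IsEvolution.isSolution (hT : 0 < T) (H : D.IsEvolution T v k y)
    (hk : D.KernelEquation T v k) (hy : D.DisplacementEquation T v k y) :
    D.IsSolution T v (wderiv 2 0 T v 1) k (wderiv 3 0 T y 2) := by
  have hv := H.v_mem.continuousOn two_pos
  have hkc := H.k_mem.continuousOn one_pos
  have hhc := H.y_mem.continuousOn_wderiv (by norm_num : 2 < 3)
  have hBc : ContinuousOn (fun s => D.B (v s)) (Icc 0 T) := D.B.continuous.comp_continuousOn hv
  have hcc := continuousOn_conv hkc hBc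
  refine ⟨hkc, hhc, H.v_mem.continuousOn_wderiv (by norm_num),
    H.v_mem.isPrimitiveOn_zero hT two_pos, H.v_init, ?_, hk, hy⟩
  have hg : ContinuousOn (fun s => D.B (v s) - k s • D.b - conv k (fun s => D.B (v s)) s +
      (D.q * wderiv 3 0 T y 2 s) • D.e) (Icc 0 T) := by fun_prop
  have h1 := ((H.y_mem.isPrimitiveOn hT (by norm_num : 2 < 3)).smul_const (D.p • D.e)).add
    (IsPrimitiveOn.of_integral (integrableOn_Ioo_of_continuousOn hg)
      (D.v₁ - (D.p * wderiv 3 0 T y 2 0) • D.e))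
  have key := ((H.v_mem.isPrimitiveOn hT (by norm_num : 1 < 2)).eqOn_iff hT h1).2 ⟨?_, ?_⟩
  · intro t ht
    rw [key ht]
    module
  · rw [H.vt_init]
    simp [smul_smul, mul_comm]
  · filter_upwards [H.wave] with t ht
    rw [ht, smul_smul, add_smul, mul_comm D.p]
    abel

theorem IsEvolution.isPrimitiveOn_functional (hT : 0 < T) (hv : MemH 2 0 T v) (L : V →L[ℝ] ℝ) :
    IsPrimitiveOn 0 T (fun t => L (v t)) (fun t => L (wderiv 2 0 T v 1 t)) ∧
      ContinuousOn (fun t => L (wderiv 2 0 T v 1 t)) (Icc 0 T) :=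
  ⟨(hv.isPrimitiveOn_zero hT two_pos).clm L,
    L.continuous.comp_continuousOn (hv.continuousOn_wderiv (by norm_num))⟩

/-- Differentiation in time with the derivative of the convolution on `k`, which is legitimate for
`k ∈ H¹` and produces the term `k(0) Lφ v`. -/
theorem kernelEquation_iff (hT : 0 < T) (hv : MemH 2 0 T v) (hk : MemH 1 0 T k)
    {F₃' : ℝ → ℝ} (hF : IsPrimitiveOn 0 T D.F₃ F₃') :
    D.KernelEquation T v k ↔ k 0 = D.α * (D.F₃ 0 + D.Lφ (v 0)) ∧
      ∀ᵐ t ∂(volume.restrict (Ioo 0 T)), wderiv 1 0 T k 1 t = D.α * (F₃' t +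
        D.Lφ (wderiv 2 0 T v 1 t) - k 0 * D.Lφ (v t) -
          conv (wderiv 1 0 T k 1) (fun s => D.Lφ (v s)) t) := by
  obtain ⟨hg, hg'⟩ := IsEvolution.isPrimitiveOn_functional hT hv D.Lφ
  have hkp := hk.isPrimitiveOn_zero hT one_pos
  have key := hkp.eqOn_iff hT (((hF.add hg).sub (hkp.conv_left hg hg')).const_mul D.α)
  refine Iff.trans Iff.rfl (key.trans ?_)
  rw [conv_zero, sub_zero]
  simp only [← sub_sub]
  rfl

/-- The same differentiation for `y''`; the derivative of the convolution again falls on `k`. -/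
theorem displacementEquation_iff (hT : 0 < T) (hv : MemH 2 0 T v) (hk : MemH 1 0 T k)
    (hy : MemH 3 0 T y) {F₁' : ℝ → ℝ} (hF : IsPrimitiveOn 0 T D.F₁ F₁')
    (hF' : ContinuousOn F₁' (Icc 0 T)) :
    D.DisplacementEquation T v k y ↔
      wderiv 3 0 T y 2 0 = D.F₁ 0 + D.Lψ (v 0) - D.γ * k 0 ∧
      ∀ᵐ t ∂(volume.restrict (Ioo 0 T)), wderiv 3 0 T y 3 t = F₁' t +
        D.Lψ (wderiv 2 0 T v 1 t) - D.γ * wderiv 1 0 T k 1 t - k 0 * (D.F₁ t + D.Lψ (v t)) -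
          conv (wderiv 1 0 T k 1) (fun s => D.F₁ s + D.Lψ (v s)) t := by
  obtain ⟨hg, hg'⟩ := IsEvolution.isPrimitiveOn_functional hT hv D.Lψ
  have hkp := hk.isPrimitiveOn_zero hT one_pos
  have hG := hF.add hg
  have key := (hy.isPrimitiveOn hT (by norm_num : 2 < 3)).eqOn_iff hT
    ((hG.sub (hkp.const_mul D.γ)).sub (hkp.conv_left hG (hF'.add hg')))
  refine Iff.trans Iff.rfl (key.trans ?_)
  rw [conv_zero, sub_zero]
  simp only [← sub_sub]
  rfl

/-- A solution of the integral system has the regularity of the evolution problem, and `y` is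
determined by its initial values. -/
theorem IsSolution.exists_isEvolution (hT : 0 < T) {r : ℝ → V} {h : ℝ → ℝ}
    (H : D.IsSolution T v r k h) {F₁' F₃' : ℝ → ℝ} (hF₁ : IsPrimitiveOn 0 T D.F₁ F₁')
    (hF₁' : ContinuousOn F₁' (Icc 0 T)) (hF₃ : IsPrimitiveOn 0 T D.F₃ F₃')
    (hF₃' : MemLp F₃' 2 (volume.restrict (Ioo 0 T))) (y₀ y₁ : ℝ) :
    ∃ y : ℝ → ℝ, D.IsEvolution T v k y ∧ D.KernelEquation T v k ∧
      D.DisplacementEquation T v k y ∧ y 0 = y₀ ∧ wderiv 3 0 T y 1 0 = y₁ := by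
  have h0 : (0 : ℝ) ∈ Icc 0 T := left_mem_Icc.2 hT.le
  have hv := H.v_prim.continuousOn
  have hr := H.r_cont
  have hk := H.k_cont
  have hh := H.h_cont
  have hLφ := H.v_prim.clm D.Lφ
  have hLψ := H.v_prim.clm D.Lψ
  have hφr : ContinuousOn (fun s => D.Lφ (r s)) (Icc 0 T) := D.Lφ.continuous.comp_continuousOn hr
  have hψr : ContinuousOn (fun s => D.Lψ (r s)) (Icc 0 T) := D.Lψ.continuous.comp_continuousOn hr
  have hBc : ContinuousOn (fun s => D.B (v s)) (Icc 0 T) := D.B.continuous.comp_continuousOn hv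
  have hcφ := continuousOn_conv hk hφr
  have hG := hF₁.add hLψ
  have hG' : ContinuousOn (fun t => F₁' t + D.Lψ (r t)) (Icc 0 T) := hF₁'.add hψr
  have hcψ := continuousOn_conv hk hG'
  have hcB := continuousOn_conv hk hBc
  -- Here `k` is only known to be continuous, so the derivative of the convolution is put on the
  -- continuously differentiable `Lφ v`. This gives `k ∈ H¹`, then `h ∈ H¹` in the same way, and
  -- finally `v' ∈ H¹`.
  set κ : ℝ → ℝ := fun t => D.α * (F₃' t + D.Lφ (r t) -
    (k t • D.Lφ (v 0) + conv k (fun s => D.Lφ (r s)) t)) with hκ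
  have hkp : IsPrimitiveOn 0 T k κ := by
    refine (((hF₃.add hLφ).sub (IsPrimitiveOn.conv hk hLφ hφr)).const_mul D.α).congr ?_
      Filter.EventuallyEq.rfl
    intro t ht
    exact (H.k_eq t ht).symm
  have hκL : MemLp κ 2 (volume.restrict (Ioo 0 T)) :=
    ((hF₃'.add (memLp_Ioo_of_continuousOn hφr)).sub (memLp_Ioo_of_continuousOn
      ((hk.smul continuousOn_const).add hcφ))).const_mul D.α
  obtain ⟨hkm, -⟩ := exists_memH_one hT hkp hκL
  set η : ℝ → ℝ := fun t => F₁' t + D.Lψ (r t) - D.γ * κ t -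
    (k t • (D.F₁ 0 + D.Lψ (v 0)) + conv k (fun s => F₁' s + D.Lψ (r s)) t) with hη
  have hhp : IsPrimitiveOn 0 T h η := by
    refine ((hG.sub (hkp.const_mul D.γ)).sub (IsPrimitiveOn.conv hk hG hG')).congr ?_
      Filter.EventuallyEq.rfl
    intro t ht
    exact (H.h_eq t ht).symm
  have hηL : MemLp η 2 (volume.restrict (Ioo 0 T)) :=
    ((memLp_Ioo_of_continuousOn hG').sub (hκL.const_mul D.γ)).sub (memLp_Ioo_of_continuousOn
      ((hk.smul continuousOn_const).add hcψ))
  have hy₁ := IsPrimitiveOn.of_integral (integrableOn_Ioo_of_continuousOn hh) y₁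
  have hy₀ := IsPrimitiveOn.of_integral (integrableOn_Ioo_of_continuousOn hy₁.continuousOn) y₀
  obtain ⟨hym, hyD1, hyD2, hyD3⟩ := exists_memH_three hT hy₀ hy₁ hhp hηL
  set y : ℝ → ℝ := fun t => y₀ + ∫ s in (0 : ℝ)..t, (y₁ + ∫ s in (0 : ℝ)..s, h s) with hy
  have hg : ContinuousOn (fun s => D.B (v s) - k s • D.b - conv k (fun s => D.B (v s)) s +
      (D.q * h s) • D.e) (Icc 0 T) := by fun_prop
  have hrp : IsPrimitiveOn 0 T r (fun t => η t • (D.p • D.e) + (D.B (v t) - k t • D.b -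
      conv k (fun s => D.B (v s)) t + (D.q * h t) • D.e)) := by
    refine ((hhp.smul_const (D.p • D.e)).add (IsPrimitiveOn.of_integral
      (integrableOn_Ioo_of_continuousOn hg) (D.v₁ - (D.p * h 0) • D.e))).congr ?_
      Filter.EventuallyEq.rfl
    intro t ht
    rw [H.r_eq t ht]
    module
  have hrL : MemLp (fun t => η t • (D.p • D.e) + (D.B (v t) - k t • D.b -
      conv k (fun s => D.B (v s)) t + (D.q * h t) • D.e)) 2 (volume.restrict (Ioo 0 T)) :=
    (((ContinuousLinearMap.id ℝ ℝ).smulRight (D.p • D.e)).comp_memLp' hηL).add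
      (memLp_Ioo_of_continuousOn hg)
  obtain ⟨hvm, hvD1, hvD2⟩ := exists_memH_two hT H.v_prim hrp hrL
  refine ⟨y, ⟨hvm, hkm, hym, H.v_init, ?_, ?_⟩, H.k_eq, ?_, by simp [hy], ?_⟩
  · rw [hvD1 h0, H.r_eq 0 h0]
    simp
  · filter_upwards [hvD2, hyD3, ae_restrict_mem measurableSet_Ioo] with t h2 h3 ht
    rw [h2, h3, hyD2 (Ioo_subset_Icc_self ht), smul_smul, add_smul, mul_comm D.p]
    abel
  · intro t ht
    rw [hyD2 ht]
    exact H.h_eq t ht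
  · rw [hyD1 h0]
    simp

end SystemData

end AcousticInverse

namespace AcousticInverse

/-! ### Integrals over `I` with the sensor as a weight -/

section Linear

variable {ℓ : ℝ}

/-- The jet of `x ↦ x/ℓ`. -/
noncomputable def linearJet (ℓ : ℝ) (j : ℕ) (x : ℝ) : ℝ :=
  match j with
  | 0 => x / ℓ
  | 1 => 1 / ℓ
  | _ => 0

theorem isSobolevJet_linearJet (hℓ : 0 < ℓ) : IsSobolevJet 2 0 ℓ (linearJet ℓ) := by
  refine IsSobolevJet.of_isPrimitiveOn hℓ (fun j hj => ?_) MemLp.zero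
  interval_cases j
  · refine ⟨integrableOn_Ioo_of_continuousOn continuousOn_const, fun t _ => ?_⟩
    simp [linearJet, div_eq_mul_inv]
  · exact IsPrimitiveOn.const _

/-- The function `x ↦ x/ℓ` in `H²(I)`. -/
noncomputable def linear (hℓ : 0 < ℓ) : H2 ℓ := ofJet _ (isSobolevJet_linearJet hℓ)

theorem val_linear (hℓ : 0 < ℓ) {x : ℝ} (hx : x ∈ Icc 0 ℓ) : val (linear hℓ) x = x / ℓ :=
  val_ofJet hℓ (isSobolevJet_linearJet hℓ) hx

theorem dx_linear (hℓ : 0 < ℓ) {x : ℝ} (hx : x ∈ Icc 0 ℓ) : dx (linear hℓ) x = 1 / ℓ :=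
  dx_ofJet hℓ (isSobolevJet_linearJet hℓ) hx

theorem dxx_linear (hℓ : 0 < ℓ) : dxx (linear hℓ) = 0 := by
  apply Lp.ext
  exact (dxx_ofJet (isSobolevJet_linearJet hℓ)).trans (Lp.coeFn_zero ..).symm

end Linear

namespace Data.Assumptions

variable {d : Data} (hd : d.Assumptions)

include hd

theorem zero_mem_I : (0 : ℝ) ∈ Icc 0 d.ℓ := left_mem_Icc.2 hd.ℓ_pos.le

theorem ℓ_mem_I : d.ℓ ∈ Icc 0 d.ℓ := right_mem_Icc.2 hd.ℓ_pos.le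

theorem φ_prim {j : ℕ} (hj : j < 3) : IsPrimitiveOn 0 d.ℓ (d.φD j) (d.φD (j + 1)) :=
  hd.φ_mem.isPrimitiveOn hd.ℓ_pos hj

theorem u₀_prim {j : ℕ} (hj : j < 4) : IsPrimitiveOn 0 d.ℓ (d.u₀D j) (d.u₀D (j + 1)) :=
  hd.u₀_mem.isPrimitiveOn hd.ℓ_pos hj

theorem u₁_prim {j : ℕ} (hj : j < 4) : IsPrimitiveOn 0 d.ℓ (d.u₁D j) (d.u₁D (j + 1)) :=
  hd.u₁_mem.isPrimitiveOn hd.ℓ_pos hj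

theorem f_prim {j : ℕ} (hj : j < 4) : IsPrimitiveOn 0 d.T (d.fD j) (d.fD (j + 1)) :=
  hd.f_mem.isPrimitiveOn hd.T_pos hj

theorem φ_eq : EqOn (d.φD 0) d.φ (Icc 0 d.ℓ) := hd.φ_mem.wderiv_zero

theorem ψ_prim : IsPrimitiveOn 0 d.ℓ d.ψ d.weight := by
  have hc : ContinuousOn d.φ (Icc 0 d.ℓ) := hd.φ_mem.continuousOn (by norm_num)
  have h := (IsPrimitiveOn.of_integral (integrableOn_Ioo_of_continuousOn hc) 0).sub
    ((hd.φ_prim (by norm_num : 1 < 3)).const_mul d.β)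
  exact h.congr (fun t _ => by simp [ψ]) Filter.EventuallyEq.rfl

theorem ψ_zero : d.ψ 0 = 0 := by
  simp [ψ, (hd.φ_zero 1 (by norm_num)).1]

theorem weight_cont : ContinuousOn d.weight (Icc 0 d.ℓ) :=
  (hd.φ_mem.continuousOn (by norm_num)).sub
    (continuousOn_const.mul (hd.φ_prim (by norm_num : 2 < 3)).continuousOn)

theorem weight_memLp : MemLp d.weight 2 (volume.restrict (Ioo 0 d.ℓ)) :=
  memLp_Ioo_of_continuousOn hd.weight_cont

theorem ψ_memLp : MemLp d.ψ 2 (volume.restrict (Ioo 0 d.ℓ)) :=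
  memLp_Ioo_of_continuousOn hd.ψ_prim.continuousOn

theorem φ_memLp {j : ℕ} (hj : j ≤ 3) : MemLp (d.φD j) 2 (volume.restrict (Ioo 0 d.ℓ)) :=
  hd.φ_mem.memLp hj

theorem integral_weight : ∫ x in (0 : ℝ)..d.ℓ, d.weight x = d.ψ d.ℓ := by
  rw [← hd.ψ_prim.sub_eq hd.zero_mem_I hd.ℓ_mem_I, hd.ψ_zero, sub_zero]

theorem integral_φ : ∫ x in (0 : ℝ)..d.ℓ, d.φD 0 x = d.ψ d.ℓ := by
  rw [ψ, (hd.φ_zero 1 (by norm_num)).2, mul_zero, sub_zero]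
  apply intervalIntegral.integral_congr
  rw [uIcc_of_le hd.ℓ_pos.le]
  exact hd.φ_eq

/-- `ψ` is the primitive of the measurement weight that vanishes at `0`, so the measurement and the
value at `ℓ` together account for the integral against `ψ`. -/
theorem integral_ψ_mul {g g' : ℝ → ℝ} (hg : IsPrimitiveOn 0 d.ℓ g g') :
    ∫ x in (0 : ℝ)..d.ℓ, d.ψ x * g' x =
      d.ψ d.ℓ * g d.ℓ - ∫ x in (0 : ℝ)..d.ℓ, d.weight x * g x := by
  have := hd.ψ_prim.integral_mul_add hd.ℓ_pos.le hg
  rw [hd.ψ_zero, zero_mul, sub_zero] at this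
  linarith

/-- The condition on `f(0)` cancels the integral left over by parts. -/
theorem GHat₀_eq : d.GHat₀ = d.u₀D 1 d.ℓ := by
  have h := hd.ψ_ne
  rw [GHat₀, hd.integral_ψ_mul (hd.u₀_prim (by norm_num : 1 < 4)), hd.f_zero]
  field_simp
  ring

/-- The conditions on `f(0)` and `f'(0)` cancel the integrals left over by parts. -/
theorem yTwo₀_eq : d.yTwo₀ = d.u₁D 1 d.ℓ - d.k₀ * d.u₀D 1 d.ℓ := by
  have h := hd.ψ_ne
  have hp := (hd.u₁_prim (by norm_num : 1 < 4)).sub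
    ((hd.u₀_prim (by norm_num : 1 < 4)).const_mul d.k₀)
  have hw : ∫ x in (0 : ℝ)..d.ℓ, d.weight x * (d.u₁D 1 x - d.k₀ * d.u₀D 1 x) =
      d.fD 1 0 - d.k₀ * d.f 0 := by
    have i1 : IntervalIntegrable (fun x => d.weight x * d.u₁D 1 x) volume 0 d.ℓ :=
      intervalIntegrable_of_integrableOn_Ioo (integrableOn_Ioo_of_continuousOn
        (hd.weight_cont.mul (hd.u₁_prim (by norm_num : 1 < 4)).continuousOn))
        hd.zero_mem_I hd.ℓ_mem_I
    have i0 : IntervalIntegrable (fun x => d.weight x * d.u₀D 1 x) volume 0 d.ℓ :=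
      intervalIntegrable_of_integrableOn_Ioo (integrableOn_Ioo_of_continuousOn
        (hd.weight_cont.mul (hd.u₀_prim (by norm_num : 1 < 4)).continuousOn))
        hd.zero_mem_I hd.ℓ_mem_I
    rw [← hd.f_zero, ← hd.f_one, ← intervalIntegral.integral_const_mul,
      ← intervalIntegral.integral_sub i1 (i0.const_mul _)]
    congr 1
    funext x
    ring
  rw [yTwo₀, hd.integral_ψ_mul hp, hw]
  field_simp
  ring

/-! ### The functionals of the problem -/

omit hd in
/-- `w ↦ ∫ (φ - β φ'') w' dx`. -/
noncomputable def _root_.AcousticInverse.Data.weightL (d : Data) : H2 d.ℓ →L[ℝ] ℝ :=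
  (pair d.ℓ d.weight).comp (coord d.ℓ 1)

omit hd in
/-- `w ↦ ∫ φ''' w dx`. -/
noncomputable def _root_.AcousticInverse.Data.φL (d : Data) : H2 d.ℓ →L[ℝ] ℝ :=
  (pair d.ℓ (d.φD 3)).comp (coord d.ℓ 0)

omit hd in
/-- `w ↦ ∫ ψ w'' dx`. -/
noncomputable def _root_.AcousticInverse.Data.ψL (d : Data) : H2 d.ℓ →L[ℝ] ℝ :=
  (pair d.ℓ d.ψ).comp (coord d.ℓ 2)

theorem weightL_apply (w : H2 d.ℓ) :
    d.weightL w = ∫ x in (0 : ℝ)..d.ℓ, d.weight x * dx w x :=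
  pair_apply_of_ae_eq hd.ℓ_pos hd.weight_memLp (coord_one_ae_eq w)

theorem φL_apply (w : H2 d.ℓ) : d.φL w = ∫ x in (0 : ℝ)..d.ℓ, val w x * d.φD 3 x := by
  rw [φL, ContinuousLinearMap.comp_apply,
    pair_apply_of_ae_eq hd.ℓ_pos (hd.φ_memLp le_rfl) (coord_zero_ae_eq w)]
  simp only [mul_comm]

theorem ψL_apply (w : H2 d.ℓ) : d.ψL w = ∫ x in (0 : ℝ)..d.ℓ, d.ψ x * dxx w x :=
  pair_apply hd.ℓ_pos hd.ψ_memLp _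

theorem ψL_eq (w : H2 d.ℓ) : d.ψL w = d.ψ d.ℓ * dxL d.ℓ w - d.weightL w := by
  rw [hd.ψL_apply, hd.weightL_apply, dxL_apply hd.ℓ_pos,
    hd.integral_ψ_mul (isPrimitiveOn_dx hd.ℓ_pos w)]

/-- Integration by parts in both terms; `φ` and `φ'` vanish at the end points. Testing with `φ'`
therefore reproduces the measurement, up to sign. -/
theorem pair_φ_helmholtz (w : H2Zero d.ℓ) :
    pair d.ℓ (d.φD 1) (helmholtz d.ℓ d.β (w : H2 d.ℓ)) = - d.weightL (w : H2 d.ℓ) := by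
  have hℓ := hd.ℓ_pos
  have hv := isPrimitiveOn_val hℓ (w : H2 d.ℓ)
  have hx := isPrimitiveOn_dx hℓ (w : H2 d.ℓ)
  have p1 := (hd.φ_prim (by norm_num : 0 < 3)).integral_mul_add hℓ.le hv
  have p2 := (hd.φ_prim (by norm_num : 1 < 3)).integral_mul_add hℓ.le hx
  rw [(hd.φ_zero 0 (by norm_num)).1, (hd.φ_zero 0 (by norm_num)).2] at p1
  rw [(hd.φ_zero 1 (by norm_num)).1, (hd.φ_zero 1 (by norm_num)).2] at p2
  have ii : ∀ {g h : ℝ → ℝ}, ContinuousOn g (Icc 0 d.ℓ) → ContinuousOn h (Icc 0 d.ℓ) →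
      IntervalIntegrable (fun x => g x * h x) volume 0 d.ℓ := fun hg hh =>
    intervalIntegrable_of_integrableOn_Ioo (integrableOn_Ioo_of_continuousOn (hg.mul hh))
      hd.zero_mem_I hd.ℓ_mem_I
  have e1 : d.weightL (w : H2 d.ℓ) = (∫ x in (0 : ℝ)..d.ℓ, d.φD 0 x * dx (w : H2 d.ℓ) x) -
      d.β * ∫ x in (0 : ℝ)..d.ℓ, d.φD 2 x * dx (w : H2 d.ℓ) x := by
    have i0 := ii (hd.φ_prim (by norm_num : 0 < 3)).continuousOn hx.continuousOn
    have i2 := ii (hd.φ_prim (by norm_num : 2 < 3)).continuousOn hx.continuousOn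
    rw [hd.weightL_apply, ← intervalIntegral.integral_const_mul,
      ← intervalIntegral.integral_sub i0 (i2.const_mul _)]
    apply intervalIntegral.integral_congr
    rw [uIcc_of_le hℓ.le]
    intro x hxm
    simp only [weight]
    rw [hd.φ_eq hxm]
    ring
  have e2 : pair d.ℓ (d.φD 1) (helmholtz d.ℓ d.β (w : H2 d.ℓ)) =
      (∫ x in (0 : ℝ)..d.ℓ, d.φD 1 x * val (w : H2 d.ℓ) x) -
        d.β * ∫ x in (0 : ℝ)..d.ℓ, d.φD 1 x * dxx (w : H2 d.ℓ) x := by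
    change pair d.ℓ (d.φD 1) (coord d.ℓ 0 w - d.β • coord d.ℓ 2 w) = _
    rw [map_sub, map_smul, smul_eq_mul,
      pair_apply_of_ae_eq hℓ (hd.φ_memLp (by norm_num)) (coord_zero_ae_eq _),
      pair_apply hℓ (hd.φ_memLp (by norm_num)), coord_two]
  rw [e1, e2]
  linear_combination p1 - d.β * p2

/-- Two integrations by parts, with `φ'` and `φ''` vanishing at the end points. -/
theorem pair_φ_dxx (w : H2Zero d.ℓ) :
    pair d.ℓ (d.φD 1) (dxx (w : H2 d.ℓ)) = d.φL (w : H2 d.ℓ) := by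
  have hℓ := hd.ℓ_pos
  have p1 := (hd.φ_prim (by norm_num : 1 < 3)).integral_mul_add hℓ.le
    (isPrimitiveOn_dx hℓ (w : H2 d.ℓ))
  have p2 := (hd.φ_prim (by norm_num : 2 < 3)).integral_mul_add hℓ.le
    (isPrimitiveOn_val hℓ (w : H2 d.ℓ))
  rw [(hd.φ_zero 1 (by norm_num)).1, (hd.φ_zero 1 (by norm_num)).2] at p1
  rw [(hd.φ_zero 2 (by norm_num)).1, (hd.φ_zero 2 (by norm_num)).2] at p2
  rw [pair_apply hℓ (hd.φ_memLp (by norm_num)), hd.φL_apply]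
  simp only [mul_comm (val (w : H2 d.ℓ) _)]
  linarith

/-- `∫ φ = ψ(ℓ)` because `φ'(ℓ) = 0`. The constant agrees up to sign with `weightL_linear`, so `z''`
enters the tested equation exactly as in the measurement of `v_tt - z'' x/ℓ`. -/
theorem pair_φ_linear :
    pair d.ℓ (d.φD 1) (coord d.ℓ 0 (linear hd.ℓ_pos)) = -(d.ψ d.ℓ / d.ℓ) := by
  have hℓ := hd.ℓ_pos
  have p1 := (hd.φ_prim (by norm_num : 0 < 3)).integral_mul_add hℓ.le
    (isPrimitiveOn_val hℓ (linear hℓ))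
  rw [(hd.φ_zero 0 (by norm_num)).1, (hd.φ_zero 0 (by norm_num)).2] at p1
  rw [pair_apply_of_ae_eq hℓ (hd.φ_memLp (by norm_num)) (coord_zero_ae_eq _)]
  have e : ∫ x in (0 : ℝ)..d.ℓ, d.φD 0 x * dx (linear hℓ) x = d.ψ d.ℓ / d.ℓ := by
    rw [← hd.integral_φ, div_eq_mul_one_div, ← intervalIntegral.integral_mul_const]
    apply intervalIntegral.integral_congr
    rw [uIcc_of_le hℓ.le]
    intro x hx
    simp only
    rw [dx_linear hℓ hx]
  rw [e] at p1
  linarith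

theorem weightL_linear : d.weightL (linear hd.ℓ_pos) = d.ψ d.ℓ / d.ℓ := by
  have hℓ := hd.ℓ_pos
  rw [hd.weightL_apply, ← hd.integral_weight, div_eq_mul_one_div,
    ← intervalIntegral.integral_mul_const]
  apply intervalIntegral.integral_congr
  rw [uIcc_of_le hℓ.le]
  intro x hx
  simp only
  rw [dx_linear hℓ hx]

/-! ### The initial data as elements of `H²(I)` -/

/-- `u₀` as an element of `H²(I)`. -/
noncomputable def U₀ : H2 d.ℓ :=
  ofJet d.u₀D ((isSobolevJet_wderiv hd.u₀_mem).1.of_le (by norm_num))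

/-- `u₁` as an element of `H²(I)`. -/
noncomputable def U₁ : H2 d.ℓ :=
  ofJet d.u₁D ((isSobolevJet_wderiv hd.u₁_mem).1.of_le (by norm_num))

/-- `u₂` as an element of `H²(I)`. -/
noncomputable def U₂ : H2 d.ℓ := ofJet d.u₂D (isSobolevJet_wderiv hd.u₂_eq.1).1

theorem val_U₀ : EqOn (val hd.U₀) d.u₀ (Icc 0 d.ℓ) :=
  (val_ofJet hd.ℓ_pos _).trans hd.u₀_mem.wderiv_zero

theorem val_U₁ : EqOn (val hd.U₁) d.u₁ (Icc 0 d.ℓ) :=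
  (val_ofJet hd.ℓ_pos _).trans hd.u₁_mem.wderiv_zero

theorem val_U₂ : EqOn (val hd.U₂) d.u₂ (Icc 0 d.ℓ) :=
  (val_ofJet hd.ℓ_pos _).trans hd.u₂_eq.1.wderiv_zero

theorem dx_U₀ : EqOn (dx hd.U₀) (d.u₀D 1) (Icc 0 d.ℓ) := dx_ofJet hd.ℓ_pos _

theorem dx_U₁ : EqOn (dx hd.U₁) (d.u₁D 1) (Icc 0 d.ℓ) := dx_ofJet hd.ℓ_pos _

theorem dx_U₂ : EqOn (dx hd.U₂) (d.u₂D 1) (Icc 0 d.ℓ) := dx_ofJet hd.ℓ_pos _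

theorem dxx_U₀ : dxx hd.U₀ =ᵐ[volume.restrict (Ioo 0 d.ℓ)] d.u₀D 2 := dxx_ofJet _

theorem dxx_U₂ : dxx hd.U₂ =ᵐ[volume.restrict (Ioo 0 d.ℓ)] d.u₂D 2 := dxx_ofJet _

/-- The relation that the original wave equation imposes on `u_tt` at `t = 0`; it determines
`u_tt(0)` once the boundary values are known. -/
theorem helmholtz_U₂ : helmholtz d.ℓ d.β hd.U₂ = dxx hd.U₀ := by
  apply Lp.ext
  filter_upwards [helmholtz_ae_eq d.β hd.U₂, hd.dxx_U₀, hd.dxx_U₂, hd.u₂_eq.2,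
    ae_restrict_mem measurableSet_Ioo] with x h1 h2 h3 h4 hx
  rw [h1, h2, h3, hd.val_U₂ (Ioo_subset_Icc_self hx)]
  exact h4

theorem weightL_U₀ : d.weightL hd.U₀ = d.f 0 := by
  rw [hd.weightL_apply, ← hd.f_zero]
  apply intervalIntegral.integral_congr
  rw [uIcc_of_le hd.ℓ_pos.le]
  intro x hx
  simp only
  rw [hd.dx_U₀ hx]

theorem weightL_U₁ : d.weightL hd.U₁ = d.fD 1 0 := by
  rw [hd.weightL_apply, ← hd.f_one]
  apply intervalIntegral.integral_congr
  rw [uIcc_of_le hd.ℓ_pos.le]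
  intro x hx
  simp only
  rw [hd.dx_U₁ hx]

theorem weightL_U₂ : d.weightL hd.U₂ = d.fD 2 0 := by
  rw [hd.weightL_apply, ← hd.f_two]
  apply intervalIntegral.integral_congr
  rw [uIcc_of_le hd.ℓ_pos.le]
  intro x hx
  simp only
  rw [hd.dx_U₂ hx]

theorem pair_φ_dxx_U₀ : pair d.ℓ (d.φD 1) (dxx hd.U₀) = d.α⁻¹ := by
  rw [pair_apply_of_ae_eq hd.ℓ_pos (hd.φ_memLp (by norm_num)) hd.dxx_U₀, α, inv_inv]

theorem α_ne_zero : d.α ≠ 0 := inv_ne_zero hd.α_ne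

theorem val_sub_linear {w : H2 d.ℓ} {c x : ℝ} (hx : x ∈ Icc 0 d.ℓ) :
    val (w - c • linear hd.ℓ_pos) x = val w x - c * (x / d.ℓ) := by
  rw [← valL_apply hd.ℓ_pos hx, map_sub, map_smul, valL_apply hd.ℓ_pos hx,
    valL_apply hd.ℓ_pos hx, val_linear hd.ℓ_pos hx, smul_eq_mul]

/-- `v₀` as an element of `H¹₀(I) ∩ H²(I)`. -/
noncomputable def V₀ : H2Zero d.ℓ :=
  ⟨hd.U₁ - d.u₁ d.ℓ • linear hd.ℓ_pos, (mem_H2Zero_iff hd.ℓ_pos _).2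
    ⟨by rw [hd.val_sub_linear hd.zero_mem_I, hd.val_U₁ hd.zero_mem_I]; exact hd.v₀_mem.2.1,
      by rw [hd.val_sub_linear hd.ℓ_mem_I, hd.val_U₁ hd.ℓ_mem_I]; exact hd.v₀_mem.2.2⟩⟩

/-- `v₁` as an element of `H¹₀(I) ∩ H²(I)`. -/
noncomputable def V₁ : H2Zero d.ℓ :=
  ⟨hd.U₂ - d.u₂ d.ℓ • linear hd.ℓ_pos, (mem_H2Zero_iff hd.ℓ_pos _).2
    ⟨by rw [hd.val_sub_linear hd.zero_mem_I, hd.val_U₂ hd.zero_mem_I]; exact hd.v₁_mem.2.1,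
      by rw [hd.val_sub_linear hd.ℓ_mem_I, hd.val_U₂ hd.ℓ_mem_I]; exact hd.v₁_mem.2.2⟩⟩

theorem val_V₀ : EqOn (val (hd.V₀ : H2 d.ℓ)) d.v₀ (Icc 0 d.ℓ) := fun x hx => by
  change val (hd.U₁ - d.u₁ d.ℓ • linear hd.ℓ_pos) x = _
  rw [hd.val_sub_linear hx, hd.val_U₁ hx, v₀]

theorem val_V₁ : EqOn (val (hd.V₁ : H2 d.ℓ)) d.v₁ (Icc 0 d.ℓ) := fun x hx => by
  change val (hd.U₂ - d.u₂ d.ℓ • linear hd.ℓ_pos) x = _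
  rw [hd.val_sub_linear hx, hd.val_U₂ hx, v₁]

theorem eq_V₀_iff {w : H2Zero d.ℓ} :
    (∀ x ∈ Icc 0 d.ℓ, val (w : H2 d.ℓ) x = d.v₀ x) ↔ w = hd.V₀ :=
  ⟨fun h => ext_H2Zero hd.ℓ_pos fun x hx => (h x hx).trans (hd.val_V₀ hx).symm,
    fun h _ hx => h ▸ hd.val_V₀ hx⟩

theorem eq_V₁_iff {w : H2Zero d.ℓ} :
    (∀ x ∈ Icc 0 d.ℓ, val (w : H2 d.ℓ) x = d.v₁ x) ↔ w = hd.V₁ :=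
  ⟨fun h => ext_H2Zero hd.ℓ_pos fun x hx => (h x hx).trans (hd.val_V₁ hx).symm,
    fun h _ hx => h ▸ hd.val_V₁ hx⟩

theorem weightL_V₀ :
    d.weightL (hd.V₀ : H2 d.ℓ) = d.fD 1 0 - d.u₁ d.ℓ * (d.ψ d.ℓ / d.ℓ) := by
  change d.weightL (hd.U₁ - d.u₁ d.ℓ • linear hd.ℓ_pos) = _
  rw [map_sub, map_smul, hd.weightL_U₁, hd.weightL_linear, smul_eq_mul]

theorem weightL_V₁ :
    d.weightL (hd.V₁ : H2 d.ℓ) = d.fD 2 0 - d.u₂ d.ℓ * (d.ψ d.ℓ / d.ℓ) := by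
  change d.weightL (hd.U₂ - d.u₂ d.ℓ • linear hd.ℓ_pos) = _
  rw [map_sub, map_smul, hd.weightL_U₂, hd.weightL_linear, smul_eq_mul]

theorem k₀_eq : d.k₀ = d.α * (d.fD 3 0 + d.φL (hd.V₀ : H2 d.ℓ)) := by
  rw [k₀, hd.φL_apply]
  congr 2
  apply intervalIntegral.integral_congr
  rw [uIcc_of_le hd.ℓ_pos.le]
  intro x hx
  simp only
  rw [hd.val_V₀ hx]

end Data.Assumptions

end AcousticInverse

namespace AcousticInverse

namespace Data.Assumptions

variable {d : Data} (hd : d.Assumptions)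

include hd

/-! ### The problem as an evolution equation in `H¹₀(I) ∩ H²(I)` -/

/-- The inverse of `1 - β d²/dx²` with homogeneous Dirichlet conditions. -/
noncomputable def resolvent : L2 d.ℓ →L[ℝ] H2Zero d.ℓ :=
  (exists_resolvent hd.ℓ_pos hd.β_pos).choose

theorem eq_resolvent_iff {w : H2Zero d.ℓ} {g : L2 d.ℓ} :
    w = hd.resolvent g ↔ helmholtz d.ℓ d.β (w : H2 d.ℓ) = g := by
  obtain ⟨h1, h2⟩ := (exists_resolvent hd.ℓ_pos hd.β_pos).choose_spec
  exact ⟨fun h => h ▸ h1 g, fun h => h ▸ (h2 w).symm⟩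

/-- The integral system of the problem. -/
noncomputable def system : SystemData (H2Zero d.ℓ) where
  α := d.α
  p := d.p
  q := d.q
  γ := d.GHat₀
  B := hd.resolvent.comp ((coord d.ℓ 2).comp (H2Zero d.ℓ).subtypeL)
  b := hd.resolvent (dxx hd.U₀)
  e := hd.resolvent (coord d.ℓ 0 (linear hd.ℓ_pos))
  v₀ := hd.V₀
  v₁ := hd.V₁
  Lφ := d.φL.comp (H2Zero d.ℓ).subtypeL
  Lψ := ((d.ψ d.ℓ)⁻¹ • d.ψL).comp (H2Zero d.ℓ).subtypeL
  F₁ t := (d.ψ d.ℓ)⁻¹ * d.fD 1 t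
  F₃ := d.fD 3

/-- The pointwise equation becomes an identity in `L²(I)`, to which functionals and the resolvent
can be applied. -/
theorem waveEquation_iff (v : ℝ → H2Zero d.ℓ) (k y : ℝ → ℝ) :
    d.WaveEquation v k y ↔ ∀ᵐ t ∂(volume.restrict (Ioo 0 d.T)),
      helmholtz d.ℓ d.β (d.vD v 2 t : H2 d.ℓ) = dxx (v t : H2 d.ℓ) - k t • dxx hd.U₀ -
        conv k (fun s => dxx (v s : H2 d.ℓ)) t + d.zD y 2 t • coord d.ℓ 0 (linear hd.ℓ_pos) := by
  refine Filter.eventually_congr (Filter.Eventually.of_forall fun t => ?_)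
  rw [Lp.ext_iff]
  refine Filter.eventually_congr ?_
  set c := conv k (fun s => dxx (v s : H2 d.ℓ)) t with hc
  filter_upwards [helmholtz_ae_eq d.β (d.vD v 2 t : H2 d.ℓ), hd.dxx_U₀,
    coord_zero_ae_eq (linear hd.ℓ_pos), ae_restrict_mem measurableSet_Ioo,
    Lp.coeFn_add (dxx (v t : H2 d.ℓ) - k t • dxx hd.U₀ - c)
      (d.zD y 2 t • coord d.ℓ 0 (linear hd.ℓ_pos)),
    Lp.coeFn_sub (dxx (v t : H2 d.ℓ) - k t • dxx hd.U₀) c,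
    Lp.coeFn_sub (dxx (v t : H2 d.ℓ)) (k t • dxx hd.U₀), Lp.coeFn_smul (k t) (dxx hd.U₀),
    Lp.coeFn_smul (d.zD y 2 t) (coord d.ℓ 0 (linear hd.ℓ_pos))] with x h1 h2 h3 hx h4 h5 h6 h7 h8
  rw [h1, h4, Pi.add_apply, h5, Pi.sub_apply, h6, Pi.sub_apply, h7, Pi.smul_apply, h2, h8,
    Pi.smul_apply, h3, val_linear hd.ℓ_pos (Ioo_subset_Icc_self hx), smul_eq_mul, smul_eq_mul]
  change _ - _ - _ + _ + c x = _ ↔ _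
  constructor <;> intro h <;> linarith

theorem prim_apply {F : Type*} [NormedAddCommGroup F] [NormedSpace ℝ F] [CompleteSpace F]
    {v : ℝ → H2Zero d.ℓ} (hv : MemH 2 0 d.T v) (L : H2 d.ℓ →L[ℝ] F) {j : ℕ} (hj : j < 2) :
    IsPrimitiveOn 0 d.T (fun t => L (d.vD v j t : H2 d.ℓ))
      (fun t => L (d.vD v (j + 1) t : H2 d.ℓ)) :=
  (hv.isPrimitiveOn hd.T_pos hj).clm (L.comp (H2Zero d.ℓ).subtypeL)

theorem prim_apply_zero {F : Type*} [NormedAddCommGroup F] [NormedSpace ℝ F] [CompleteSpace F]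
    {v : ℝ → H2Zero d.ℓ} (hv : MemH 2 0 d.T v) (L : H2 d.ℓ →L[ℝ] F) :
    IsPrimitiveOn 0 d.T (fun t => L (v t : H2 d.ℓ)) (fun t => L (d.vD v 1 t : H2 d.ℓ)) :=
  (hv.isPrimitiveOn_zero hd.T_pos two_pos).clm (L.comp (H2Zero d.ℓ).subtypeL)

theorem y_prim {y : ℝ → ℝ} (hy : MemH 3 0 d.T y) {j : ℕ} (hj : j < 3) :
    IsPrimitiveOn 0 d.T (d.yD y j) (d.yD y (j + 1)) := hy.isPrimitiveOn hd.T_pos hj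

theorem z_prim {y : ℝ → ℝ} (hy : MemH 3 0 d.T y) {j : ℕ} (hj : j < 2) :
    IsPrimitiveOn 0 d.T (d.zD y j) (d.zD y (j + 1)) :=
  ((hd.y_prim hy (by omega)).const_mul d.p).add ((hd.y_prim hy (by omega)).const_mul d.q)

theorem F₁_prim : IsPrimitiveOn 0 d.T hd.system.F₁ (fun t => (d.ψ d.ℓ)⁻¹ * d.fD 2 t) :=
  (hd.f_prim (by norm_num : 1 < 4)).const_mul _

theorem F₁_deriv_continuousOn : ContinuousOn (fun t => (d.ψ d.ℓ)⁻¹ * d.fD 2 t) (Icc 0 d.T) :=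
  continuousOn_const.mul (hd.f_prim (by norm_num : 2 < 4)).continuousOn

/-- Apply the resolvent, which is bounded and so commutes with the convolution. -/
theorem wave_iff {v : ℝ → H2Zero d.ℓ} {k y : ℝ → ℝ} (hv : MemH 2 0 d.T v)
    (hk : MemH 1 0 d.T k) :
    d.WaveEquation v k y ↔ ∀ᵐ t ∂(volume.restrict (Ioo 0 d.T)),
      wderiv 2 0 d.T v 2 t = hd.system.B (v t) - k t • hd.system.b -
        conv k (fun s => hd.system.B (v s)) t +
        (hd.system.p * wderiv 3 0 d.T y 3 t + hd.system.q * wderiv 3 0 d.T y 2 t) •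
          hd.system.e := by
  rw [hd.waveEquation_iff]
  refine Filter.eventually_congr ?_
  have hc : ContinuousOn (fun s => dxx (v s : H2 d.ℓ)) (Icc 0 d.T) :=
    (hd.prim_apply_zero hv (coord d.ℓ 2)).continuousOn
  filter_upwards [ae_restrict_mem measurableSet_Ioo] with t ht
  have e : conv k (fun s => hd.system.B (v s)) t =
      hd.resolvent (conv k (fun s => dxx (v s : H2 d.ℓ)) t) :=
    (@map_conv (L2 d.ℓ) (H2Zero d.ℓ) _ _ (Submodule.normedAddCommGroup _)
      (Submodule.normedSpace _) _ _ inferInstance _ _ (hk.continuousOn one_pos) hc hd.resolvent _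
      (Ioo_subset_Icc_self ht)).symm
  rw [← hd.eq_resolvent_iff, e, map_add, map_sub, map_sub, map_smul, map_smul]
  rfl

/-! ### The equivalent problem -/

/-- The prescribed `y''(0)` is the value that the integrated displacement equation forces at `t =
0`. The multiples of `u₁(ℓ)` coming from `v₀'(ℓ)` and from the measurement of `v₀` cancel. -/
theorem yTwo₀_eq_hInit : d.yTwo₀ = hd.system.F₁ 0 + hd.system.Lψ hd.V₀ - d.GHat₀ * d.k₀ := by
  have h := hd.ψ_ne
  have e : hd.system.F₁ 0 + hd.system.Lψ hd.V₀ =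
      (d.ψ d.ℓ)⁻¹ * (d.fD 1 0 + d.ψL (hd.V₀ : H2 d.ℓ)) := by
    rw [mul_add]
    rfl
  have e2 : dxL d.ℓ (hd.V₀ : H2 d.ℓ) = d.u₁D 1 d.ℓ - d.u₁ d.ℓ * (1 / d.ℓ) := by
    change dxL d.ℓ (hd.U₁ - d.u₁ d.ℓ • linear hd.ℓ_pos) = _
    rw [map_sub, map_smul, dxL_apply hd.ℓ_pos, dxL_apply hd.ℓ_pos, hd.dx_U₁ hd.ℓ_mem_I,
      dx_linear hd.ℓ_pos hd.ℓ_mem_I, smul_eq_mul]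
  rw [e, hd.yTwo₀_eq, hd.GHat₀_eq, hd.ψL_eq, e2, hd.weightL_V₀]
  field_simp
  ring

/-- The equations for `k'` and `y'''` with the prescribed `k(0)` and `y''(0)` are exactly the
differentiated forms of the two integral equations. -/
theorem equivalent_iff {v : ℝ → H2Zero d.ℓ} {k y : ℝ → ℝ} :
    d.IsEquivalentSolution v k y ↔ hd.system.IsEvolution d.T v k y ∧
      hd.system.KernelEquation d.T v k ∧ hd.system.DisplacementEquation d.T v k y := by
  have hT := hd.T_pos
  have key1 : ∀ {v : ℝ → H2Zero d.ℓ} {k : ℝ → ℝ} (t : ℝ),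
      (∫ s in (0 : ℝ)..t, ∫ x in (0 : ℝ)..d.ℓ,
        d.kD k 1 (t - s) * val (v s : H2 d.ℓ) x * d.φD 3 x) =
      conv (wderiv 1 0 d.T k 1) (fun s => hd.system.Lφ (v s)) t := by
    intro v k t
    rw [conv]
    congr 1
    funext s
    have : hd.system.Lφ (v s) = ∫ x in (0 : ℝ)..d.ℓ, val (v s : H2 d.ℓ) x * d.φD 3 x :=
      hd.φL_apply _
    rw [this, smul_eq_mul, ← intervalIntegral.integral_const_mul]
    simp only [mul_assoc]
    rfl
  have key2 : ∀ (v : ℝ → H2Zero d.ℓ) (t : ℝ),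
      d.G v t = hd.system.F₁ t + hd.system.Lψ (v t) := by
    intro v t
    rw [G, ← hd.ψL_apply, mul_add]
    rfl
  have key3 : ∀ (v : ℝ → H2Zero d.ℓ) (t : ℝ), d.GPrime v t =
      (d.ψ d.ℓ)⁻¹ * d.fD 2 t + hd.system.Lψ (wderiv 2 0 d.T v 1 t) := by
    intro v t
    rw [GPrime, ← hd.ψL_apply, mul_add]
    rfl
  have keyk : ∀ {v : ℝ → H2Zero d.ℓ} {k : ℝ → ℝ}, (∀ᵐ t ∂(volume.restrict (Ioo 0 d.T)),
      d.kD k 1 t = d.α * (d.fD 4 t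
        + (∫ x in (0 : ℝ)..d.ℓ, val (d.vD v 1 t : H2 d.ℓ) x * d.φD 3 x)
        - k 0 * (∫ x in (0 : ℝ)..d.ℓ, val (v t : H2 d.ℓ) x * d.φD 3 x)
        - ∫ s in (0 : ℝ)..t, ∫ x in (0 : ℝ)..d.ℓ,
          d.kD k 1 (t - s) * val (v s : H2 d.ℓ) x * d.φD 3 x)) ↔
      ∀ᵐ t ∂(volume.restrict (Ioo 0 d.T)), wderiv 1 0 d.T k 1 t = hd.system.α * (d.fD 4 t +
        hd.system.Lφ (wderiv 2 0 d.T v 1 t) - k 0 * hd.system.Lφ (v t) -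
          conv (wderiv 1 0 d.T k 1) (fun s => hd.system.Lφ (v s)) t) := by
    intro v k
    refine Filter.eventually_congr (Filter.Eventually.of_forall fun t => ?_)
    rw [key1, ← hd.φL_apply, ← hd.φL_apply]
    rfl
  have keyy : ∀ {v : ℝ → H2Zero d.ℓ} {k y : ℝ → ℝ}, (∀ᵐ t ∂(volume.restrict (Ioo 0 d.T)),
      d.yD y 3 t = d.GPrime v t - d.kD k 1 t * d.GHat₀ - k 0 * d.G v t
        - ∫ s in (0 : ℝ)..t, d.kD k 1 (t - s) * d.G v s) ↔
      ∀ᵐ t ∂(volume.restrict (Ioo 0 d.T)), wderiv 3 0 d.T y 3 t = (d.ψ d.ℓ)⁻¹ * d.fD 2 t +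
        hd.system.Lψ (wderiv 2 0 d.T v 1 t) - hd.system.γ * wderiv 1 0 d.T k 1 t -
          k 0 * (hd.system.F₁ t + hd.system.Lψ (v t)) -
          conv (wderiv 1 0 d.T k 1) (fun s => hd.system.F₁ s + hd.system.Lψ (v s)) t := by
    intro v k y
    refine Filter.eventually_congr (Filter.Eventually.of_forall fun t => ?_)
    simp only [key2, key3]
    rw [mul_comm (d.kD k 1 t)]
    rfl
  constructor
  · intro H
    have hv0 := hd.eq_V₀_iff.1 H.v_init
    refine ⟨⟨H.v_mem, H.k_mem, H.y_mem, hv0, hd.eq_V₁_iff.1 H.vt_init,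
      (hd.wave_iff H.v_mem H.k_mem).1 H.wave⟩,
      (SystemData.kernelEquation_iff hT H.v_mem H.k_mem (hd.f_prim (by norm_num : 3 < 4))).2
        ⟨?_, keyk.1 H.k_eq⟩,
      (SystemData.displacementEquation_iff hT H.v_mem H.k_mem H.y_mem hd.F₁_prim
        hd.F₁_deriv_continuousOn).2 ⟨?_, keyy.1 H.y_eq⟩⟩
    · rw [H.k_init, hd.k₀_eq, hv0]
      rfl
    · rw [H.k_init, hv0]
      exact H.y_init.trans hd.yTwo₀_eq_hInit
  · rintro ⟨H, hk, hy⟩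
    obtain ⟨hk0, hk1⟩ := (SystemData.kernelEquation_iff hT H.v_mem H.k_mem
      (hd.f_prim (by norm_num : 3 < 4))).1 hk
    obtain ⟨hy0, hy1⟩ := (SystemData.displacementEquation_iff hT H.v_mem H.k_mem H.y_mem
      hd.F₁_prim hd.F₁_deriv_continuousOn).1 hy
    have hki : k 0 = d.k₀ := by
      rw [hk0, H.v_init, hd.k₀_eq]
      rfl
    refine ⟨H.v_mem, H.k_mem, H.y_mem, (hd.wave_iff H.v_mem H.k_mem).2 H.wave,
      hd.eq_V₀_iff.2 H.v_init, hd.eq_V₁_iff.2 H.vt_init, hki, ?_, keyk.2 hk1, keyy.2 hy1⟩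
    rw [hki, H.v_init] at hy0
    exact hy0.trans hd.yTwo₀_eq_hInit.symm

/-! ### The overdetermination and the boundary condition -/

theorem integral_overdetermination (w : H2 d.ℓ) (c : ℝ) :
    ∫ x in (0 : ℝ)..d.ℓ, d.weight x * (dx w x - c / d.ℓ) =
      d.weightL w - c * (d.ψ d.ℓ / d.ℓ) := by
  have i1 : IntervalIntegrable (fun x => d.weight x * dx w x) volume 0 d.ℓ :=
    intervalIntegrable_of_integrableOn_Ioo (integrableOn_Ioo_of_continuousOn
      (hd.weight_cont.mul (isPrimitiveOn_dx hd.ℓ_pos w).continuousOn)) hd.zero_mem_I hd.ℓ_mem_I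
  have i0 : IntervalIntegrable (fun x => d.weight x * (c / d.ℓ)) volume 0 d.ℓ :=
    intervalIntegrable_of_integrableOn_Ioo (integrableOn_Ioo_of_continuousOn
      (hd.weight_cont.mul continuousOn_const)) hd.zero_mem_I hd.ℓ_mem_I
  simp only [mul_sub]
  rw [intervalIntegral.integral_sub i1 i0, intervalIntegral.integral_mul_const,
    hd.integral_weight, ← hd.weightL_apply]
  ring

/-- The wave equation tested with `φ'`. -/
theorem wave_paired {v : ℝ → H2Zero d.ℓ} {k y : ℝ → ℝ} (hv : MemH 2 0 d.T v)
    (hk : MemH 1 0 d.T k) (hw : d.WaveEquation v k y) :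
    ∀ᵐ t ∂(volume.restrict (Ioo 0 d.T)),
      d.weightL (d.vD v 2 t : H2 d.ℓ) - d.zD y 2 t * (d.ψ d.ℓ / d.ℓ) =
        d.α⁻¹ * k t - d.φL (v t : H2 d.ℓ) + conv k (fun s => d.φL (v s : H2 d.ℓ)) t := by
  have hc : ContinuousOn (fun s => dxx (v s : H2 d.ℓ)) (Icc 0 d.T) :=
    (hd.prim_apply_zero hv (coord d.ℓ 2)).continuousOn
  filter_upwards [(hd.waveEquation_iff v k y).1 hw, ae_restrict_mem measurableSet_Ioo] with t h ht
  have h2 := congrArg (pair d.ℓ (d.φD 1)) h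
  rw [map_add, map_sub, map_sub, map_smul, map_smul,
    map_conv (hk.continuousOn one_pos) hc _ (Ioo_subset_Icc_self ht), hd.pair_φ_helmholtz,
    hd.pair_φ_dxx, hd.pair_φ_dxx_U₀, hd.pair_φ_linear, smul_eq_mul, smul_eq_mul] at h2
  simp only [hd.pair_φ_dxx] at h2
  linarith

theorem overdetermination_iff_Icc {v : ℝ → H2Zero d.ℓ} {y : ℝ → ℝ} (hv : MemH 2 0 d.T v)
    (hy : MemH 3 0 d.T y) :
    (∀ t ∈ Ioo 0 d.T,
      ∫ x in (0 : ℝ)..d.ℓ, d.weight x * (dx (v t : H2 d.ℓ) x - d.zD y 0 t / d.ℓ) = d.fD 1 t) ↔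
    EqOn (fun t => d.weightL (v t : H2 d.ℓ) - d.ψ d.ℓ / d.ℓ * d.zD y 0 t) (d.fD 1)
      (Icc 0 d.T) := by
  simp only [hd.integral_overdetermination, mul_comm (d.zD y 0 _)]
  refine ⟨fun h => eqOn_Icc_of_eqOn_Ioo hd.T_pos ?_ (hd.f_prim (by norm_num)).continuousOn h,
    fun h t ht => h (Ioo_subset_Icc_self ht)⟩
  exact (hd.prim_apply_zero hv d.weightL).continuousOn.sub
    (continuousOn_const.mul (hd.z_prim hy two_pos).continuousOn)

/-- Differentiate twice. The two initial values remain, and the second derivative, rewritten by the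
wave equation tested with `φ'`, is the integral equation for `k` solved for `f'''`. -/
theorem overdetermination_iff {v : ℝ → H2Zero d.ℓ} {k y : ℝ → ℝ} (hv : MemH 2 0 d.T v)
    (hk : MemH 1 0 d.T k) (hy : MemH 3 0 d.T y) (hw : d.WaveEquation v k y) :
    EqOn (fun t => d.weightL (v t : H2 d.ℓ) - d.ψ d.ℓ / d.ℓ * d.zD y 0 t) (d.fD 1)
      (Icc 0 d.T) ↔
    d.weightL (v 0 : H2 d.ℓ) - d.ψ d.ℓ / d.ℓ * d.zD y 0 0 = d.fD 1 0 ∧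
      d.weightL (d.vD v 1 0 : H2 d.ℓ) - d.ψ d.ℓ / d.ℓ * d.zD y 1 0 = d.fD 2 0 ∧
      hd.system.KernelEquation d.T v k := by
  have hT := hd.T_pos
  have hα := hd.α_ne_zero
  have hφ := (hd.prim_apply_zero hv d.φL).continuousOn
  have hkc := hk.continuousOn one_pos
  have p0 := (hd.prim_apply_zero hv d.weightL).sub
    ((hd.z_prim hy two_pos).const_mul (d.ψ d.ℓ / d.ℓ))
  have p1 := (hd.prim_apply hv d.weightL one_lt_two).sub
    ((hd.z_prim hy one_lt_two).const_mul (d.ψ d.ℓ / d.ℓ))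
  have c2 : ContinuousOn (fun t => d.α⁻¹ * k t - d.φL (v t : H2 d.ℓ) +
      conv k (fun s => d.φL (v s : H2 d.ℓ)) t) (Icc 0 d.T) :=
    ((continuousOn_const.mul hkc).sub hφ).add (continuousOn_conv hkc hφ)
  have f2 := hd.f_prim (by norm_num : 2 < 4)
  have f3 := hd.f_prim (by norm_num : 3 < 4)
  rw [p0.eqOn_iff hT (hd.f_prim (by norm_num : 1 < 4))]
  refine and_congr Iff.rfl ?_
  have e1 : (fun t => d.weightL (d.vD v 1 t : H2 d.ℓ) - d.ψ d.ℓ / d.ℓ * d.zD y 1 t)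
      =ᵐ[volume.restrict (Ioo 0 d.T)] d.fD 2 ↔
      EqOn (fun t => d.weightL (d.vD v 1 t : H2 d.ℓ) - d.ψ d.ℓ / d.ℓ * d.zD y 1 t) (d.fD 2)
        (Icc 0 d.T) :=
    ⟨fun h => eqOn_Icc_of_ae_eq_Ioo hT p1.continuousOn f2.continuousOn h, fun h =>
      (ae_restrict_mem measurableSet_Ioo).mono fun t ht => h (Ioo_subset_Icc_self ht)⟩
  refine e1.trans ((p1.eqOn_iff hT f2).trans (and_congr Iff.rfl ?_))
  have e2 : (fun t => d.weightL (d.vD v 2 t : H2 d.ℓ) - d.ψ d.ℓ / d.ℓ * d.zD y 2 t)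
      =ᵐ[volume.restrict (Ioo 0 d.T)] fun t => d.α⁻¹ * k t - d.φL (v t : H2 d.ℓ) +
        conv k (fun s => d.φL (v s : H2 d.ℓ)) t := by
    filter_upwards [hd.wave_paired hv hk hw] with t ht
    rw [← ht, mul_comm (d.zD y 2 t)]
  constructor
  · intro h t ht
    have := eqOn_Icc_of_ae_eq_Ioo hT c2 f3.continuousOn (e2.symm.trans h) ht
    change k t = d.α * (d.fD 3 t + d.φL (v t : H2 d.ℓ) -
      conv k (fun s => d.φL (v s : H2 d.ℓ)) t)
    rw [← this]
    field_simp
    ring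
  · intro h
    refine e2.trans ((ae_restrict_mem measurableSet_Ioo).mono fun t ht => ?_)
    have ht' : k t = d.α * (d.fD 3 t + d.φL (v t : H2 d.ℓ) -
      conv k (fun s => d.φL (v s : H2 d.ℓ)) t) := h t (Ioo_subset_Icc_self ht)
    simp only
    rw [ht']
    field_simp
    ring

/-- Under the overdetermination condition, `F₁ + Lψ v = v_x(ℓ) - z/ℓ`. Substituting this and `Ĝ₀ =
u₀'(ℓ)`, the two equations differ by a rearrangement; continuity supplies the end points in time. -/
theorem boundary_iff {v : ℝ → H2Zero d.ℓ} {k y : ℝ → ℝ} (hv : MemH 2 0 d.T v)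
    (hk : MemH 1 0 d.T k) (hy : MemH 3 0 d.T y)
    (ho : EqOn (fun t => d.weightL (v t : H2 d.ℓ) - d.ψ d.ℓ / d.ℓ * d.zD y 0 t) (d.fD 1)
      (Icc 0 d.T)) :
    (∀ t ∈ Ioo 0 d.T,
      dx (v t : H2 d.ℓ) d.ℓ - (∫ s in (0 : ℝ)..t, k (t - s) * dx (v s : H2 d.ℓ) d.ℓ)
        = d.yD y 2 t + k t * d.u₀D 1 d.ℓ
          + 1 / d.ℓ * (d.zD y 0 t - ∫ s in (0 : ℝ)..t, k (t - s) * d.zD y 0 s)) ↔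
      hd.system.DisplacementEquation d.T v k y := by
  have hψ := hd.ψ_ne
  have hkc := hk.continuousOn one_pos
  have hz := (hd.z_prim hy two_pos).continuousOn
  have hy2 := (hd.y_prim hy (by norm_num : 2 < 3)).continuousOn
  have hxc := (hd.prim_apply_zero hv (dxL d.ℓ)).continuousOn
  have hFv : EqOn (fun t => hd.system.F₁ t + hd.system.Lψ (v t))
      (fun t => dxL d.ℓ (v t : H2 d.ℓ) - 1 / d.ℓ * d.zD y 0 t) (Icc 0 d.T) := by
    intro t ht
    change (d.ψ d.ℓ)⁻¹ * d.fD 1 t + (d.ψ d.ℓ)⁻¹ * d.ψL (v t : H2 d.ℓ) = _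
    rw [← ho ht, hd.ψL_eq]
    field_simp
    ring
  have hconv : EqOn (conv k fun s => hd.system.F₁ s + hd.system.Lψ (v s))
      (fun t => conv k (fun s => dxL d.ℓ (v s : H2 d.ℓ)) t - 1 / d.ℓ * conv k (d.zD y 0) t)
      (Icc 0 d.T) := by
    intro t ht
    have hz' : ContinuousOn (fun s => 1 / d.ℓ * d.zD y 0 s) (Icc 0 d.T) :=
      continuousOn_const.mul hz
    rw [conv_congr (eqOn_refl k _) hFv ht, conv_sub hkc hxc hz' ht, conv_const_mul]
  have hb : (∀ t ∈ Ioo 0 d.T,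
      dx (v t : H2 d.ℓ) d.ℓ - (∫ s in (0 : ℝ)..t, k (t - s) * dx (v s : H2 d.ℓ) d.ℓ)
        = d.yD y 2 t + k t * d.u₀D 1 d.ℓ
          + 1 / d.ℓ * (d.zD y 0 t - ∫ s in (0 : ℝ)..t, k (t - s) * d.zD y 0 s)) ↔
      EqOn (fun t => dxL d.ℓ (v t : H2 d.ℓ) - conv k (fun s => dxL d.ℓ (v s : H2 d.ℓ)) t)
        (fun t => d.yD y 2 t + k t * d.u₀D 1 d.ℓ +
          1 / d.ℓ * (d.zD y 0 t - conv k (d.zD y 0) t)) (Ioo 0 d.T) := by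
    simp only [dxL_apply hd.ℓ_pos]
    rfl
  rw [hb]
  have c1 := hxc.sub (continuousOn_conv hkc hxc)
  have c2 : ContinuousOn (fun t => d.yD y 2 t + k t * d.u₀D 1 d.ℓ +
      1 / d.ℓ * (d.zD y 0 t - conv k (d.zD y 0) t)) (Icc 0 d.T) :=
    (hy2.add (hkc.mul continuousOn_const)).add
      (continuousOn_const.mul (hz.sub (continuousOn_conv hkc hz)))
  constructor
  · intro h t ht
    have h1 := eqOn_Icc_of_eqOn_Ioo hd.T_pos c1 c2 h ht
    have h2 := hFv ht
    have h3 := hconv ht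
    have h4 : hd.system.γ = d.u₀D 1 d.ℓ := hd.GHat₀_eq
    simp only [Pi.sub_apply] at h1 h2 h3
    rw [h2, h3, h4]
    change d.yD y 2 t = _
    linarith
  · intro h t ht
    have h1 := h t (Ioo_subset_Icc_self ht)
    have h2 := hFv (Ioo_subset_Icc_self ht)
    have h3 := hconv (Ioo_subset_Icc_self ht)
    have h4 : hd.system.γ = d.u₀D 1 d.ℓ := hd.GHat₀_eq
    simp only at h2 h3
    rw [h2, h3, h4] at h1
    change d.yD y 2 t = _ at h1
    simp only
    rw [h1]
    ring

/-- The inverse problem is the equivalent problem plus two numbers. By the conditions on `f'(0)` and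
`f''(0)`, the initial values of the overdetermination condition say `z(0) = -u₁(ℓ)` and `z'(0) =
-u₂(ℓ)`, as `ψ(ℓ)/ℓ ≠ 0`. -/
theorem inverse_iff {v : ℝ → H2Zero d.ℓ} {k y : ℝ → ℝ} :
    d.IsInverseSolution v k y ↔ (hd.system.IsEvolution d.T v k y ∧
      hd.system.KernelEquation d.T v k ∧ hd.system.DisplacementEquation d.T v k y) ∧
      d.zD y 0 0 = - d.u₁ d.ℓ ∧ d.zD y 1 0 = - d.u₂ d.ℓ := by
  have hc : d.ψ d.ℓ / d.ℓ ≠ 0 := div_ne_zero hd.ψ_ne hd.ℓ_pos.ne'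
  have e0 : d.weightL (hd.V₀ : H2 d.ℓ) - d.ψ d.ℓ / d.ℓ * d.zD y 0 0 = d.fD 1 0 ↔
      d.zD y 0 0 = - d.u₁ d.ℓ := by
    rw [hd.weightL_V₀]
    refine ⟨fun h => mul_left_cancel₀ hc (by linarith), fun h => ?_⟩
    rw [h]
    ring
  have e1 : d.weightL (hd.V₁ : H2 d.ℓ) - d.ψ d.ℓ / d.ℓ * d.zD y 1 0 = d.fD 2 0 ↔
      d.zD y 1 0 = - d.u₂ d.ℓ := by
    rw [hd.weightL_V₁]
    refine ⟨fun h => mul_left_cancel₀ hc (by linarith), fun h => ?_⟩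
    rw [h]
    ring
  constructor
  · intro H
    have hv0 := hd.eq_V₀_iff.1 H.v_init
    have hv1 := hd.eq_V₁_iff.1 H.vt_init
    have ho := (hd.overdetermination_iff_Icc H.v_mem H.y_mem).1 H.overdetermination
    obtain ⟨h1, h2, h3⟩ := (hd.overdetermination_iff H.v_mem H.k_mem H.y_mem H.wave).1 ho
    rw [hv0, e0] at h1
    rw [hv1, e1] at h2
    exact ⟨⟨⟨H.v_mem, H.k_mem, H.y_mem, hv0, hv1, (hd.wave_iff H.v_mem H.k_mem).1 H.wave⟩, h3,
      (hd.boundary_iff H.v_mem H.k_mem H.y_mem ho).1 H.boundary⟩, h1, h2⟩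
  · rintro ⟨⟨H, hk, hy⟩, h1, h2⟩
    have hw := (hd.wave_iff H.v_mem H.k_mem).2 H.wave
    have hv1 : d.vD v 1 0 = hd.V₁ := H.vt_init
    have hv0 : v 0 = hd.V₀ := H.v_init
    have ho := (hd.overdetermination_iff H.v_mem H.k_mem H.y_mem hw).2
      ⟨by rw [hv0, e0, h1], by rw [hv1, e1, h2], hk⟩
    exact ⟨H.v_mem, H.k_mem, H.y_mem, hw,
      (hd.boundary_iff H.v_mem H.k_mem H.y_mem ho).2 hy, hd.eq_V₀_iff.2 hv0,
      hd.eq_V₁_iff.2 hv1, (hd.overdetermination_iff_Icc H.v_mem H.y_mem).2 ho⟩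

/-! ### Existence and uniqueness -/

/-- The integral system sees `y` only through `y''`, so nothing more can be concluded about `y`
here. -/
theorem equivalent_unique {v v' : ℝ → H2Zero d.ℓ} {k k' y y' : ℝ → ℝ}
    (H : d.IsEquivalentSolution v k y) (H' : d.IsEquivalentSolution v' k' y') :
    EqOn v v' (Icc 0 d.T) ∧ EqOn k k' (Icc 0 d.T) ∧ EqOn (d.yD y 2) (d.yD y' 2) (Icc 0 d.T) := by
  obtain ⟨h1, h2, h3⟩ := hd.equivalent_iff.1 H
  obtain ⟨h1', h2', h3'⟩ := hd.equivalent_iff.1 H'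
  exact (h1.isSolution hd.T_pos h2 h3).unique (h1'.isSolution hd.T_pos h2' h3')
    hd.F₁_prim.continuousOn

theorem inverse_equivalent {v : ℝ → H2Zero d.ℓ} {k y : ℝ → ℝ} (H : d.IsInverseSolution v k y) :
    d.IsEquivalentSolution v k y := hd.equivalent_iff.2 (hd.inverse_iff.1 H).1

theorem yD_one_zero {v : ℝ → H2Zero d.ℓ} {k y : ℝ → ℝ} (H : d.IsInverseSolution v k y) :
    d.yD y 1 0 = (- d.u₂ d.ℓ - d.p * d.yTwo₀) / d.q := by
  have h2 := (hd.inverse_iff.1 H).2.2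
  have h3 := (hd.inverse_equivalent H).y_init
  rw [zD] at h2
  change d.p * d.yD y 2 0 + _ = _ at h2
  rw [eq_div_iff hd.q_pos.ne', ← h3]
  linarith

/-- `y''` is already unique. The value `z'(0)` gives `y'(0)` and then `z(0)` gives `y(0)`, since `q
≠ 0`; two integrations recover `y`. -/
theorem inverse_unique {v v' : ℝ → H2Zero d.ℓ} {k k' y y' : ℝ → ℝ}
    (H : d.IsInverseSolution v k y) (H' : d.IsInverseSolution v' k' y') :
    EqOn v v' (Icc 0 d.T) ∧ EqOn k k' (Icc 0 d.T) ∧ EqOn y y' (Icc 0 d.T) := by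
  obtain ⟨hv, hk, hy⟩ := hd.equivalent_unique (hd.inverse_equivalent H) (hd.inverse_equivalent H')
  have h1 := (hd.inverse_iff.1 H).2.1
  have h1' := (hd.inverse_iff.1 H').2.1
  rw [zD, zero_add, hd.yD_one_zero H] at h1
  rw [zD, zero_add, hd.yD_one_zero H'] at h1'
  have hy1 : EqOn (d.yD y 1) (d.yD y' 1) (Icc 0 d.T) :=
    ((hd.y_prim H.y_mem (by norm_num : 1 < 3)).eqOn_iff hd.T_pos
      (hd.y_prim H'.y_mem (by norm_num : 1 < 3))).2
      ⟨(hd.yD_one_zero H).trans (hd.yD_one_zero H').symm,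
        (ae_restrict_mem measurableSet_Ioo).mono fun t ht => hy (Ioo_subset_Icc_self ht)⟩
  have hy0 : EqOn (d.yD y 0) (d.yD y' 0) (Icc 0 d.T) :=
    ((hd.y_prim H.y_mem (by norm_num : 0 < 3)).eqOn_iff hd.T_pos
      (hd.y_prim H'.y_mem (by norm_num : 0 < 3))).2
      ⟨mul_left_cancel₀ hd.q_pos.ne' (by linarith),
        (ae_restrict_mem measurableSet_Ioo).mono fun t ht => hy1 (Ioo_subset_Icc_self ht)⟩
  exact ⟨hv, hk, H.y_mem.wderiv_zero.symm.trans (hy0.trans H'.y_mem.wderiv_zero)⟩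

theorem exists_inverse : ∃ (v : ℝ → H2Zero d.ℓ) (k y : ℝ → ℝ), d.IsInverseSolution v k y := by
  have hT := hd.T_pos
  have h0 : (0 : ℝ) ∈ Icc 0 d.T := left_mem_Icc.2 hT.le
  have hq := hd.q_pos.ne'
  obtain ⟨v, r, k, h, H⟩ := hd.system.exists_isSolution hT.le hd.F₁_prim.continuousOn
    (hd.f_prim (by norm_num : 3 < 4)).continuousOn
  -- The constants solve `p y''(0) + q y'(0) = -u₂(ℓ)` for `y'(0)` and then `p y'(0) + q y(0) =
  -- -u₁(ℓ)` for `y(0)`.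
  obtain ⟨y, h1, h2, h3, h4, h5⟩ := H.exists_isEvolution hT hd.F₁_prim hd.F₁_deriv_continuousOn
    (hd.f_prim (by norm_num : 3 < 4)) (hd.f_mem.memLp le_rfl)
    ((- d.u₁ d.ℓ - d.p * ((- d.u₂ d.ℓ - d.p * d.yTwo₀) / d.q)) / d.q)
    ((- d.u₂ d.ℓ - d.p * d.yTwo₀) / d.q)
  have he := (hd.equivalent_iff.2 ⟨h1, h2, h3⟩).y_init
  have h5' : d.yD y 1 0 = (- d.u₂ d.ℓ - d.p * d.yTwo₀) / d.q := h5
  have h4' : d.yD y 0 0 = _ := (h1.y_mem.wderiv_zero h0).trans h4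
  refine ⟨v, k, y, hd.inverse_iff.2 ⟨⟨h1, h2, h3⟩, ?_, ?_⟩⟩
  · rw [zD, zero_add, h5', h4']
    field_simp
    ring
  · rw [zD]
    change d.p * d.yD y 2 0 + _ = _
    rw [he, h5']
    field_simp
    ring

end Data.Assumptions

end AcousticInverse

namespace AcousticInverse

/-- With the derivative of the convolution on `g`, the boundary term `k g(0)` appears. It is the
origin of the terms `k u₀''` and `k u₀'(ℓ)` in the problem for `v`. -/
theorem IsPrimitiveOn.eqOn_sub_conv_iff {E : Type*} [NormedAddCommGroup E] [NormedSpace ℝ E]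
    [CompleteSpace E] {T : ℝ} (hT : 0 < T) {k : ℝ → ℝ} (hk : ContinuousOn k (Icc 0 T))
    {g g' h h' : ℝ → E} (hg : IsPrimitiveOn 0 T g g') (hg' : ContinuousOn g' (Icc 0 T))
    (hh : IsPrimitiveOn 0 T h h') :
    EqOn h (fun t => g t - AcousticInverse.conv k g t) (Icc 0 T) ↔ h 0 = g 0 ∧
      ∀ᵐ t ∂(volume.restrict (Ioo 0 T)),
        h' t = g' t - (k t • g 0 + AcousticInverse.conv k g' t) := by
  rw [hh.eqOn_iff hT (hg.sub (IsPrimitiveOn.conv hk hg hg')), conv_zero, sub_zero]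
  rfl

theorem memLp_clm {E F : Type*} [NormedAddCommGroup E] [NormedSpace ℝ E] [NormedAddCommGroup F]
    [NormedSpace ℝ F] {μ : Measure ℝ} {f : ℝ → E} (hf : MemLp f 2 μ) (L : E →L[ℝ] F) :
    MemLp (fun t => L (f t)) 2 μ :=
  L.comp_memLp' hf

namespace Data.Assumptions

variable {d : Data} (hd : d.Assumptions)

include hd

/-! ### The original problem -/

theorem helmholtz_linear :
    helmholtz d.ℓ d.β (linear hd.ℓ_pos) = coord d.ℓ 0 (linear hd.ℓ_pos) := by
  change coord d.ℓ 0 (linear hd.ℓ_pos) - d.β • dxx (linear hd.ℓ_pos) = _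
  rw [dxx_linear, smul_zero, sub_zero]

/-- For `u ∈ H³(0, T; H²)` all terms are continuous in time, so the equation holds at every `t`,
including `t = 0`, where it ties `u_tt(0)` to `u₀''`. -/
theorem original_wave_iff {u : ℝ → H2 d.ℓ} {k : ℝ → ℝ} (hu : MemH 3 0 d.T u)
    (hk : MemH 1 0 d.T k) :
    (∀ᵐ t ∂(volume.restrict (Ioo 0 d.T)), ∀ᵐ x ∂(volume.restrict (Ioo 0 d.ℓ)),
      val (d.uD u 2 t) x - dxx (u t) x - d.β * dxx (d.uD u 2 t) x
        + (∫ s in (0 : ℝ)..t, k (t - s) • dxx (u s) : L2 d.ℓ) x = 0) ↔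
    EqOn (fun t => helmholtz d.ℓ d.β (d.uD u 2 t))
      (fun t => dxx (u t) - conv k (fun s => dxx (u s)) t) (Icc 0 d.T) := by
  have hT := hd.T_pos
  have c1 : ContinuousOn (fun t => helmholtz d.ℓ d.β (d.uD u 2 t)) (Icc 0 d.T) :=
    (helmholtz d.ℓ d.β).continuous.comp_continuousOn
      (hu.continuousOn_wderiv (by norm_num : 2 < 3))
  have c2 : ContinuousOn (fun t => dxx (u t)) (Icc 0 d.T) :=
    (coord d.ℓ 2).continuous.comp_continuousOn (hu.continuousOn (by norm_num))
  have c3 := c2.sub (continuousOn_conv (hk.continuousOn one_pos) c2)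
  refine Iff.trans (b := (fun t => helmholtz d.ℓ d.β (d.uD u 2 t))
      =ᵐ[volume.restrict (Ioo 0 d.T)] fun t => dxx (u t) - conv k (fun s => dxx (u s)) t) ?_
    ⟨fun h => eqOn_Icc_of_ae_eq_Ioo hT c1 c3 h, fun h =>
      (ae_restrict_mem measurableSet_Ioo).mono fun t ht => h (Ioo_subset_Icc_self ht)⟩
  refine Filter.eventually_congr (Filter.Eventually.of_forall fun t => ?_)
  rw [Lp.ext_iff]
  refine Filter.eventually_congr ?_
  set c := conv k (fun s => dxx (u s)) t with hc
  filter_upwards [helmholtz_ae_eq d.β (d.uD u 2 t), Lp.coeFn_sub (dxx (u t)) c] with x h1 h2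
  rw [h1, h2, Pi.sub_apply]
  change _ - _ - _ + c x = _ ↔ _
  constructor <;> intro h <;> linarith

/-- The acoustic condition in the form in which it arises by differentiating the Neumann condition
for `u`. -/
theorem boundary_iff_ae {v : ℝ → H2Zero d.ℓ} {k y : ℝ → ℝ} (hv : MemH 2 0 d.T v)
    (hk : MemH 1 0 d.T k) (hy : MemH 3 0 d.T y) :
    (∀ t ∈ Ioo 0 d.T,
      dx (v t : H2 d.ℓ) d.ℓ - (∫ s in (0 : ℝ)..t, k (t - s) * dx (v s : H2 d.ℓ) d.ℓ)
        = d.yD y 2 t + k t * d.u₀D 1 d.ℓ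
          + 1 / d.ℓ * (d.zD y 0 t - ∫ s in (0 : ℝ)..t, k (t - s) * d.zD y 0 s)) ↔
      ∀ᵐ t ∂(volume.restrict (Ioo 0 d.T)), d.yD y 2 t =
        dxL d.ℓ (v t : H2 d.ℓ) - d.zD y 0 t * (1 / d.ℓ) - (k t • d.u₀D 1 d.ℓ +
          conv k (fun s => dxL d.ℓ (v s : H2 d.ℓ) - d.zD y 0 s * (1 / d.ℓ)) t) := by
  have hkc := hk.continuousOn one_pos
  have hz := (hd.z_prim hy two_pos).continuousOn
  have hz' : ContinuousOn (fun s => 1 / d.ℓ * d.zD y 0 s) (Icc 0 d.T) :=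
    continuousOn_const.mul hz
  have hy2 := (hd.y_prim hy (by norm_num : 2 < 3)).continuousOn
  have hxc := (hd.prim_apply_zero hv (dxL d.ℓ)).continuousOn
  have hg : ContinuousOn (fun t => dxL d.ℓ (v t : H2 d.ℓ) - d.zD y 0 t * (1 / d.ℓ) -
      (k t • d.u₀D 1 d.ℓ + conv k (fun s => dxL d.ℓ (v s : H2 d.ℓ) -
        d.zD y 0 s * (1 / d.ℓ)) t)) (Icc 0 d.T) := by
    have h1 : ContinuousOn (fun t => dxL d.ℓ (v t : H2 d.ℓ) - d.zD y 0 t * (1 / d.ℓ))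
        (Icc 0 d.T) := hxc.sub (hz.mul continuousOn_const)
    exact h1.sub ((hkc.smul continuousOn_const).add (continuousOn_conv hkc h1))
  have key : ∀ t ∈ Icc 0 d.T, (dx (v t : H2 d.ℓ) d.ℓ -
      (∫ s in (0 : ℝ)..t, k (t - s) * dx (v s : H2 d.ℓ) d.ℓ)
        = d.yD y 2 t + k t * d.u₀D 1 d.ℓ
          + 1 / d.ℓ * (d.zD y 0 t - ∫ s in (0 : ℝ)..t, k (t - s) * d.zD y 0 s) ↔
      d.yD y 2 t = dxL d.ℓ (v t : H2 d.ℓ) - d.zD y 0 t * (1 / d.ℓ) - (k t • d.u₀D 1 d.ℓ +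
          conv k (fun s => dxL d.ℓ (v s : H2 d.ℓ) - d.zD y 0 s * (1 / d.ℓ)) t)) := by
    intro t ht
    simp only [mul_comm (d.zD y 0 _), smul_eq_mul]
    rw [conv_sub hkc hxc hz' ht, conv_const_mul]
    simp only [← dxL_apply hd.ℓ_pos]
    change _ - conv k (fun s => dxL d.ℓ (v s : H2 d.ℓ)) t = _ + _ +
      _ * (_ - conv k (d.zD y 0) t) ↔ _
    constructor <;> intro h <;> linarith
  refine ⟨fun h => (ae_restrict_mem measurableSet_Ioo).mono fun t ht =>
    (key t (Ioo_subset_Icc_self ht)).1 (h t ht), fun h t ht =>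
    (key t (Ioo_subset_Icc_self ht)).2 ?_⟩
  exact eqOn_Icc_of_ae_eq_Ioo hd.T_pos hy2 hg h (Ioo_subset_Icc_self ht)

theorem right_iff {u : ℝ → H2 d.ℓ} {k y : ℝ → ℝ} (hu : MemH 3 0 d.T u) (hk : MemH 1 0 d.T k)
    (hy : MemH 3 0 d.T y) :
    (∀ t ∈ Ioo 0 d.T,
      dx (u t) d.ℓ - (∫ s in (0 : ℝ)..t, k s * dx (u (t - s)) d.ℓ) = d.yD y 1 t) ↔
    EqOn (d.yD y 1) (fun t => dxL d.ℓ (u t) - conv k (fun s => dxL d.ℓ (u s)) t)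
      (Icc 0 d.T) := by
  have hxc : ContinuousOn (fun t => dxL d.ℓ (u t)) (Icc 0 d.T) :=
    (dxL d.ℓ).continuous.comp_continuousOn (hu.continuousOn (by norm_num))
  simp only [conv_eq_reflect, dxL_apply hd.ℓ_pos, smul_eq_mul]
  refine ⟨fun h => ?_, fun h t ht => (h (Ioo_subset_Icc_self ht)).symm⟩
  have c := hxc.sub (continuousOn_conv (hk.continuousOn one_pos) hxc)
  refine eqOn_Icc_of_eqOn_Ioo hd.T_pos (hd.y_prim hy (by norm_num : 1 < 3)).continuousOn
    (c.congr fun t _ => ?_) fun t ht => (h t ht).symm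
  simp only [Pi.sub_apply, conv_eq_reflect, dxL_apply hd.ℓ_pos, smul_eq_mul]

/-- The original problem for `u` and the inverse problem for `v = u_t + z x/ℓ` are equivalent. -/
theorem original_iff (h0 : d.u₀ 0 = 0)
    (h2 : d.u₂ d.ℓ = -(d.p * d.yTwo₀ + d.q * d.u₀D 1 d.ℓ)) {u : ℝ → H2 d.ℓ}
    {v : ℝ → H2Zero d.ℓ} {k y : ℝ → ℝ} (hu : MemH 3 0 d.T u) (hv : MemH 2 0 d.T v)
    (hk : MemH 1 0 d.T k) (hy : MemH 3 0 d.T y)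
    (he : EqOn (d.uD u 1) (fun t => (v t : H2 d.ℓ) - d.zD y 0 t • linear hd.ℓ_pos)
      (Icc 0 d.T)) :
    d.IsOriginalSolution u k y ↔ u 0 = hd.U₀ ∧ d.IsInverseSolution v k y := by
  have hT := hd.T_pos
  have hℓ := hd.ℓ_pos
  have t0 : (0 : ℝ) ∈ Icc 0 d.T := left_mem_Icc.2 hT.le
  have hkc := hk.continuousOn one_pos
  have pu : ∀ {j : ℕ}, j < 3 → IsPrimitiveOn 0 d.T (d.uD u j) (d.uD u (j + 1)) :=
    fun hj => hu.isPrimitiveOn hT hj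
  have pu0 : IsPrimitiveOn 0 d.T u (d.uD u 1) := hu.isPrimitiveOn_zero hT three_pos
  have pv0 := hd.prim_apply_zero hv (ContinuousLinearMap.id ℝ (H2 d.ℓ))
  have pv1 := hd.prim_apply hv (ContinuousLinearMap.id ℝ (H2 d.ℓ)) one_lt_two
  have pz0 := hd.z_prim hy two_pos
  have pz1 := hd.z_prim hy one_lt_two
  have pa0 := pv0.sub (pz0.smul_const (linear hℓ))
  have pa1 := pv1.sub (pz1.smul_const (linear hℓ))
  have e2 : EqOn (d.uD u 2) (fun t => (d.vD v 1 t : H2 d.ℓ) - d.zD y 1 t • linear hℓ)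
      (Icc 0 d.T) := eqOn_Icc_of_ae_eq_Ioo hT (pu (by norm_num)).continuousOn pa1.continuousOn
    ((pu (by norm_num)).ae_eq hT pa0 he)
  have e3 : d.uD u 3 =ᵐ[volume.restrict (Ioo 0 d.T)]
      fun t => (d.vD v 2 t : H2 d.ℓ) - d.zD y 2 t • linear hℓ :=
    (pu (by norm_num)).ae_eq hT pa1 e2
  have a1 : ∀ (w : H2Zero d.ℓ) (c : ℝ), helmholtz d.ℓ d.β ((w : H2 d.ℓ) - c • linear hℓ) =
      helmholtz d.ℓ d.β (w : H2 d.ℓ) - c • coord d.ℓ 0 (linear hℓ) := fun w c => by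
    rw [map_sub, map_smul, hd.helmholtz_linear]
  have a2 : ∀ (w : H2Zero d.ℓ) (c : ℝ), dxx ((w : H2 d.ℓ) - c • linear hℓ) =
      dxx (w : H2 d.ℓ) := fun w c => by
    change dxx (w : H2 d.ℓ) - c • dxx (linear hℓ) = _
    rw [dxx_linear, smul_zero, sub_zero]
  have a3 : ∀ (w : H2Zero d.ℓ) (c : ℝ), dxL d.ℓ ((w : H2 d.ℓ) - c • linear hℓ) =
      dxL d.ℓ (w : H2 d.ℓ) - c * (1 / d.ℓ) := fun w c => by
    rw [map_sub, map_smul, dxL_apply hℓ (linear hℓ), dx_linear hℓ hd.ℓ_mem_I, smul_eq_mul]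
  have a4 : ∀ (w : H2Zero d.ℓ) (c : ℝ), d.weightL ((w : H2 d.ℓ) - c • linear hℓ) =
      d.weightL (w : H2 d.ℓ) - d.ψ d.ℓ / d.ℓ * c := fun w c => by
    rw [map_sub, map_smul, hd.weightL_linear, smul_eq_mul, mul_comm]
  have a5 : ∀ (w : H2Zero d.ℓ) (c : ℝ), val ((w : H2 d.ℓ) - c • linear hℓ) 0 = 0 :=
    fun w c => by
      rw [hd.val_sub_linear hd.zero_mem_I, val_zero_of_H2Zero hℓ, zero_div, mul_zero, sub_zero]
  have a6 : ∀ (w : H2Zero d.ℓ) (c : ℝ), val ((w : H2 d.ℓ) - c • linear hℓ) d.ℓ = -c :=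
    fun w c => by
      rw [hd.val_sub_linear hd.ℓ_mem_I, val_right_of_H2Zero hℓ, div_self hℓ.ne', mul_one,
        zero_sub]
  -- the equations for `u` in terms of `v`
  have wave : (∀ᵐ t ∂(volume.restrict (Ioo 0 d.T)), ∀ᵐ x ∂(volume.restrict (Ioo 0 d.ℓ)),
      val (d.uD u 2 t) x - dxx (u t) x - d.β * dxx (d.uD u 2 t) x
        + (∫ s in (0 : ℝ)..t, k (t - s) • dxx (u s) : L2 d.ℓ) x = 0) ↔
      helmholtz d.ℓ d.β (d.uD u 2 0) = dxx (u 0) ∧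
      ∀ᵐ t ∂(volume.restrict (Ioo 0 d.T)), helmholtz d.ℓ d.β (d.vD v 2 t : H2 d.ℓ) =
        dxx (v t : H2 d.ℓ) - k t • dxx (u 0) - conv k (fun s => dxx (v s : H2 d.ℓ)) t +
          d.zD y 2 t • coord d.ℓ 0 (linear hℓ) := by
    have pg := pu0.clm (coord d.ℓ 2)
    have ph := (pu (by norm_num : 2 < 3)).clm (helmholtz d.ℓ d.β)
    have cg : ContinuousOn (fun t => coord d.ℓ 2 (d.uD u 1 t)) (Icc 0 d.T) :=
      (coord d.ℓ 2).continuous.comp_continuousOn (pu (by norm_num : 1 < 3)).continuousOn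
    rw [hd.original_wave_iff hu hk]
    refine (IsPrimitiveOn.eqOn_sub_conv_iff hT hkc pg cg ph).trans (and_congr Iff.rfl ?_)
    refine Filter.eventually_congr ?_
    have eg : EqOn (fun t => coord d.ℓ 2 (d.uD u 1 t)) (fun t => dxx (v t : H2 d.ℓ))
        (Icc 0 d.T) := fun t ht => by
      simp only [he ht]
      exact a2 _ _
    filter_upwards [e3, ae_restrict_mem measurableSet_Ioo] with t h3 ht
    have ht' := Ioo_subset_Icc_self ht
    have := eg ht'
    simp only at this
    rw [h3, a1, conv_congr (eqOn_refl k _) eg ht', this, sub_eq_iff_eq_add, sub_sub]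
    rfl
  have right : (∀ t ∈ Ioo 0 d.T,
      dx (u t) d.ℓ - (∫ s in (0 : ℝ)..t, k s * dx (u (t - s)) d.ℓ) = d.yD y 1 t) ↔
      d.yD y 1 0 = dxL d.ℓ (u 0) ∧ ∀ᵐ t ∂(volume.restrict (Ioo 0 d.T)), d.yD y 2 t =
        dxL d.ℓ (v t : H2 d.ℓ) - d.zD y 0 t * (1 / d.ℓ) - (k t • dxL d.ℓ (u 0) +
          conv k (fun s => dxL d.ℓ (v s : H2 d.ℓ) - d.zD y 0 s * (1 / d.ℓ)) t) := by
    have pg := pu0.clm (dxL d.ℓ)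
    have cg : ContinuousOn (fun t => dxL d.ℓ (d.uD u 1 t)) (Icc 0 d.T) :=
      (dxL d.ℓ).continuous.comp_continuousOn (pu (by norm_num : 1 < 3)).continuousOn
    rw [hd.right_iff hu hk hy]
    refine (IsPrimitiveOn.eqOn_sub_conv_iff hT hkc pg cg
      (hd.y_prim hy (by norm_num : 1 < 3))).trans (and_congr Iff.rfl ?_)
    refine Filter.eventually_congr ?_
    have eg : EqOn (fun t => dxL d.ℓ (d.uD u 1 t))
        (fun t => dxL d.ℓ (v t : H2 d.ℓ) - d.zD y 0 t * (1 / d.ℓ)) (Icc 0 d.T) := fun t ht => by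
      simp only [he ht]
      exact a3 _ _
    filter_upwards [ae_restrict_mem measurableSet_Ioo] with t ht
    have ht' := Ioo_subset_Icc_self ht
    have := eg ht'
    simp only at this
    rw [conv_congr (eqOn_refl k _) eg ht', this]
  have overdet : (∀ t ∈ Icc 0 d.T, ∫ x in (0 : ℝ)..d.ℓ, d.weight x * dx (u t) x = d.f t) ↔
      d.weightL (u 0) = d.f 0 ∧ EqOn (fun t => d.weightL (v t : H2 d.ℓ) -
        d.ψ d.ℓ / d.ℓ * d.zD y 0 t) (d.fD 1) (Icc 0 d.T) := by
    have pf : IsPrimitiveOn 0 d.T d.f (d.fD 1) := hd.f_mem.isPrimitiveOn_zero hT (by norm_num)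
    have cw : ContinuousOn (fun t => d.weightL (d.uD u 1 t)) (Icc 0 d.T) :=
      d.weightL.continuous.comp_continuousOn (pu (by norm_num : 1 < 3)).continuousOn
    have ew : EqOn (fun t => d.weightL (d.uD u 1 t))
        (fun t => d.weightL (v t : H2 d.ℓ) - d.ψ d.ℓ / d.ℓ * d.zD y 0 t) (Icc 0 d.T) :=
      fun t ht => by
        simp only [he ht]
        exact a4 _ _
    simp only [← hd.weightL_apply]
    refine ((pu0.clm d.weightL).eqOn_iff hT pf).trans (and_congr Iff.rfl ⟨fun h => ?_, fun h => ?_⟩)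
    · exact ew.symm.trans (eqOn_Icc_of_ae_eq_Ioo hT cw (hd.f_prim (by norm_num)).continuousOn h)
    · exact (ae_restrict_mem measurableSet_Ioo).mono fun t ht =>
        (ew.trans h) (Ioo_subset_Icc_self ht)
  have hx0 : dxL d.ℓ hd.U₀ = d.u₀D 1 d.ℓ := by rw [dxL_apply hℓ, hd.dx_U₀ hd.ℓ_mem_I]
  constructor
  · intro H
    have hu0 : u 0 = hd.U₀ := ext_H2 hℓ fun x hx => (H.u_init x hx).trans (hd.val_U₀ hx).symm
    have hu1 : d.uD u 1 0 = hd.U₁ :=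
      ext_H2 hℓ fun x hx => (H.ut_init x hx).trans (hd.val_U₁ hx).symm
    obtain ⟨w1, w2⟩ := wave.1 H.wave
    obtain ⟨r1, r2⟩ := right.1 H.right
    obtain ⟨-, o2⟩ := overdet.1 H.overdetermination
    rw [hu0] at w1 w2 r1 r2
    rw [hx0] at r1 r2
    have he0 := he t0
    rw [hu1] at he0
    have hz0 : d.zD y 0 0 = - d.u₁ d.ℓ := by
      rw [← hd.val_U₁ hd.ℓ_mem_I, he0, a6, neg_neg]
    have hv0 : v 0 = hd.V₀ := by
      apply Subtype.ext
      change (v 0 : H2 d.ℓ) = hd.U₁ - d.u₁ d.ℓ • linear hℓ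
      simp only at he0
      rw [he0, hz0, neg_smul, sub_neg_eq_add, add_sub_cancel_right]
    -- The order matters from here on: `v(0)` and the wave equation for `v` give the kernel equation
    -- and so `k(0)`; this gives `y''(0)`, then `z'(0)`, and only then `v_t(0)`.
    have hw := (hd.waveEquation_iff v k y).2 w2
    obtain ⟨-, -, hK⟩ := (hd.overdetermination_iff hv hk hy hw).1 o2
    have hk0 : k 0 = d.k₀ := by
      rw [hK 0 t0, hd.k₀_eq, conv_zero, sub_zero, hv0]
      rfl
    have hb := (hd.boundary_iff_ae hv hk hy).2 r2
    have hy2 : d.yD y 2 0 = d.yTwo₀ := by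
      have := (hd.boundary_iff hv hk hy o2).1 hb 0 t0
      rw [conv_zero, sub_zero, hv0, hk0] at this
      exact this.trans hd.yTwo₀_eq_hInit.symm
    -- `z'(0) = p y''(0) + q y'(0)` with `y''(0) = y₂` and `y'(0) = u₀'(ℓ)`; this is where the
    -- hypothesis on `u₂(ℓ)` enters.
    have hz1 : d.zD y 1 0 = - d.u₂ d.ℓ := by
      rw [zD, h2, r1, hy2, neg_neg]
    -- `u_tt(0)` and `u₂` solve the same Helmholtz equation. Both become elements of `H¹₀ ∩ H²`
    -- after adding the same multiple of `x/ℓ`, so injectivity identifies them.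
    have hv1 : d.vD v 1 0 = hd.V₁ := by
      have e20 := e2 t0
      simp only at e20
      rw [e20, a1, hz1, ← hd.helmholtz_U₂] at w1
      rw [← sub_eq_zero]
      refine helmholtz_injective hℓ hd.β_pos ?_
      change helmholtz d.ℓ d.β ((d.vD v 1 0 : H2 d.ℓ) - (hd.U₂ - d.u₂ d.ℓ • linear hℓ)) = 0
      rw [map_sub, map_sub, map_smul, hd.helmholtz_linear, ← w1, neg_smul]
      abel
    exact ⟨hu0, hv, hk, hy, hw, hb, hd.eq_V₀_iff.2 hv0, hd.eq_V₁_iff.2 hv1,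
      (hd.overdetermination_iff_Icc hv hy).2 o2⟩
  · rintro ⟨hu0, H⟩
    have hv0 := hd.eq_V₀_iff.1 H.v_init
    have hv1 := hd.eq_V₁_iff.1 H.vt_init
    obtain ⟨-, hz0, hz1⟩ := hd.inverse_iff.1 H
    have hu1 : d.uD u 1 0 = hd.U₁ := by
      refine (he t0).trans ?_
      simp only
      rw [hv0, hz0]
      change hd.U₁ - d.u₁ d.ℓ • linear hℓ - (-d.u₁ d.ℓ) • linear hℓ = _
      module
    have hu2 : d.uD u 2 0 = hd.U₂ := by
      refine (e2 t0).trans ?_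
      simp only
      rw [hv1, hz1]
      change hd.U₂ - d.u₂ d.ℓ • linear hℓ - (-d.u₂ d.ℓ) • linear hℓ = _
      module
    -- Conversely, the hypothesis on `u₂(ℓ)` turns the value of `y'(0)` found from `z'(0)` into the
    -- Neumann condition at `t = 0`.
    have hy1 : d.yD y 1 0 = d.u₀D 1 d.ℓ := by
      have hq := hd.q_pos.ne'
      rw [hd.yD_one_zero H, h2]
      field_simp
      ring
    have left : EqOn (fun t => valL d.ℓ 0 (u t)) (fun _ => 0) (Icc 0 d.T) := by
      refine ((pu0.clm (valL d.ℓ 0)).eqOn_iff hT (IsPrimitiveOn.const 0)).2 ⟨?_, ?_⟩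
      · rw [hu0, valL_apply hℓ hd.zero_mem_I, hd.val_U₀ hd.zero_mem_I, h0]
      · filter_upwards [ae_restrict_mem measurableSet_Ioo] with t ht
        rw [he (Ioo_subset_Icc_self ht), valL_apply hℓ hd.zero_mem_I, a5]
    refine ⟨hu, hk, hy, wave.2 ⟨?_, ?_⟩, fun t ht => ?_, right.2 ⟨?_, ?_⟩, fun t ht => ?_,
      fun x hx => ?_, fun x hx => ?_, overdet.2 ⟨?_, ?_⟩⟩
    · rw [hu2, hu0, hd.helmholtz_U₂]
    · rw [hu0]
      exact (hd.waveEquation_iff v k y).1 H.wave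
    · rw [← valL_apply hℓ hd.zero_mem_I]
      exact left (Ioo_subset_Icc_self ht)
    · rw [hu0, hx0, hy1]
    · rw [hu0, hx0]
      exact (hd.boundary_iff_ae hv hk hy).1 H.boundary
    · have e : d.yD y 0 t = y t := hy.wderiv_zero (Ioo_subset_Icc_self ht)
      rw [he (Ioo_subset_Icc_self ht), a6, zD, zero_add, e]
      ring
    · rw [hu0, hd.val_U₀ hx]
    · rw [hu1, hd.val_U₁ hx]
    · rw [hu0, hd.weightL_U₀]
    · exact (hd.overdetermination_iff_Icc hv hy).1 H.overdetermination

/-- Integrate `v - z x/ℓ` from `u₀`; the regularity of `u` is one order above that of `v` and `z`.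
-/
theorem exists_potential {v : ℝ → H2Zero d.ℓ} {y : ℝ → ℝ} (hv : MemH 2 0 d.T v)
    (hy : MemH 3 0 d.T y) :
    ∃ u : ℝ → H2 d.ℓ, MemH 3 0 d.T u ∧ u 0 = hd.U₀ ∧
      EqOn (d.uD u 1) (fun t => (v t : H2 d.ℓ) - d.zD y 0 t • linear hd.ℓ_pos) (Icc 0 d.T) := by
  have hℓ := hd.ℓ_pos
  have hT := hd.T_pos
  have pa0 := (hd.prim_apply_zero hv (ContinuousLinearMap.id ℝ (H2 d.ℓ))).sub
    ((hd.z_prim hy two_pos).smul_const (linear hℓ))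
  have pa1 := (hd.prim_apply hv (ContinuousLinearMap.id ℝ (H2 d.ℓ)) one_lt_two).sub
    ((hd.z_prim hy one_lt_two).smul_const (linear hℓ))
  have hz2 : MemLp (d.zD y 2) 2 (volume.restrict (Ioo 0 d.T)) :=
    ((hy.memLp le_rfl).const_mul d.p).add ((hy.memLp (by norm_num : 2 ≤ 3)).const_mul d.q)
  have hm := (@memLp_clm (H2Zero d.ℓ) (H2 d.ℓ) (Submodule.normedAddCommGroup _)
    (Submodule.normedSpace _) _ _ _ _ (hv.memLp le_rfl) (H2Zero d.ℓ).subtypeL).sub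
    (((ContinuousLinearMap.id ℝ ℝ).smulRight (linear hℓ)).comp_memLp' hz2)
  obtain ⟨h1, h2, -, -⟩ := exists_memH_three hT (IsPrimitiveOn.of_integral
    (integrableOn_Ioo_of_continuousOn pa0.continuousOn) hd.U₀) pa0 pa1 hm
  exact ⟨_, h1, by simp, h2⟩

/-- `u_t + z x/ℓ` vanishes at `x = 0`, by differentiating `u(0, t) = 0` in time, and at `x = ℓ`, by
the acoustic equation `u_t(ℓ) = -z`. -/
theorem exists_inverse_of_original {u : ℝ → H2 d.ℓ} {k y : ℝ → ℝ}
    (H : d.IsOriginalSolution u k y) :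
    ∃ v : ℝ → H2Zero d.ℓ, MemH 2 0 d.T v ∧
      EqOn (d.uD u 1) (fun t => (v t : H2 d.ℓ) - d.zD y 0 t • linear hd.ℓ_pos) (Icc 0 d.T) := by
  have hℓ := hd.ℓ_pos
  have hT := hd.T_pos
  have hu := H.u_mem
  have hy := H.y_mem
  have pu : ∀ {j : ℕ}, j < 3 → IsPrimitiveOn 0 d.T (d.uD u j) (d.uD u (j + 1)) :=
    fun hj => hu.isPrimitiveOn hT hj
  have pu0 : IsPrimitiveOn 0 d.T u (d.uD u 1) := hu.isPrimitiveOn_zero hT three_pos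
  have hz2 : MemLp (d.zD y 2) 2 (volume.restrict (Ioo 0 d.T)) :=
    ((hy.memLp le_rfl).const_mul d.p).add ((hy.memLp (by norm_num : 2 ≤ 3)).const_mul d.q)
  -- A bounded projection onto `H¹₀ ∩ H²`. Applied to the `H²`-valued function and its time
  -- derivatives, it yields a chain of primitives in the subspace; on the function itself it acts as
  -- the identity.
  let P : H2 d.ℓ →L[ℝ] H2Zero d.ℓ := hd.resolvent.comp (helmholtz d.ℓ d.β)
  have hP : ∀ w : H2Zero d.ℓ, P (w : H2 d.ℓ) = w := fun w => (hd.eq_resolvent_iff.2 rfl).symm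
  have clm := fun {g g' : ℝ → H2 d.ℓ} (h : IsPrimitiveOn 0 d.T g g') => 
    @IsPrimitiveOn.clm (H2 d.ℓ) (H2Zero d.ℓ) _ _ (Submodule.normedAddCommGroup _)
      (Submodule.normedSpace _) _ _ _ _ _ inferInstance h P
  have p0 := clm ((pu (by norm_num : 1 < 3)).add ((hd.z_prim hy two_pos).smul_const (linear hℓ)))
  have p1 := clm ((pu (by norm_num : 2 < 3)).add
    ((hd.z_prim hy one_lt_two).smul_const (linear hℓ)))
  have hm := @memLp_clm (H2 d.ℓ) (H2Zero d.ℓ) _ _ (Submodule.normedAddCommGroup _)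
    (Submodule.normedSpace _) _ _ ((hu.memLp le_rfl).add
      (((ContinuousLinearMap.id ℝ ℝ).smulRight (linear hℓ)).comp_memLp' hz2)) P
  obtain ⟨h1, -, -⟩ := exists_memH_two hT p0 p1 hm
  refine ⟨_, h1, fun t ht => ?_⟩
  have left : EqOn (fun t => valL d.ℓ 0 (d.uD u 1 t)) (fun _ => 0) (Icc 0 d.T) := by
    have c : ContinuousOn (fun t => valL d.ℓ 0 (u t)) (Icc 0 d.T) :=
      (valL d.ℓ 0).continuous.comp_continuousOn pu0.continuousOn
    have c' : ContinuousOn (fun t => valL d.ℓ 0 (d.uD u 1 t)) (Icc 0 d.T) :=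
      (valL d.ℓ 0).continuous.comp_continuousOn (pu (by norm_num : 1 < 3)).continuousOn
    refine eqOn_Icc_of_ae_eq_Ioo hT c' continuousOn_const
      ((pu0.clm (valL d.ℓ 0)).ae_eq hT (IsPrimitiveOn.const 0) ?_)
    refine eqOn_Icc_of_eqOn_Ioo hT c continuousOn_const fun t ht => ?_
    rw [valL_apply hℓ hd.zero_mem_I, H.left t ht]
  have right : EqOn (fun t => valL d.ℓ d.ℓ (d.uD u 1 t)) (fun t => - d.zD y 0 t)
      (Icc 0 d.T) := by
    have c' : ContinuousOn (fun t => valL d.ℓ d.ℓ (d.uD u 1 t)) (Icc 0 d.T) :=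
      (valL d.ℓ d.ℓ).continuous.comp_continuousOn (pu (by norm_num : 1 < 3)).continuousOn
    refine eqOn_Icc_of_eqOn_Ioo hT c' (hd.z_prim hy two_pos).continuousOn.neg fun t ht => ?_
    have e : d.yD y 0 t = y t := hy.wderiv_zero (Ioo_subset_Icc_self ht)
    rw [valL_apply hℓ hd.ℓ_mem_I, H.acoustic t ht, zD, zero_add, e]
    ring
  have hmem : d.uD u 1 t + d.zD y 0 t • linear hℓ ∈ H2Zero d.ℓ := by
    have l := left ht
    have r := right ht
    simp only at l r
    rw [mem_H2Zero_iff hℓ, ← valL_apply hℓ hd.zero_mem_I, ← valL_apply hℓ hd.ℓ_mem_I, map_add,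
      map_add, map_smul, map_smul, l, r, valL_apply hℓ hd.zero_mem_I, valL_apply hℓ hd.ℓ_mem_I,
      val_linear hℓ hd.zero_mem_I, val_linear hℓ hd.ℓ_mem_I, div_self hℓ.ne']
    simp
  have := congrArg Subtype.val (hP ⟨_, hmem⟩)
  change _ = (P (d.uD u 1 t + d.zD y 0 t • linear hℓ) : H2 d.ℓ) - _
  rw [this, add_sub_cancel_right]

/-- Uniqueness for the inverse problem gives `v`, `k` and `y`; then `u_t = v - z x/ℓ` and `u(0)`
determine `u`. -/
theorem original_unique (h0 : d.u₀ 0 = 0)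
    (h2 : d.u₂ d.ℓ = -(d.p * d.yTwo₀ + d.q * d.u₀D 1 d.ℓ)) {u u' : ℝ → H2 d.ℓ}
    {k k' y y' : ℝ → ℝ} (H : d.IsOriginalSolution u k y) (H' : d.IsOriginalSolution u' k' y') :
    EqOn u u' (Icc 0 d.T) ∧ EqOn k k' (Icc 0 d.T) ∧ EqOn y y' (Icc 0 d.T) := by
  have hT := hd.T_pos
  obtain ⟨v, hv, he⟩ := hd.exists_inverse_of_original H
  obtain ⟨v', hv', he'⟩ := hd.exists_inverse_of_original H'
  obtain ⟨hu0, hi⟩ := (hd.original_iff h0 h2 H.u_mem hv H.k_mem H.y_mem he).1 H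
  obtain ⟨hu0', hi'⟩ := (hd.original_iff h0 h2 H'.u_mem hv' H'.k_mem H'.y_mem he').1 H'
  obtain ⟨h1, hk, hy⟩ := hd.inverse_unique hi hi'
  refine ⟨?_, hk, hy⟩
  have hy0 : EqOn (d.yD y 0) (d.yD y' 0) (Icc 0 d.T) :=
    H.y_mem.wderiv_zero.trans (hy.trans H'.y_mem.wderiv_zero.symm)
  have hy1 : EqOn (d.yD y 1) (d.yD y' 1) (Icc 0 d.T) := eqOn_Icc_of_ae_eq_Ioo hT
    (hd.y_prim H.y_mem (by norm_num : 1 < 3)).continuousOn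
    (hd.y_prim H'.y_mem (by norm_num : 1 < 3)).continuousOn
    ((hd.y_prim H.y_mem (by norm_num : 0 < 3)).ae_eq hT
      (hd.y_prim H'.y_mem (by norm_num : 0 < 3)) hy0)
  refine ((H.u_mem.isPrimitiveOn_zero hT three_pos).eqOn_iff hT
    (H'.u_mem.isPrimitiveOn_zero hT three_pos)).2 ⟨hu0.trans hu0'.symm, ?_⟩
  filter_upwards [ae_restrict_mem measurableSet_Ioo] with t ht
  have ht' := Ioo_subset_Icc_self ht
  change d.uD u 1 t = d.uD u' 1 t
  refine (he ht').trans (Eq.trans ?_ (he' ht').symm)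
  simp only
  rw [h1 ht', zD, zD, zero_add, hy0 ht', hy1 ht']

theorem val_potential {u : ℝ → H2 d.ℓ} {v : ℝ → H2Zero d.ℓ} {y : ℝ → ℝ} (hu : MemH 3 0 d.T u)
    (hu0 : u 0 = hd.U₀) (he : EqOn (d.uD u 1)
      (fun t => (v t : H2 d.ℓ) - d.zD y 0 t • linear hd.ℓ_pos) (Icc 0 d.T)) {t x : ℝ}
    (ht : t ∈ Icc 0 d.T) (hx : x ∈ Icc 0 d.ℓ) :
    val (u t) x =
      d.u₀ x + ∫ s in (0 : ℝ)..t, (val (v s : H2 d.ℓ) x - d.zD y 0 s * (x / d.ℓ)) := by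
  have h := ((hu.isPrimitiveOn_zero hd.T_pos three_pos).clm (valL d.ℓ x)).eq t ht
  rw [valL_apply hd.ℓ_pos hx, valL_apply hd.ℓ_pos hx, hu0, hd.val_U₀ hx] at h
  rw [h]
  congr 1
  apply intervalIntegral.integral_congr
  rw [uIcc_of_le ht.1]
  intro s hs
  change valL d.ℓ x (d.uD u 1 s) = _
  rw [he ⟨hs.1, hs.2.trans ht.2⟩, valL_apply hd.ℓ_pos hx, hd.val_sub_linear hx]

end Data.Assumptions

end AcousticInverse

/-! ### The main theorem -/

theorem theorem4p3 (d : Data) (hd : d.Assumptions) :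
    ∃ (v : ℝ → H2Zero d.ℓ) (k y : ℝ → ℝ),
      -- existence and uniqueness for the equivalent system
      d.IsEquivalentSolution v k y ∧
      (∀ (v' : ℝ → H2Zero d.ℓ) (k' y' : ℝ → ℝ), d.IsEquivalentSolution v' k' y' →
        EqOn v' v (Icc 0 d.T) ∧ EqOn k' k (Icc 0 d.T)) ∧
      -- existence and uniqueness for the inverse problem in the variables `(v, k, y)`
      d.IsInverseSolution v k y ∧
      (∀ (v' : ℝ → H2Zero d.ℓ) (k' y' : ℝ → ℝ), d.IsInverseSolution v' k' y' →
        EqOn v' v (Icc 0 d.T) ∧ EqOn k' k (Icc 0 d.T) ∧ EqOn y' y (Icc 0 d.T)) ∧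
      -- recovery of the solution of the original problem, when `u₀` satisfies the Dirichlet
      -- condition at `x = 0` and `u₂(ℓ)` is the value of `u_tt(ℓ, 0)` that the problem forces
      (d.u₀ 0 = 0 → d.u₂ d.ℓ = -(d.p * d.yTwo₀ + d.q * d.u₀D 1 d.ℓ) →
        ∃ u : ℝ → H2 d.ℓ,
          (∀ t ∈ Icc 0 d.T, ∀ x ∈ Icc 0 d.ℓ, val (u t) x =
            d.u₀ x + ∫ s in (0 : ℝ)..t, (val (v s : H2 d.ℓ) x - d.zD y 0 s * (x / d.ℓ))) ∧
          d.IsOriginalSolution u k y ∧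
          ∀ (u' : ℝ → H2 d.ℓ) (k' y' : ℝ → ℝ), d.IsOriginalSolution u' k' y' →
            EqOn u' u (Icc 0 d.T) ∧ EqOn k' k (Icc 0 d.T) ∧ EqOn y' y (Icc 0 d.T)) := by
  obtain ⟨v, k, y, H⟩ := hd.exists_inverse
  have hE := hd.inverse_equivalent H
  refine ⟨v, k, y, hE, fun v' k' y' H' => ?_, H, fun v' k' y' H' => hd.inverse_unique H' H,
    fun h0 h2 => ?_⟩
  · obtain ⟨h1, h2, -⟩ := hd.equivalent_unique H' hE
    exact ⟨h1, h2⟩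
  · obtain ⟨u, hu, hu0, he⟩ := hd.exists_potential H.v_mem H.y_mem
    have hO := (hd.original_iff h0 h2 hu H.v_mem H.k_mem H.y_mem he).2 ⟨hu0, H⟩
    exact ⟨u, fun t ht x hx => hd.val_potential hu hu0 he ht hx, hO,
      fun u' k' y' H' => hd.original_unique h0 h2 H' hO⟩
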